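/- Let $k\ge 4$ and $r\ge 1$ be integers with $k$ even, and let $n$ be an odd multiple of $k$. In the One-or-Many Cycles problem $\mathrm{OMC}_{n,k}$ there are two disjoint vertex sets $L,R$ with $|L|=|R|=n/2$, known to both players; Alice is given a perfect matching $M_A$ and Bob a perfect matching $M_B$ between $L$ and $R$, with $M_A\cap M_B=\emptyset$. It is promised that the $2$-regular bipartite graph $G=(L,R,M_A\cup M_B)$ is either a single Hamiltonian cycle (Yes case) or a union of $n/k$ vertex-disjoint cycles of length $k$ (No case), and the goal is to distinguish the two cases. In an $r$-round randomized protocol, Alice and Bob, who share a random string, send one message (a bit string) per round for $r$ rounds, Alice in odd rounds and Bob in even rounds; after round $r$ the receiver of the last message outputs Yes or No. Its communication cost $\|\pi\|$ is the maximum, over all instances and all random strings, of the total number of bits sent, not counting the output. The protocol solves $\mathrm{OMC}_{n,k}$ with probability at least $p$ if on every instance its output is correct with probability at least $p$. There is an absolute constant $K>0$ such that for all such $n,k,r$, every randomized $r$-round protocol $\pi$ that solves $\mathrm{OMC}_{n,k}$ with probability at least $\frac12+\left(\frac kn\right)^2$ satisfies $$\|\pi\|\;\ge\;2^{-K r}\cdot\left(\frac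 nk\right)^{1-10^4\cdot k^{-1/r}} .$$ -/

import Mathlib

universe u

/-! ### The two-party communication model -/

/-- A deterministic `r`-round two-party protocol; Alice holds `x : X`, Bob holds `y : Y`.
A message is an arbitrary (possibly empty) bit string and may depend on the sender's input and on
all earlier messages. Alice speaks in rounds `1, 3, 5, …`, Bob in rounds `2, 4, 6, …`. After round
`r` the player who has just received a message (Bob for odd `r`, Alice for even `r`) computes the
one-bit output from the own input and the transcript. -/
structure DetProtocol (X Y : Type) (r : ℕ) where
  /-- Alice's next message, from her input and the list of all earlier messages. -/
  aliceMsg : X → List (List Bool) → List Bool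
  /-- Bob's next message. -/
  bobMsg : Y → List (List Bool) → List Bool
  /-- The output if it is computed by Alice. -/
  aliceOut : X → List (List Bool) → Bool
  /-- The output if it is computed by Bob. -/
  bobOut : Y → List (List Bool) → Bool

namespace DetProtocol

variable {X Y : Type} {r : ℕ}

/-- The list of the first `i` messages, in chronological order. -/
def transcript (p : DetProtocol X Y r) (x : X) (y : Y) : ℕ → List (List Bool)
  | 0 => []
  | i + 1 =>
    let t := transcript p x y i
    t ++ [if Even i then p.aliceMsg x t else p.bobMsg y t]

/-- The output after `r` rounds. -/
def output (p : DetProtocol X Y r) (x : X) (y : Y) : Bool :=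
  if Even r then p.aliceOut x (p.transcript x y r) else p.bobOut y (p.transcript x y r)

/-- The total number of bits sent in the `r` rounds (the output is not counted). -/
def bits (p : DetProtocol X Y r) (x : X) (y : Y) : ℕ :=
  ((p.transcript x y r).map List.length).sum

end DetProtocol

/-- A randomized `r`-round protocol: a random deterministic protocol, i.e. the players share the
random element `ω`. Private coins are the special case in which `ω` has components that only one
player's functions use. -/
structure RandProtocol (X Y : Type) (r : ℕ) where
  /-- The space of random strings. -/
  Ω : Type u
  /-- Its `σ`-algebra. -/
  mΩ : MeasurableSpace Ω
  /-- The distribution of the random string. -/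
  μ : MeasureTheory.Measure Ω
  isProb : MeasureTheory.IsProbabilityMeasure μ
  /-- The deterministic protocol that is run on the random string `ω`. -/
  det : Ω → DetProtocol X Y r
  /-- On every input, the output is a random variable. -/
  measurable_output : ∀ x y, MeasurableSet {ω | (det ω).output x y = true}

namespace RandProtocol

variable {X Y : Type} {r : ℕ}

/-- The probability that the output on input `(x, y)` is `b`. -/
noncomputable def prob (π : RandProtocol.{u} X Y r) (x : X) (y : Y) (b : Bool) : ℝ :=
  (π.μ {ω | (π.det ω).output x y = b}).toReal

/-- The communication cost: the worst-case number of bits sent, over all the inputs that satisfy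
the promise `P` and all random strings. -/
noncomputable def cost (π : RandProtocol.{u} X Y r) (P : X → Y → Prop) : ℕ∞ :=
  ⨆ (x : X) (y : Y) (_ : P x y) (ω : π.Ω), (((π.det ω).bits x y : ℕ) : ℕ∞)

end RandProtocol

/-! ### The One-or-Many Cycles problem -/

namespace OMC

/-- A perfect matching between the two sides `L = R = Fin (n / 2)` of the vertex set. -/
abbrev Matching (n : ℕ) : Type := Fin (n / 2) ≃ Fin (n / 2)

/-- The bipartite graph on `L ⊔ R` (`n` vertices, for even `n`) with edge set `M_A ∪ M_B`. -/
def graph {n : ℕ} (A B : Matching n) : SimpleGraph (Fin (n / 2) ⊕ Fin (n / 2)) :=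
  SimpleGraph.fromRel fun u v => ∃ i, u = Sum.inl i ∧ (v = Sum.inr (A i) ∨ v = Sum.inr (B i))

/-- The two matchings have no edge in common. -/
def DisjointMatchings {n : ℕ} (A B : Matching n) : Prop := ∀ i, A i ≠ B i

/-- Yes case: the graph is a single Hamiltonian cycle. -/
def IsYes {n : ℕ} (A B : Matching n) : Prop :=
  DisjointMatchings A B ∧ Nonempty (graph A B ≃g SimpleGraph.cycleGraph n)

/-- No case: the graph is a vertex-disjoint union of cycles of length `k` (there are then `n / k`
of them, since the graph has `n` vertices). -/
def IsNo {n : ℕ} (k : ℕ) (A B : Matching n) : Prop :=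
  DisjointMatchings A B ∧
    ∀ c : (graph A B).ConnectedComponent, Nonempty (c.toSimpleGraph ≃g SimpleGraph.cycleGraph k)

/-- The promise of the problem. -/
def Promise (n k : ℕ) (A B : Matching n) : Prop := IsYes A B ∨ IsNo k A B

/-- The protocol solves the problem with probability at least `p`: on every Yes instance it outputs
`true`, and on every No instance `false`, with probability at least `p` over its coins. -/
def Solves {n r : ℕ} (k : ℕ) (π : RandProtocol.{u} (Matching n) (Matching n) r) (p : ℝ) : Prop :=
  ∀ A B : Matching n,
    (IsYes A B → p ≤ π.prob A B true) ∧ (IsNo k A B → p ≤ π.prob A B false)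

end OMC

/-! Write k = 2p and n = mk. Arrange the left vertices in p layers of m vertices, and let Alice's
and Bob's permutations of `Fin m` act alternately between consecutive layers. One tour of the layers
then applies the inverse of the interleaved product a₀b₀a₁b₁⋯. If the product is 1, every walk
closes up after k steps. If it is the inverse of a full rotation, all walks merge into a Hamiltonian
cycle (`exists_matchings_of_altProd`). Since m is odd the rotation is even, so both values lie in
the alternating group G. It remains to show that r rounds with few messages cannot separate two
values of an interleaved product over G of length (2q)^r ≤ p (`condSum_sub_le`).

Round elimination (`condSum_step`): cut the sequences into J = (2q)^(r-1) blocks and each block into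
two halves of length q. Over Γ = G^J the first halves multiply to c and the second halves to p, and
the whole product is the interleaved product of c and p, of length J. The first message says almost
nothing about p, even when Bob's part of the second halves is known. So one may fix the message,
give a uniform p to the first speaker and c to the other player, and let each fill in a compatible
full input. This is a protocol with one round fewer in which the other player starts. Without rounds
the length is 1, and the unseen last factor hides the product completely.

Mixing (`sum_fiberCount_sub_average_le`): it suffices that the law of the product, given the
message, is nearly invariant under shifts that generate Γ. Embed a cube by σ and write aᵢ = dᵢ σ(xᵢ)
γᵢ⁻¹ with γᵢ = bᵢ dᵢ₊₁. The product telescopes to d₀ σ(∑ xᵢ) h⁻¹, while for uniform b the tuples d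
and γ are independent. Conjugation inside Γ then permutes the coordinates of each row xᵢ
independently, so the array x may be assumed randomly permuted row by row.

The law of ∑ xᵢ sees only the Fourier coefficients at frequencies that repeat one U in all q rows.
After random row permutations, each of the C(t,u) frequencies U of weight u averages over C(t,u)^q
arrays, a saving of C(t,u)^(q-1). The level inequality, a consequence of hypercontractivity, bounds
the total weight on these arrays. Only U = 0 and the all-ones U resist, and they are blind to a
shift in two coordinates. Such shifts are products of four disjoint transpositions in G, and at most
m of them give any even permutation.

With s = k^(1/r), q about s/4 and t about m/4, the error is a power of m times (l/t)^q, where l is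
about c·64^r·m^(1/s). Beating a fixed power of m costs a fixed power of m^(1/s) in c, whence the
exponent 1 - O(k^(-1/r)). -/

open Finset

/-! ### Fourier analysis on the discrete cube -/

/-- The nontrivial real character of `ZMod 2`. -/
noncomputable def zsgn (a : ZMod 2) : ℝ := if a = 0 then 1 else -1

@[simp] lemma zsgn_zero : zsgn 0 = 1 := by simp [zsgn]

@[simp] lemma zsgn_one : zsgn 1 = -1 := by simp [zsgn]

lemma zmod_two_cases (a : ZMod 2) : a = 0 ∨ a = 1 := by
  revert a; decide

lemma zsgn_add (a b : ZMod 2) : zsgn (a + b) = zsgn a * zsgn b := by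
  rcases zmod_two_cases a with rfl | rfl <;> rcases zmod_two_cases b with rfl | rfl <;>
    simp [show (1 : ZMod 2) + 1 = 0 from rfl]

lemma abs_zsgn (a : ZMod 2) : |zsgn a| = 1 := by
  rcases zmod_two_cases a with rfl | rfl <;> simp

lemma sum_zmod_two {M : Type*} [AddCommMonoid M] (f : ZMod 2 → M) :
    ∑ a, f a = f 0 + f 1 := Fin.sum_univ_two f

section Cube

variable {ι κ : Type*} [Fintype ι] [Fintype κ]

/-- The character of the cube `ι → ZMod 2` with frequency `U`. -/
noncomputable def chi (U x : ι → ZMod 2) : ℝ := ∏ i, zsgn (U i * x i)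

/-- The Hamming weight. -/
def wt (U : ι → ZMod 2) : ℕ := ∑ i, (U i).val

lemma chi_add_right (U x y : ι → ZMod 2) : chi U (x + y) = chi U x * chi U y := by
  simp [chi, mul_add, zsgn_add, prod_mul_distrib]

lemma chi_comm (U x : ι → ZMod 2) : chi U x = chi x U := by
  simp [chi, mul_comm]

lemma chi_add_left (U V x : ι → ZMod 2) : chi (U + V) x = chi U x * chi V x := by
  rw [chi_comm, chi_add_right, chi_comm x, chi_comm x]

@[simp] lemma chi_zero_left (x : ι → ZMod 2) : chi 0 x = 1 := by simp [chi]

@[simp] lemma chi_zero_right (x : ι → ZMod 2) : chi x 0 = 1 := by simp [chi]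

lemma abs_chi (U x : ι → ZMod 2) : |chi U x| = 1 := by
  simp [chi, abs_prod, abs_zsgn]

lemma chi_sum_right {α : Type*} (s : Finset α) (U : ι → ZMod 2) (x : α → ι → ZMod 2) :
    chi U (∑ i ∈ s, x i) = ∏ i ∈ s, chi U (x i) := by
  classical
  induction s using Finset.induction_on with
  | empty => simp
  | insert a s ha ih => rw [sum_insert ha, prod_insert ha, chi_add_right, ih]

lemma chi_comp_equiv (e : ι ≃ κ) (U x : κ → ZMod 2) : chi (U ∘ e) (x ∘ e) = chi U x :=
  Equiv.prod_comp e fun i => zsgn (U i * x i)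

lemma wt_comp_equiv (e : ι ≃ κ) (U : κ → ZMod 2) : wt (U ∘ e) = wt U :=
  Equiv.sum_comp e fun i => (U i).val

variable [DecidableEq ι]

lemma sum_chi (U : ι → ZMod 2) :
    ∑ x, chi U x = if U = 0 then (2 : ℝ) ^ Fintype.card ι else 0 := by
  split_ifs with h
  · subst h
    simp [ZMod.card]
  · obtain ⟨i, hi⟩ := Function.ne_iff.mp h
    have hi1 : U i = 1 := (zmod_two_cases (U i)).resolve_left hi
    have hs : chi U (Pi.single i 1) = -1 := by
      rw [chi, Finset.prod_eq_single i]
      · simp [hi1]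
      · intro j _ hj; simp [hj]
      · simp
    have h2 : ∑ x, chi U x = ∑ x : ι → ZMod 2, chi U (x + Pi.single i 1) := by
      rw [← Equiv.sum_comp (Equiv.addRight (Pi.single i 1 : ι → ZMod 2)) (chi U)]
      simp only [Equiv.coe_addRight]
    simp only [chi_add_right, hs] at h2
    rw [← sum_mul] at h2
    linarith

/-- Fourier coefficients of a function on the cube. -/
noncomputable def fhat (f : (ι → ZMod 2) → ℝ) (U : ι → ZMod 2) : ℝ :=
  (∑ x, f x * chi U x) / 2 ^ Fintype.card ι

lemma zmod_two_pi_add_self {ι : Type*} (x : ι → ZMod 2) : x + x = 0 := by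
  funext i
  exact CharTwo.add_self_eq_zero (x i)

lemma sum_chi_mul_chi (x y : ι → ZMod 2) :
    ∑ U, chi U x * chi U y = if x = y then (2 : ℝ) ^ Fintype.card ι else 0 := by
  have h : ∀ U : ι → ZMod 2, chi U x * chi U y = chi (x + y) U := fun U => by
    rw [chi_add_left, chi_comm U x, chi_comm U y]
  simp only [h]
  rw [sum_chi]
  have : x + y = 0 ↔ x = y := by
    constructor
    · intro h
      have := congrArg (· + y) h
      simpa [add_assoc, zmod_two_pi_add_self] using this
    · rintro rfl; exact zmod_two_pi_add_self x
  simp [this]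

lemma sum_sq_sum_mul_chi (f : (ι → ZMod 2) → ℝ) :
    ∑ U, (∑ x, f x * chi U x) ^ 2 = 2 ^ Fintype.card ι * ∑ x, f x ^ 2 := by
  calc ∑ U, (∑ x, f x * chi U x) ^ 2
      = ∑ U, ∑ x, ∑ y, (f x * f y) * (chi U x * chi U y) := by
        refine sum_congr rfl fun U _ => ?_
        rw [sq, sum_mul_sum]
        exact sum_congr rfl fun x _ => sum_congr rfl fun y _ => by ring
    _ = ∑ x, ∑ y, (f x * f y) * ∑ U, (chi U x * chi U y) := by
        rw [sum_comm]
        refine sum_congr rfl fun x _ => ?_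
        rw [sum_comm]
        exact sum_congr rfl fun y _ => by rw [mul_sum]
    _ = _ := by
        simp only [sum_chi_mul_chi, mul_ite, mul_zero, sum_ite_eq, mem_univ, if_true]
        rw [mul_sum]
        exact sum_congr rfl fun x _ => by ring

lemma sum_fhat_sq (f : (ι → ZMod 2) → ℝ) :
    ∑ U, fhat f U ^ 2 = (∑ x, f x ^ 2) / 2 ^ Fintype.card ι := by
  have h := sum_sq_sum_mul_chi f
  have h2 : (2 : ℝ) ^ Fintype.card ι ≠ 0 := by positivity
  simp only [fhat, div_pow]
  rw [← sum_div, h]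
  field_simp

end Cube

/-! ### Hypercontractivity -/

/-- Compare the growth from i to i + 1: the left side gains (2j-2i)(2j-2i-1)/((2i+2)(2i+1)), the
binomial on the right (j-i)/(i+1), and the quotient (2j-2i-1)/(2i+1) is at most 2j-1. -/
lemma choose_two_mul_le (j i : ℕ) (h : i ≤ j) :
    ((2 * j).choose (2 * i) : ℝ) ≤ j.choose i * (2 * j - 1 : ℝ) ^ i := by
  induction i with
  | zero => simp
  | succ i ih =>
    have hij : i + 1 ≤ j := h
    have ih := ih (by omega)
    have hj : (i : ℝ) + 1 ≤ j := by exact_mod_cast hij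
    have h1 : ((2 * j).choose (2 * i + 1) : ℝ) * (2 * i + 1) =
        (2 * j).choose (2 * i) * (2 * j - 2 * i) := by
      have := Nat.choose_succ_right_eq (2 * j) (2 * i)
      have h' : ((2 * j - 2 * i : ℕ) : ℝ) = 2 * j - 2 * i := by
        rw [Nat.cast_sub (by omega)]; push_cast; ring
      rw [← h']
      exact_mod_cast this
    have h2 : ((2 * j).choose (2 * (i + 1)) : ℝ) * (2 * i + 2) =
        (2 * j).choose (2 * i + 1) * (2 * j - 2 * i - 1) := by
      have := Nat.choose_succ_right_eq (2 * j) (2 * i + 1)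
      have h' : ((2 * j - (2 * i + 1) : ℕ) : ℝ) = 2 * j - 2 * i - 1 := by
        rw [Nat.cast_sub (by omega)]; push_cast; ring
      rw [← h']
      exact_mod_cast this
    have h3 : (j.choose (i + 1) : ℝ) * (i + 1) = j.choose i * (j - i) := by
      have := Nat.choose_succ_right_eq j i
      have h' : ((j - i : ℕ) : ℝ) = j - i := by rw [Nat.cast_sub (by omega)]
      rw [← h']
      exact_mod_cast this
    have hi0 : (0 : ℝ) ≤ i := Nat.cast_nonneg i
    set P : ℝ := (2 * j - 1 : ℝ) ^ i with hP
    have hP0 : 0 ≤ P := pow_nonneg (by linarith) _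
    have key : ((2 * j).choose (2 * (i + 1)) : ℝ) * ((2 * i + 2) * (2 * i + 1)) ≤
        (j.choose (i + 1) * (2 * j - 1 : ℝ) ^ (i + 1)) * ((2 * i + 2) * (2 * i + 1)) := by
      calc ((2 * j).choose (2 * (i + 1)) : ℝ) * ((2 * i + 2) * (2 * i + 1))
          = (2 * j).choose (2 * i) * ((2 * j - 2 * i) * (2 * j - 2 * i - 1)) := by
            linear_combination (2 * (i : ℝ) + 1) * h2 + (2 * (j : ℝ) - 2 * i - 1) * h1
        _ ≤ (j.choose i * P) * ((2 * j - 2 * i) * (2 * j - 2 * i - 1)) := by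
            apply mul_le_mul_of_nonneg_right ih
            apply mul_nonneg <;> linarith
        _ = (j.choose (i + 1) * (i + 1)) * (2 * P * (2 * j - 2 * i - 1)) := by
            rw [h3]; ring
        _ ≤ (j.choose (i + 1) * (i + 1)) * (2 * P * ((2 * j - 1) * (2 * i + 1))) := by
            apply mul_le_mul_of_nonneg_left _ (by positivity)
            apply mul_le_mul_of_nonneg_left _ (by positivity)
            nlinarith
        _ = _ := by rw [pow_succ, ← hP]; ring
    exact le_of_mul_le_mul_right key (by positivity)

lemma sum_range_two_mul_succ (f : ℕ → ℝ) (j : ℕ) :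
    ∑ i ∈ range (2 * j + 1), f i =
      ∑ i ∈ range (j + 1), f (2 * i) + ∑ i ∈ range j, f (2 * i + 1) := by
  induction j with
  | zero => simp
  | succ j ih =>
    rw [show 2 * (j + 1) + 1 = 2 * j + 1 + 1 + 1 by ring, sum_range_succ, sum_range_succ, ih,
      sum_range_succ _ (j + 1), sum_range_succ (fun i => f (2 * i + 1)) j,
      show 2 * (j + 1) = 2 * j + 1 + 1 by ring]
    ring

/-- The two-point inequality: odd powers of Y cancel, and the even ones are compared term by term
with the expansion of (X² + (2j-1)Y²)^j. -/
lemma add_pow_add_sub_pow_le (X Y : ℝ) (j : ℕ) :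
    (X + Y) ^ (2 * j) + (X - Y) ^ (2 * j) ≤
      2 * ∑ i ∈ range (j + 1), (j.choose i * (2 * j - 1 : ℝ) ^ i) *
        ((X ^ 2) ^ (j - i) * (Y ^ 2) ^ i) := by
  rw [add_comm X Y, show X - Y = -Y + X by ring, add_pow, add_pow, ← sum_add_distrib,
    sum_range_two_mul_succ, mul_sum]
  have h0 : ∑ i ∈ range j, (Y ^ (2 * i + 1) * X ^ (2 * j - (2 * i + 1)) *
      ((2 * j).choose (2 * i + 1) : ℝ) +
      (-Y) ^ (2 * i + 1) * X ^ (2 * j - (2 * i + 1)) * ((2 * j).choose (2 * i + 1) : ℝ)) = 0 := by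
    refine sum_eq_zero fun i _ => ?_
    rw [Odd.neg_pow ⟨i, rfl⟩]
    ring
  rw [h0, add_zero]
  refine sum_le_sum fun i hi => ?_
  have hij : i ≤ j := by simpa [Nat.lt_succ_iff] using hi
  have hc := choose_two_mul_le j i hij
  rw [Even.neg_pow (even_two_mul i), show 2 * j - 2 * i = 2 * (j - i) by omega, pow_mul, pow_mul]
  have h1 : 0 ≤ (X ^ 2) ^ (j - i) * (Y ^ 2) ^ i := by positivity
  nlinarith [mul_le_mul_of_nonneg_right hc h1]

lemma young_pow {a b : ℝ} (ha : 0 ≤ a) (hb : 0 ≤ b) (p i : ℕ) (h : 0 < p + i) :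
    ((p + i : ℕ) : ℝ) * (a ^ p * b ^ i) ≤ p * a ^ (p + i) + i * b ^ (p + i) := by
  have hj : (0 : ℝ) < ((p + i : ℕ) : ℝ) := by exact_mod_cast h
  have := Real.geom_mean_le_arith_mean2_weighted (w₁ := p / ((p + i : ℕ) : ℝ))
    (w₂ := i / ((p + i : ℕ) : ℝ)) (p₁ := a ^ (p + i)) (p₂ := b ^ (p + i))
    (by positivity) (by positivity) (by positivity) (by positivity)
    (by rw [← add_div]; push_cast; push_cast at hj; field_simp)
  have e1 : (a ^ (p + i) : ℝ) ^ ((p : ℝ) / ((p + i : ℕ) : ℝ)) = a ^ p := by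
    rw [← Real.rpow_natCast, ← Real.rpow_mul ha, mul_div_cancel₀ _ hj.ne', Real.rpow_natCast]
  have e2 : (b ^ (p + i) : ℝ) ^ ((i : ℝ) / ((p + i : ℕ) : ℝ)) = b ^ i := by
    rw [← Real.rpow_natCast, ← Real.rpow_mul hb, mul_div_cancel₀ _ hj.ne', Real.rpow_natCast]
  rw [e1, e2] at this
  calc _ ≤ ((p + i : ℕ) : ℝ) * (p / ((p + i : ℕ) : ℝ) * a ^ (p + i) +
        i / ((p + i : ℕ) : ℝ) * b ^ (p + i)) := mul_le_mul_of_nonneg_left this hj.le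
    _ = _ := by field_simp

/-- Hölder's inequality, obtained by applying Young's inequality to X/A and Y/B. If A or B is 0, the
corresponding function vanishes on `s`. -/
lemma sum_pow_mul_pow_le {α : Type*} (s : Finset α) (X Y : α → ℝ) (hX : ∀ x, 0 ≤ X x)
    (hY : ∀ x, 0 ≤ Y x) {A B C : ℝ} (hA : 0 ≤ A) (hB : 0 ≤ B) (p i : ℕ) (h : 0 < p + i)
    (h1 : ∑ x ∈ s, X x ^ (p + i) ≤ C * A ^ (p + i))
    (h2 : ∑ x ∈ s, Y x ^ (p + i) ≤ C * B ^ (p + i)) :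
    ∑ x ∈ s, X x ^ p * Y x ^ i ≤ C * (A ^ p * B ^ i) := by
  rcases Nat.eq_zero_or_pos p with rfl | hp
  · simpa using h2
  rcases Nat.eq_zero_or_pos i with rfl | hi
  · simpa using h1
  have vanish : ∀ (Z : α → ℝ), (∀ x, 0 ≤ Z x) → ∑ x ∈ s, Z x ^ (p + i) ≤ 0 →
      ∀ x ∈ s, Z x = 0 := by
    intro Z hZ hs x hx
    have h0 := (sum_eq_zero_iff_of_nonneg (fun x _ => pow_nonneg (hZ x) (p + i))).1
      (le_antisymm hs (sum_nonneg fun x _ => pow_nonneg (hZ x) _)) x hx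
    exact pow_eq_zero_iff (by omega) |>.1 h0
  rcases hA.eq_or_lt with rfl | hA
  · rw [zero_pow (by omega), mul_zero] at h1
    rw [zero_pow hp.ne', zero_mul, mul_zero]
    exact (sum_eq_zero fun x hx => by rw [vanish X hX h1 x hx, zero_pow hp.ne', zero_mul]).le
  rcases hB.eq_or_lt with rfl | hB
  · rw [zero_pow (by omega), mul_zero] at h2
    rw [zero_pow hi.ne', mul_zero, mul_zero]
    exact (sum_eq_zero fun x hx => by rw [vanish Y hY h2 x hx, zero_pow hi.ne', mul_zero]).le
  have hj : (0 : ℝ) < ((p + i : ℕ) : ℝ) := by exact_mod_cast h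
  have key : ((p + i : ℕ) : ℝ) * ∑ x ∈ s, (X x / A) ^ p * (Y x / B) ^ i ≤
      ((p + i : ℕ) : ℝ) * C := by
    calc ((p + i : ℕ) : ℝ) * ∑ x ∈ s, (X x / A) ^ p * (Y x / B) ^ i
        ≤ ∑ x ∈ s, (p * (X x / A) ^ (p + i) + i * (Y x / B) ^ (p + i)) := by
          rw [mul_sum]
          exact sum_le_sum fun x _ => young_pow (div_nonneg (hX x) hA.le)
            (div_nonneg (hY x) hB.le) p i h
      _ = p * ((∑ x ∈ s, X x ^ (p + i)) / A ^ (p + i)) +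
          i * ((∑ x ∈ s, Y x ^ (p + i)) / B ^ (p + i)) := by
          simp only [div_pow, sum_add_distrib, ← mul_sum, ← sum_div]
      _ ≤ p * C + i * C := by
          gcongr
          · rw [div_le_iff₀ (by positivity)]; exact h1
          · rw [div_le_iff₀ (by positivity)]; exact h2
      _ = _ := by push_cast; ring
  have key2 := le_of_mul_le_mul_left key hj
  simp only [div_pow, div_mul_div_comm] at key2
  rw [← sum_div, div_le_iff₀ (by positivity)] at key2
  exact key2

/-- Induction on the dimension: on the two halves of the cube the function is P₀ + P₁ and P₀ - P₁.
The two-point inequality holds pointwise, Hölder separates the mixed moments, and the binomial sum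
reassembles. -/
lemma hypercontractive_fin (j : ℕ) (hj : 0 < j) (n : ℕ) (c : (Fin n → ZMod 2) → ℝ) :
    ∑ x, (∑ U, c U * chi U x) ^ (2 * j) ≤
      2 ^ n * (∑ U, (2 * j - 1 : ℝ) ^ wt U * c U ^ 2) ^ j := by
  have hw : (0 : ℝ) ≤ 2 * j - 1 := by
    have : (1 : ℝ) ≤ j := by exact_mod_cast hj
    linarith
  induction n with
  | zero => simp [chi, wt, pow_mul]
  | succ n ih =>
    set w : ℝ := 2 * j - 1 with hwdef
    have split : ∀ F : (Fin (n + 1) → ZMod 2) → ℝ,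
        ∑ x, F x = ∑ x : Fin n → ZMod 2, (F (Fin.cons 0 x) + F (Fin.cons 1 x)) := by
      intro F
      rw [← (Fin.consEquiv fun _ => ZMod 2).sum_comp, Fintype.sum_prod_type, sum_zmod_two,
        ← sum_add_distrib]
      rfl
    have chi_cons : ∀ (a b : ZMod 2) (U x : Fin n → ZMod 2),
        chi (Fin.cons a U : Fin (n + 1) → ZMod 2) (Fin.cons b x) = zsgn (a * b) * chi U x := by
      intro a b U x
      simp [chi, Fin.prod_univ_succ]
    have wt_cons : ∀ (a : ZMod 2) (U : Fin n → ZMod 2),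
        wt (Fin.cons a U : Fin (n + 1) → ZMod 2) = a.val + wt U := by
      intro a U
      simp [wt, Fin.sum_univ_succ]
    set P : ZMod 2 → (Fin n → ZMod 2) → ℝ :=
      fun a x => ∑ U, c (Fin.cons a U) * chi U x with hP
    set A : ZMod 2 → ℝ := fun a => ∑ U, w ^ wt U * c (Fin.cons a U) ^ 2 with hA
    have hA0 : ∀ a, 0 ≤ A a := fun a =>
      sum_nonneg fun U _ => mul_nonneg (pow_nonneg hw _) (sq_nonneg _)
    have eP : ∀ b x, ∑ U, c U * chi U (Fin.cons b x) = P 0 x + zsgn b * P 1 x := by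
      intro b x
      rw [split]
      simp only [chi_cons, hP, mul_sum, ← sum_add_distrib]
      refine sum_congr rfl fun U _ => ?_
      simp only [zero_mul, one_mul, zsgn_zero]
      ring
    have eA : ∑ U, w ^ wt U * c U ^ 2 = w * A 1 + A 0 := by
      rw [split]
      simp only [wt_cons, hA, mul_sum, ← sum_add_distrib]
      refine sum_congr rfl fun U _ => ?_
      rw [show (1 : ZMod 2).val = 1 from rfl, show (0 : ZMod 2).val = 0 from rfl]
      ring
    rw [split, eA]
    simp only [eP, zsgn_zero, zsgn_one, one_mul, neg_one_mul, ← sub_eq_add_neg]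
    have ih0 : ∀ a, ∑ x, (P a x ^ 2) ^ j ≤ 2 ^ n * A a ^ j := by
      intro a
      have := ih fun U => c (Fin.cons a U)
      simpa only [pow_mul] using this
    calc ∑ x, ((P 0 x + P 1 x) ^ (2 * j) + (P 0 x - P 1 x) ^ (2 * j))
        ≤ ∑ x, 2 * ∑ i ∈ range (j + 1), (j.choose i * w ^ i) *
            ((P 0 x ^ 2) ^ (j - i) * (P 1 x ^ 2) ^ i) :=
          sum_le_sum fun x _ => add_pow_add_sub_pow_le _ _ j
      _ = 2 * ∑ i ∈ range (j + 1), (j.choose i * w ^ i) *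
            ∑ x, ((P 0 x ^ 2) ^ (j - i) * (P 1 x ^ 2) ^ i) := by
          rw [← mul_sum, sum_comm]
          simp only [mul_sum]
      _ ≤ 2 * ∑ i ∈ range (j + 1), (j.choose i * w ^ i) *
            (2 ^ n * (A 0 ^ (j - i) * A 1 ^ i)) := by
          gcongr with i hi
          have hij : i ≤ j := by simpa [Nat.lt_succ_iff] using hi
          have hji : j - i + i = j := by omega
          apply sum_pow_mul_pow_le _ _ _ (fun x => sq_nonneg _) (fun x => sq_nonneg _)
            (hA0 0) (hA0 1) (j - i) i (by omega)
          · rw [hji]; exact ih0 0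
          · rw [hji]; exact ih0 1
      _ = 2 ^ (n + 1) * (w * A 1 + A 0) ^ j := by
          rw [add_pow, mul_sum, mul_sum]
          refine sum_congr rfl fun i _ => ?_
          rw [mul_pow]; ring

/-- The Bonami inequality between the norms of orders `2 * j` and `2`. -/
lemma hypercontractive {ι : Type*} [Fintype ι] [DecidableEq ι] (j : ℕ) (hj : 0 < j)
    (c : (ι → ZMod 2) → ℝ) :
    ∑ x, (∑ U, c U * chi U x) ^ (2 * j) ≤
      2 ^ Fintype.card ι * (∑ U, (2 * j - 1 : ℝ) ^ wt U * c U ^ 2) ^ j := by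
  set e := (Fintype.equivFin ι).symm
  set E : (ι → ZMod 2) ≃ (Fin (Fintype.card ι) → ZMod 2) := e.symm.arrowCongr (Equiv.refl _)
  have hE : ∀ U, E U = U ∘ e := fun U => by
    funext i; simp [E, Equiv.arrowCongr]
  have h := hypercontractive_fin j hj (Fintype.card ι) fun U => c (E.symm U)
  rw [← E.sum_comp, ← E.sum_comp] at h
  simp only [Equiv.symm_apply_apply] at h
  have h3 : ∀ x : Fin (Fintype.card ι) → ZMod 2, ∑ U, c (E.symm U) * chi U x =
      ∑ U, c U * chi (E U) x := fun x => by
    rw [← E.sum_comp]; simp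
  simp only [h3, hE, chi_comp_equiv, wt_comp_equiv] at h
  exact h

/-- The level inequality: a bound for the Fourier weight of a function with small support on a
family of frequencies of weight `d`. -/
lemma level_inequality {ι : Type*} [Fintype ι] [DecidableEq ι] (g : (ι → ZMod 2) → ℝ)
    (hg : ∀ x, |g x| ≤ 1)
    (s : Finset (ι → ZMod 2)) (d : ℕ) (hs : ∀ U ∈ s, wt U = d) (j : ℕ) (hj : 0 < j) :
    (∑ U ∈ s, fhat g U ^ 2) ^ j ≤
      ((∑ x, |g x|) / 2 ^ Fintype.card ι) ^ (2 * j - 1) * ((2 * j - 1 : ℝ) ^ d) ^ j := by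
  set N : ℝ := 2 ^ Fintype.card ι with hN
  have hN0 : 0 < N := by positivity
  have hw : (0 : ℝ) ≤ 2 * j - 1 := by
    have : (1 : ℝ) ≤ j := by exact_mod_cast hj
    linarith
  set W := ∑ U ∈ s, fhat g U ^ 2 with hW
  have hW0 : 0 ≤ W := sum_nonneg fun _ _ => sq_nonneg _
  set M := ∑ x, |g x| with hM
  have hM0 : 0 ≤ M := sum_nonneg fun _ _ => abs_nonneg _
  rcases hW0.eq_or_lt with h0 | hWpos
  · rw [← h0, zero_pow hj.ne']; positivity
  set c : (ι → ZMod 2) → ℝ := fun U => if U ∈ s then fhat g U else 0 with hc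
  set P : (ι → ZMod 2) → ℝ := fun x => ∑ U, c U * chi U x with hP
  have hNW : N * W = ∑ x, g x * P x := by
    calc N * W = ∑ U, c U * (N * fhat g U) := by
          simp only [hW, hc, ite_mul, zero_mul, sum_ite_mem, univ_inter, mul_sum]
          exact sum_congr rfl fun U _ => by ring
      _ = ∑ U, ∑ x, g x * (c U * chi U x) := by
          refine sum_congr rfl fun U _ => ?_
          rw [fhat, mul_div_cancel₀ _ hN0.ne', mul_sum]
          exact sum_congr rfl fun x _ => by ring
      _ = _ := by rw [sum_comm]; simp only [hP, mul_sum]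
  have hMpos : 0 < M := by
    rcases hM0.eq_or_lt with h0 | h
    · exfalso
      have hz : ∀ x, g x = 0 := fun x => by
        have := (sum_eq_zero_iff_of_nonneg (fun x _ => abs_nonneg (g x))).1 h0.symm x (mem_univ x)
        simpa using this
      simp only [hz, zero_mul, sum_const_zero] at hNW
      have : 0 < N * W := by positivity
      linarith
    · exact h
  -- Jensen with the probability weights |g|/M; afterwards |g| ≤ 1 removes the remaining weight.
  -- This turns small support into the factor M^(2j-1).
  have hJ : (N * W) ^ (2 * j) ≤ M ^ (2 * j - 1) * ∑ x, P x ^ (2 * j) := by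
    have h1 : N * W ≤ M * ∑ x, (|g x| / M) * |P x| := by
      rw [hNW, mul_sum]
      refine sum_le_sum fun x _ => ?_
      rw [← mul_assoc, mul_div_cancel₀ _ hMpos.ne', ← abs_mul]
      exact le_abs_self _
    have h2 := Real.pow_arith_mean_le_arith_mean_pow univ (fun x => |g x| / M) (fun x => |P x|)
      (fun x _ => by positivity) (by rw [← sum_div, ← hM, div_self hMpos.ne'])
      (fun x _ => abs_nonneg _) (2 * j)
    calc (N * W) ^ (2 * j) ≤ (M * ∑ x, (|g x| / M) * |P x|) ^ (2 * j) :=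
          pow_le_pow_left₀ (by positivity) h1 _
      _ = M ^ (2 * j) * (∑ x, (|g x| / M) * |P x|) ^ (2 * j) := mul_pow _ _ _
      _ ≤ M ^ (2 * j) * ∑ x, (|g x| / M) * |P x| ^ (2 * j) := by gcongr
      _ = M ^ (2 * j - 1) * ∑ x, |g x| * P x ^ (2 * j) := by
          rw [show M ^ (2 * j) = M ^ (2 * j - 1) * M by rw [← pow_succ]; congr 1; omega,
            mul_assoc, mul_sum]
          congr 1
          refine sum_congr rfl fun x _ => ?_
          rw [Even.pow_abs (even_two_mul j)]
          field_simp
      _ ≤ _ := by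
          gcongr with x
          have h0 : 0 ≤ P x ^ (2 * j) := by rw [pow_mul]; positivity
          nlinarith [hg x]
  have hH := hypercontractive j hj c
  have hcW : ∑ U, (2 * j - 1 : ℝ) ^ wt U * c U ^ 2 = (2 * j - 1 : ℝ) ^ d * W := by
    rw [hW, mul_sum, ← sum_subset (subset_univ s)]
    · refine sum_congr rfl fun U hU => ?_
      rw [hs U hU]; simp [hc, hU]
    · intro U _ hU; simp [hc, hU]
  rw [hcW] at hH
  have hfin : (N * W) ^ (2 * j) ≤ M ^ (2 * j - 1) * (N * ((2 * j - 1 : ℝ) ^ d * W) ^ j) :=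
    hJ.trans (by gcongr)
  have e1 : (N * W) ^ (2 * j) = (W ^ j) * (W ^ j * (N ^ (2 * j - 1) * N)) := by
    rw [← pow_succ, show 2 * j - 1 + 1 = 2 * j by omega, mul_pow, two_mul, pow_add, pow_add]
    ring
  have e2 : M ^ (2 * j - 1) * (N * ((2 * j - 1 : ℝ) ^ d * W) ^ j) =
      ((M / N) ^ (2 * j - 1) * ((2 * j - 1 : ℝ) ^ d) ^ j) * (W ^ j * (N ^ (2 * j - 1) * N)) := by
    rw [div_pow, mul_pow]
    field_simp
  rw [e1, e2] at hfin
  exact le_of_mul_le_mul_right hfin (by positivity)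

/-! ### Sums along randomly permuted rows of a Boolean array -/

section Gap

variable {q t : ℕ}

/-- The sum of the rows of a Boolean array. -/
def rowSum (x : Fin q × Fin t → ZMod 2) : Fin t → ZMod 2 := fun v => ∑ i, x (i, v)

/-- The (unnormalized) distance between the `φ`-weighted distribution of the row sum and its
translate by `e`. -/
noncomputable def gap (φ : (Fin q × Fin t → ZMod 2) → ℝ) (e : Fin t → ZMod 2) : ℝ :=
  ∑ y, |∑ x, φ x * ((if rowSum x = y then 1 else 0) - (if rowSum x = y + e then 1 else 0))|

/-- The permutation of the array that permutes row `i` by `B i`. -/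
def rowPerm (B : Fin q → Equiv.Perm (Fin t)) : Equiv.Perm (Fin q × Fin t) :=
  Equiv.prodShear (Equiv.refl _) B

lemma chi_rowSum (U : Fin t → ZMod 2) (x : Fin q × Fin t → ZMod 2) :
    chi U (rowSum x) = chi (U ∘ Prod.snd) x := by
  have : rowSum x = ∑ i, fun v => x (i, v) := by
    funext v; simp [rowSum]
  rw [this, chi_sum_right]
  simp [chi, Fintype.prod_prod_type]

/-- Cauchy–Schwarz and Parseval for the law of the row sum. Its coefficient at U is that of φ at the
frequency repeating U in every row, and a translation by e multiplies it by `chi U e`. -/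
lemma gap_sq_le (φ : (Fin q × Fin t → ZMod 2) → ℝ) (e : Fin t → ZMod 2) :
    gap φ e ^ 2 ≤ (2 ^ (q * t)) ^ 2 *
      ∑ U : Fin t → ZMod 2, (1 - chi U e) ^ 2 * fhat φ (U ∘ Prod.snd) ^ 2 := by
  set Y : (Fin t → ZMod 2) → ℝ := fun y =>
    ∑ x, φ x * ((if rowSum x = y then 1 else 0) - (if rowSum x = y + e then 1 else 0)) with hY
  have h1 : gap φ e ^ 2 ≤ 2 ^ t * ∑ y, Y y ^ 2 := by
    have := sq_sum_le_card_mul_sum_sq (s := (univ : Finset (Fin t → ZMod 2))) (f := fun y => |Y y|)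
    simpa [gap, hY, ZMod.card] using this
  have h2 := sum_sq_sum_mul_chi Y
  rw [Fintype.card_fin] at h2
  rw [← h2] at h1
  refine h1.trans (le_of_eq ?_)
  rw [mul_sum]
  refine sum_congr rfl fun U _ => ?_
  have h3 : ∑ y, Y y * chi U y = (1 - chi U e) * ∑ x, φ x * chi (U ∘ Prod.snd) x := by
    calc ∑ y, Y y * chi U y
        = ∑ x, φ x * ∑ y, ((if rowSum x = y then 1 else 0) -
            (if rowSum x = y + e then 1 else 0)) * chi U y := by
          simp only [hY, sum_mul, mul_sum]
          rw [sum_comm]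
          exact sum_congr rfl fun x _ => sum_congr rfl fun y _ => by ring
      _ = _ := by
          rw [mul_sum]
          refine sum_congr rfl fun x _ => ?_
          have h4 : ∀ y, (rowSum x = y + e) ↔ (rowSum x + e = y) := fun y => by
            constructor
            · intro h; rw [h, add_assoc, zmod_two_pi_add_self, add_zero]
            · rintro rfl; rw [add_assoc, zmod_two_pi_add_self, add_zero]
          simp only [h4, sub_mul, sum_sub_distrib, ite_mul, one_mul, zero_mul, sum_ite_eq,
            mem_univ, if_true]
          rw [chi_add_right, ← chi_rowSum]
          ring
  rw [h3, fhat, Fintype.card_prod, Fintype.card_fin, Fintype.card_fin]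
  field_simp

lemma gap_le (φ : (Fin q × Fin t → ZMod 2) → ℝ) (e : Fin t → ZMod 2) :
    gap φ e ≤ 2 * ∑ x, |φ x| := by
  calc gap φ e ≤ ∑ y, ∑ x, |φ x| * ((if rowSum x = y then 1 else 0) +
        (if rowSum x + e = y then 1 else 0)) := by
        refine sum_le_sum fun y _ => (abs_sum_le_sum_abs _ _).trans (sum_le_sum fun x _ => ?_)
        have h4 : (rowSum x = y + e) ↔ (rowSum x + e = y) := by
          constructor
          · intro h; rw [h, add_assoc, zmod_two_pi_add_self, add_zero]
          · rintro rfl; rw [add_assoc, zmod_two_pi_add_self, add_zero]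
        rw [abs_mul]
        simp only [h4]
        refine mul_le_mul_of_nonneg_left ?_ (abs_nonneg _)
        split_ifs <;> norm_num
    _ = _ := by
        rw [sum_comm, mul_sum]
        refine sum_congr rfl fun x _ => ?_
        rw [← mul_sum, sum_add_distrib]
        simp
        ring

lemma fhat_comp_rowPerm (φ : (Fin q × Fin t → ZMod 2) → ℝ) (B : Fin q → Equiv.Perm (Fin t))
    (V : Fin q × Fin t → ZMod 2) :
    fhat (fun x => φ (x ∘ rowPerm B)) V = fhat φ (V ∘ rowPerm B) := by
  unfold fhat
  congr 1
  set E : (Fin q × Fin t → ZMod 2) ≃ (Fin q × Fin t → ZMod 2) :=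
    (rowPerm B).symm.arrowCongr (Equiv.refl _)
  have hE : ∀ U, E U = U ∘ rowPerm B := fun U => by
    funext i; simp [E, Equiv.arrowCongr]
  rw [← E.sum_comp fun x => φ x * chi (V ∘ rowPerm B) x]
  simp only [hE, chi_comp_equiv]

/-! ### Averaging Fourier weight over row permutations -/

/-- The arrays all of whose rows have weight `u`. -/
def rowLevel (q t u : ℕ) : Finset (Fin q × Fin t → ZMod 2) :=
  univ.filter fun V => ∀ i, wt (fun v => V (i, v)) = u

lemma wt_eq_card (U : Fin t → ZMod 2) : wt U = Fintype.card {v // U v = 1} := by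
  rw [Fintype.card_subtype, wt, card_filter]
  refine sum_congr rfl fun v _ => ?_
  rcases zmod_two_cases (U v) with h | h <;> rw [h] <;> rfl

lemma wt_add_one (U : Fin t → ZMod 2) : wt (U + 1) + wt U = t := by
  rw [wt, wt, ← sum_add_distrib]
  have : ∀ v, ((U + 1) v).val + (U v).val = 1 := fun v => by
    rcases zmod_two_cases (U v) with h | h <;> simp only [Pi.add_apply, Pi.one_apply, h] <;> rfl
  rw [sum_congr rfl fun v _ => this v]
  simp

lemma card_wt_eq_le (t u : ℕ) :
    (univ.filter fun U : Fin t → ZMod 2 => wt U = u).card ≤ t.choose u := by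
  have : t.choose u = ((univ : Finset (Fin t)).powersetCard u).card := by simp
  rw [this]
  refine card_le_card_of_injOn (fun U => univ.filter fun v => U v = 1) ?_ ?_
  · intro U hU
    simp only [coe_filter, mem_univ, true_and, Set.mem_ofPred_eq] at hU
    simp only [mem_coe, mem_powersetCard, subset_univ, true_and]
    rw [← hU, wt_eq_card, Fintype.card_subtype]
  · intro U _ V _ h
    funext v
    have hv := Finset.ext_iff.1 h v
    simp only [mem_filter, mem_univ, true_and] at hv
    rcases zmod_two_cases (U v) with h1 | h1 <;> rcases zmod_two_cases (V v) with h2 | h2 <;>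
      simp_all

/-- If the set is nonempty, it is a coset of the stabilizer of U, which permutes the ones and the
zeros of U separately. -/
lemma card_comp_perm_eq_le (U U' : Fin t → ZMod 2) :
    (univ.filter fun β : Equiv.Perm (Fin t) => U ∘ β = U').card ≤
      (wt U).factorial * (t - wt U).factorial := by
  rcases (univ.filter fun β : Equiv.Perm (Fin t) => U ∘ β = U').eq_empty_or_nonempty
    with h | ⟨β₀, h⟩
  · rw [h]; simp
  simp only [mem_filter, mem_univ, true_and] at h
  have h1 : (univ.filter fun β : Equiv.Perm (Fin t) => U ∘ β = U').card ≤
      (univ.filter fun β : Equiv.Perm (Fin t) => U ∘ β = U).card := by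
    refine card_le_card_of_injOn (fun β => β * β₀⁻¹) ?_ (fun _ _ _ _ h => mul_right_cancel h)
    intro β hβ
    simp only [coe_filter, mem_univ, true_and, Set.mem_ofPred_eq] at hβ ⊢
    funext v
    have := congrFun (hβ.trans h.symm) (β₀⁻¹ v)
    simpa using this
  refine h1.trans (le_of_eq ?_)
  rw [← Fintype.card_subtype, DomMulAct.stabilizer_card]
  have h2 : Fintype.card {v // U v = 0} = t - wt U := by
    have h3 := wt_add_one U
    rw [wt_eq_card (U + 1)] at h3
    have : Fintype.card {v // U v = 0} = Fintype.card {v // (U + 1) v = 1} :=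
      Fintype.card_congr (Equiv.subtypeEquivRight fun v => by simp)
    omega
  rw [show (univ : Finset (ZMod 2)) = {0, 1} from rfl, prod_pair (by decide), h2, ← wt_eq_card,
    mul_comm]

lemma sum_comp_rowPerm_le (F : (Fin q × Fin t → ZMod 2) → ℝ) (hF : ∀ V, 0 ≤ F V)
    (U : Fin t → ZMod 2) :
    ∑ B : Fin q → Equiv.Perm (Fin t), F ((U ∘ Prod.snd) ∘ rowPerm B) ≤
      (((wt U).factorial * (t - wt U).factorial : ℕ) : ℝ) ^ q *
        ∑ V ∈ rowLevel q t (wt U), F V := by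
  calc ∑ B : Fin q → Equiv.Perm (Fin t), F ((U ∘ Prod.snd) ∘ rowPerm B)
      = ∑ V ∈ rowLevel q t (wt U), ∑ B ∈ univ.filter
          (fun B : Fin q → Equiv.Perm (Fin t) => (U ∘ Prod.snd) ∘ rowPerm B = V),
          F ((U ∘ Prod.snd) ∘ rowPerm B) := by
        symm
        apply sum_fiberwise_of_maps_to
        intro B _
        simp only [rowLevel, mem_filter, mem_univ, true_and]
        intro i
        exact wt_comp_equiv (B i) U
    _ = ∑ V ∈ rowLevel q t (wt U), ((univ.filter
          (fun B : Fin q → Equiv.Perm (Fin t) => (U ∘ Prod.snd) ∘ rowPerm B = V)).card : ℝ) *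
          F V := by
        refine sum_congr rfl fun V _ => ?_
        rw [sum_congr rfl (g := fun _ => F V) (fun B hB => by rw [(mem_filter.1 hB).2]), sum_const,
          nsmul_eq_mul]
    _ ≤ _ := by
        rw [mul_sum]
        refine sum_le_sum fun V _ => mul_le_mul_of_nonneg_right ?_ (hF V)
        have h : (univ.filter
            (fun B : Fin q → Equiv.Perm (Fin t) => (U ∘ Prod.snd) ∘ rowPerm B = V)) =
            Fintype.piFinset fun i => univ.filter fun β : Equiv.Perm (Fin t) =>
              U ∘ β = fun v => V (i, v) := by
          ext B
          simp only [mem_filter, mem_univ, true_and, Fintype.mem_piFinset, funext_iff]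
          constructor
          · intro h i v; exact h (i, v)
          · rintro h ⟨i, v⟩; exact h i v
        rw [h, Fintype.card_piFinset]
        calc ((∏ i : Fin q, (univ.filter fun β : Equiv.Perm (Fin t) =>
              U ∘ β = fun v => V (i, v)).card : ℕ) : ℝ)
            ≤ ((∏ _i : Fin q, ((wt U).factorial * (t - wt U).factorial) : ℕ) : ℝ) := by
              exact_mod_cast prod_le_prod' fun i _ => card_comp_perm_eq_le U _
          _ = _ := by simp

/-- There are C(t,u) frequencies U of weight u, and each is spread over the C(t,u)^q arrays of
`rowLevel q t u`. So the mean contribution of level u is its weight divided by C(t,u)^(q-1), which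
is the normalization of κ. There are at most t levels. -/
lemma sum_rowPerm_fhat_le (hq : 0 < q) (φ : (Fin q × Fin t → ZMod 2) → ℝ) (c : (Fin t → ZMod 2) → ℝ)
    (hc4 : ∀ U, c U ≤ 4) (hc0 : ∀ U, c U ≠ 0 → 0 < wt U ∧ wt U < t) {κ : ℝ}
    (hκ0 : 0 ≤ κ)
    (hκ : ∀ u, 0 < u → u < t →
      ∑ V ∈ rowLevel q t u, fhat φ V ^ 2 ≤ κ * (t.choose u : ℝ) ^ (q - 1)) :
    ∑ B : Fin q → Equiv.Perm (Fin t), ∑ U, c U * fhat φ ((U ∘ Prod.snd) ∘ rowPerm B) ^ 2 ≤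
      (t.factorial : ℝ) ^ q * (4 * t * κ) := by
  set u' : Finset ℕ := (range t).filter (fun u => 0 < u)
  calc ∑ B : Fin q → Equiv.Perm (Fin t), ∑ U, c U * fhat φ ((U ∘ Prod.snd) ∘ rowPerm B) ^ 2
      = ∑ U, c U * ∑ B : Fin q → Equiv.Perm (Fin t),
          fhat φ ((U ∘ Prod.snd) ∘ rowPerm B) ^ 2 := by
        rw [sum_comm]; simp only [mul_sum]
    _ = ∑ U ∈ univ.filter (fun U => c U ≠ 0), c U * ∑ B : Fin q → Equiv.Perm (Fin t),
          fhat φ ((U ∘ Prod.snd) ∘ rowPerm B) ^ 2 := by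
        symm
        apply sum_subset (filter_subset _ _)
        intro U _ hU
        have : c U = 0 := by simpa using hU
        rw [this, zero_mul]
    _ = ∑ u ∈ u', ∑ U ∈ (univ.filter (fun U => c U ≠ 0)).filter (fun U => wt U = u),
          c U * ∑ B : Fin q → Equiv.Perm (Fin t), fhat φ ((U ∘ Prod.snd) ∘ rowPerm B) ^ 2 := by
        symm
        apply sum_fiberwise_of_maps_to
        intro U hU
        have := hc0 U (by simpa using hU)
        simp [u', this.1, this.2]
    _ ≤ ∑ u ∈ u', (t.factorial : ℝ) ^ q * (4 * κ) := by
        refine sum_le_sum fun u hu => ?_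
        obtain ⟨hut, hu0⟩ : u < t ∧ 0 < u := by simpa [u'] using hu
        have hfac : u.factorial * (t - u).factorial * t.choose u = t.factorial := by
          rw [← Nat.choose_mul_factorial_mul_factorial hut.le]; ring
        set Cc : ℝ := (t.choose u : ℝ) with hCc
        set f : ℝ := ((u.factorial * (t - u).factorial : ℕ) : ℝ) with hf
        have hfC : f * Cc = t.factorial := by rw [hf, hCc]; exact_mod_cast hfac
        have hCc0 : 0 ≤ Cc := Nat.cast_nonneg _
        have hf0 : 0 ≤ f := Nat.cast_nonneg _
        have hterm : ∀ U ∈ (univ.filter (fun U => c U ≠ 0)).filter (fun U => wt U = u),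
            c U * ∑ B : Fin q → Equiv.Perm (Fin t), fhat φ ((U ∘ Prod.snd) ∘ rowPerm B) ^ 2 ≤
              4 * (f ^ q * (κ * Cc ^ (q - 1))) := by
          intro U hU
          have hwt : wt U = u := (mem_filter.1 hU).2
          have h1 := sum_comp_rowPerm_le (q := q) (fun V => fhat φ V ^ 2) (fun V => sq_nonneg _) U
          rw [hwt] at h1
          have h2 : f ^ q * ∑ V ∈ rowLevel q t u, fhat φ V ^ 2 ≤ f ^ q * (κ * Cc ^ (q - 1)) :=
            mul_le_mul_of_nonneg_left (hκ u hu0 hut) (by positivity)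
          exact mul_le_mul (hc4 U) (h1.trans h2) (sum_nonneg fun _ _ => sq_nonneg _) (by norm_num)
        refine (sum_le_sum hterm).trans ?_
        rw [sum_const, nsmul_eq_mul]
        have hcard : ((((univ.filter (fun U => c U ≠ 0)).filter
            (fun U : Fin t → ZMod 2 => wt U = u)).card : ℕ) : ℝ) ≤ Cc := by
          rw [hCc]
          exact_mod_cast (card_le_card (filter_subset_filter _ (subset_univ _))).trans
            (card_wt_eq_le t u)
        calc _ ≤ Cc * (4 * (f ^ q * (κ * Cc ^ (q - 1)))) :=
              mul_le_mul_of_nonneg_right hcard (by positivity)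
          _ = (f * Cc) ^ q * (4 * κ) := by
              rw [mul_pow]
              conv_rhs => rw [show q = q - 1 + 1 by omega, pow_succ Cc]
              rw [show q - 1 + 1 = q by omega]
              ring
          _ = _ := by rw [hfC]
    _ ≤ _ := by
        rw [sum_const, nsmul_eq_mul]
        have : ((u'.card : ℕ) : ℝ) ≤ t := by
          exact_mod_cast (card_filter_le _ _).trans (by simp)
        calc _ ≤ (t : ℝ) * ((t.factorial : ℝ) ^ q * (4 * κ)) :=
              mul_le_mul_of_nonneg_right this (by positivity)
          _ = _ := by ring

/-! ### Fourier weight of a level against binomial coefficients -/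

lemma choose_le_choose_of_le_half {n a b : ℕ} (hab : a ≤ b) (hb : 2 * b ≤ n) :
    n.choose a ≤ n.choose b := by
  induction b, hab using Nat.le_induction with
  | base => exact le_rfl
  | succ b _ ih => exact (ih (by omega)).trans (Nat.choose_le_succ_of_lt_half_left (by omega))

lemma div_pow_le_choose {n v : ℕ} (hv : 0 < v) (h : 2 * v ≤ n) :
    ((n : ℝ) / (2 * v)) ^ v ≤ n.choose v := by
  have h1 := Nat.pow_le_choose (α := ℝ) v n
  have hv' : (0 : ℝ) < v := by exact_mod_cast hv
  refine le_trans ?_ h1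
  rw [div_pow, mul_pow, le_div_iff₀ (by positivity), div_mul_eq_mul_div,
    div_le_iff₀ (by positivity)]
  have h2 : (v.factorial : ℝ) ≤ (v : ℝ) ^ v := by exact_mod_cast Nat.factorial_le_pow v
  have h3 : (n : ℝ) ≤ ((n + 1 - v : ℕ) : ℝ) * 2 := by
    exact_mod_cast (by omega : n ≤ (n + 1 - v) * 2)
  calc (n : ℝ) ^ v * v.factorial ≤ (((n + 1 - v : ℕ) : ℝ) * 2) ^ v * (v : ℝ) ^ v := by gcongr
    _ = _ := by rw [mul_pow]; ring

lemma wt_of_mem_rowLevel {u : ℕ} {V : Fin q × Fin t → ZMod 2} (hV : V ∈ rowLevel q t u) :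
    wt V = u * q := by
  have h : ∀ i, wt (fun v => V (i, v)) = u := (mem_filter.1 hV).2
  rw [wt, Fintype.sum_prod_type]
  have h' : ∀ i, ∑ v, (V (i, v)).val = u := h
  rw [sum_congr rfl fun i _ => h' i]
  simp [mul_comm]

/-- The level inequality with j = ⌈l/u⌉ loses a factor μ^(-1/j) against μ². As μ ≥ 2^(-ql), this is
at most 2^(uq), and 2j-1 ≤ 3l/u; together they give 6l/u. -/
lemma rowLevel_weight_le (φ : (Fin q × Fin t → ZMod 2) → ℝ) (hφ : ∀ x, |φ x| ≤ 1)
    {μ : ℝ} (hμ : μ = (∑ x, |φ x|) / 2 ^ (q * t)) {l : ℕ} (hμl : 1 ≤ μ * 2 ^ (q * l))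
    {u : ℕ} (hu : 0 < u) (hul : u ≤ l) :
    ∑ V ∈ rowLevel q t u, fhat φ V ^ 2 ≤ μ ^ 2 * ((6 * l / u : ℝ) ^ u) ^ q := by
  have hμ0 : 0 < μ := pos_of_mul_pos_left (lt_of_lt_of_le one_pos hμl) (by positivity)
  set j := (l + u - 1) / u with hj
  have hju : l ≤ j * u := by
    have := Nat.div_add_mod (l + u - 1) u
    have h2 := Nat.mod_lt (l + u - 1) hu
    rw [← hj] at this
    rw [mul_comm]
    omega
  have hju2 : j * u ≤ l + u - 1 := Nat.div_mul_le_self _ _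
  have hj0 : 0 < j := Nat.pos_of_ne_zero fun h => by rw [h] at hju; omega
  have hlev := level_inequality φ hφ (rowLevel q t u) (u * q) (fun V hV => wt_of_mem_rowLevel hV) j
    hj0
  rw [Fintype.card_prod, Fintype.card_fin, Fintype.card_fin, ← hμ] at hlev
  set W := ∑ V ∈ rowLevel q t u, fhat φ V ^ 2
  have hu' : (0 : ℝ) < u := by exact_mod_cast hu
  have hj1 : (1 : ℝ) ≤ j := by exact_mod_cast hj0
  have hw : (2 * j - 1 : ℝ) ≤ 3 * l / u := by
    rw [le_div_iff₀ hu']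
    have h1 : ((j * u : ℕ) : ℝ) + 1 ≤ ((l + u : ℕ) : ℝ) := by
      exact_mod_cast (by omega : j * u + 1 ≤ l + u)
    have h2 : (u : ℝ) ≤ l := by exact_mod_cast hul
    push_cast at h1
    nlinarith
  have h1 : W ^ j ≤ (μ ^ 2 * ((6 * l / u : ℝ) ^ u) ^ q) ^ j := by
    calc W ^ j ≤ μ ^ (2 * j - 1) * ((2 * j - 1 : ℝ) ^ (u * q)) ^ j := hlev
      _ ≤ (μ ^ (2 * j) * (2 ^ (u * q)) ^ j) * ((3 * l / u : ℝ) ^ (u * q)) ^ j := by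
          have hw0 : (0 : ℝ) ≤ 2 * j - 1 := by linarith
          gcongr
          calc μ ^ (2 * j - 1) ≤ μ ^ (2 * j - 1) * (μ * 2 ^ (q * l)) :=
                le_mul_of_one_le_right (by positivity) hμl
            _ = μ ^ (2 * j) * 2 ^ (q * l) := by
                rw [← mul_assoc, ← pow_succ]; congr 2; omega
            _ ≤ μ ^ (2 * j) * (2 ^ (u * q)) ^ j := by
                rw [← pow_mul]
                refine mul_le_mul_of_nonneg_left (pow_le_pow_right₀ one_le_two ?_) (by positivity)
                calc q * l ≤ q * (j * u) := Nat.mul_le_mul_left _ hju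
                  _ = u * q * j := by ring
      _ = _ := by
          rw [mul_assoc, ← mul_pow, ← mul_pow, pow_mul μ 2 j, ← mul_pow, ← pow_mul _ u q,
            show (2 * (3 * l / u) : ℝ) = 6 * l / u by ring]
  exact le_of_pow_le_pow_left₀ hj0.ne' (by positivity) h1

lemma rowLevel_bound_of_le_half (hq : 0 < q) (φ : (Fin q × Fin t → ZMod 2) → ℝ)
    (hφ : ∀ x, |φ x| ≤ 1) {μ : ℝ} (hμ : μ = (∑ x, |φ x|) / 2 ^ (q * t)) {l : ℕ} (hl : 0 < l)
    (hμl : 1 ≤ μ * 2 ^ (q * l)) (hX : (t : ℝ) * (12 * l / t : ℝ) ^ q ≤ 1)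
    {u : ℕ} (hu : 0 < u) (hut : 2 * u ≤ t) :
    ∑ V ∈ rowLevel q t u, fhat φ V ^ 2 ≤
      μ ^ 2 * (t * (12 * l / t : ℝ) ^ q) * (t.choose u : ℝ) ^ (q - 1) := by
  have hμ0 : 0 < μ := pos_of_mul_pos_left (lt_of_lt_of_le one_pos hμl) (by positivity)
  -- From level l on, Parseval together with μ ≥ 2^(-ql) gives the bound of level l. Since binomials
  -- increase up to the middle, C(t,v) ≤ C(t,u), so this is still enough.
  set v := min u l with hv
  have hv0 : 0 < v := lt_min hu hl
  have hvu : v ≤ u := min_le_left _ _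
  have hvl : v ≤ l := min_le_right _ _
  have hv' : (0 : ℝ) < v := by exact_mod_cast hv0
  have hv1 : (1 : ℝ) ≤ v := by exact_mod_cast hv0
  have ht' : (0 : ℝ) < t := by exact_mod_cast (by omega : 0 < t)
  have hW : ∑ V ∈ rowLevel q t u, fhat φ V ^ 2 ≤ μ ^ 2 * ((6 * l / v : ℝ) ^ v) ^ q := by
    rcases le_total u l with h | h
    · rw [hv, min_eq_left h]
      exact rowLevel_weight_le φ hφ hμ hμl hu h
    · have hvl' : v = l := by rw [hv, min_eq_right h]
      have hl' : (0 : ℝ) < l := by exact_mod_cast hl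
      rw [hvl', mul_div_cancel_right₀ _ hl'.ne']
      calc ∑ V ∈ rowLevel q t u, fhat φ V ^ 2 ≤ ∑ V, fhat φ V ^ 2 :=
            sum_le_sum_of_subset_of_nonneg (subset_univ _) fun _ _ _ => sq_nonneg _
        _ = (∑ x, φ x ^ 2) / 2 ^ (q * t) := by
            rw [sum_fhat_sq, Fintype.card_prod, Fintype.card_fin, Fintype.card_fin]
        _ ≤ μ := by
            rw [hμ]
            gcongr with x
            rw [← sq_abs]
            nlinarith [hφ x, abs_nonneg (φ x)]
        _ ≤ μ * (μ * 2 ^ (q * l)) := le_mul_of_one_le_right hμ0.le hμl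
        _ ≤ μ ^ 2 * ((6 : ℝ) ^ l) ^ q := by
            rw [← mul_assoc, ← sq, ← pow_mul, mul_comm q l]
            gcongr
            norm_num
  refine hW.trans ?_
  rw [mul_assoc]
  refine mul_le_mul_of_nonneg_left ?_ (by positivity)
  set a : ℝ := (t : ℝ) / (2 * v) with ha
  have ha0 : 0 ≤ a := by positivity
  have hC : a ^ v ≤ t.choose u :=
    (div_pow_le_choose hv0 (by omega)).trans
      (by exact_mod_cast choose_le_choose_of_le_half hvu hut)
  have e : (6 * l / v : ℝ) = 12 * l / t * a := by rw [ha]; field_simp; norm_num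
  set X := (12 * l / t : ℝ) with hXdef
  have hX0 : 0 ≤ X := by positivity
  calc ((6 * l / v : ℝ) ^ v) ^ q = (X ^ q * a) ^ v * (a ^ v) ^ (q - 1) := by
        rw [e, mul_pow, mul_pow, mul_pow, ← pow_mul, ← pow_mul, ← pow_mul, ← pow_mul, mul_assoc,
          ← pow_add, mul_comm v q]
        congr 2
        obtain ⟨q', rfl⟩ : ∃ q', q = q' + 1 := ⟨q - 1, by omega⟩
        rw [Nat.add_sub_cancel]; ring
    _ ≤ (t * X ^ q) ^ v * (t.choose u : ℝ) ^ (q - 1) := by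
        gcongr ?_ ^ v * ?_ ^ (q - 1)
        rw [mul_comm]
        gcongr
        rw [ha]
        exact div_le_self ht'.le (by linarith)
    _ ≤ (t * X ^ q) * (t.choose u : ℝ) ^ (q - 1) := by
        gcongr
        exact pow_le_of_le_one (by positivity) hX hv0.ne'

/-- Multiplying φ by the all-ones character adds 1 to every frequency, which exchanges the row
weights u and t - u and leaves |φ| unchanged. -/
lemma rowLevel_bound (hq : 0 < q) (φ : (Fin q × Fin t → ZMod 2) → ℝ)
    (hφ : ∀ x, |φ x| ≤ 1) {μ : ℝ} (hμ : μ = (∑ x, |φ x|) / 2 ^ (q * t)) {l : ℕ} (hl : 0 < l)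
    (hμl : 1 ≤ μ * 2 ^ (q * l)) (hX : (t : ℝ) * (12 * l / t : ℝ) ^ q ≤ 1)
    {u : ℕ} (hu : 0 < u) (hut : u < t) :
    ∑ V ∈ rowLevel q t u, fhat φ V ^ 2 ≤
      μ ^ 2 * (t * (12 * l / t : ℝ) ^ q) * (t.choose u : ℝ) ^ (q - 1) := by
  rcases Nat.lt_or_ge t (2 * u) with h | h
  · have h1 := rowLevel_bound_of_le_half (u := t - u) hq (fun x => φ x * chi 1 x)
      (fun x => by rw [abs_mul, abs_chi, mul_one]; exact hφ x) (μ := μ)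
      (by simpa only [abs_mul, abs_chi, mul_one] using hμ) hl hμl hX (by omega) (by omega)
    rw [Nat.choose_symm hut.le] at h1
    refine le_trans (le_of_eq ?_) h1
    have h2 : ∀ V, fhat (fun x => φ x * chi 1 x) V = fhat φ (V + 1) := fun V => by
      simp only [fhat, chi_add_left]
      congr 1
      exact sum_congr rfl fun x _ => by ring
    have h11 : (1 : Fin q × Fin t → ZMod 2) + 1 = 0 := zmod_two_pi_add_self _
    have hmem : ∀ u' ≤ t, ∀ V ∈ rowLevel q t u', V + 1 ∈ rowLevel q t (t - u') := by
      intro u' hu' V hV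
      simp only [rowLevel, mem_filter, mem_univ, true_and] at hV ⊢
      intro i
      have h3 := wt_add_one fun v => V (i, v)
      rw [hV i] at h3
      have : wt (fun v => (V + 1) (i, v)) + u' = t := h3
      omega
    refine sum_bij' (fun V _ => V + 1) (fun V _ => V + 1) (hmem u hut.le) ?_ ?_ ?_ ?_
    · intro V hV
      have := hmem (t - u) (by omega) V hV
      rwa [Nat.sub_sub_self hut.le] at this
    · intro V _; rw [add_assoc, h11, add_zero]
    · intro V _; rw [add_assoc, h11, add_zero]
    · intro V _; rw [h2, add_assoc, h11, add_zero]
  · exact rowLevel_bound_of_le_half hq φ hφ hμ hl hμl hX hu h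

/-- The factor (1 - χ_U(e))² is at most 4, and it vanishes for constant U because e has an even
number of summands. So exactly the levels 0 < u < t are needed. Cauchy–Schwarz over B passes from
squares to the first power. -/
lemma sum_gap_rowPerm_le (hq : 0 < q) (φ : (Fin q × Fin t → ZMod 2) → ℝ)
    (hφ : ∀ x, |φ x| ≤ 1) {l : ℕ} (hl : 0 < l)
    (hμl : 1 ≤ (∑ x, |φ x|) / 2 ^ (q * t) * 2 ^ (q * l))
    {η : ℝ} (hη : 0 ≤ η) (hX : (t : ℝ) * (12 * l / t : ℝ) ^ q ≤ 1)
    (hηX : (t : ℝ) * (t * (12 * l / t : ℝ) ^ q) ≤ η ^ 2) (v w : Fin t) :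
    ∑ B : Fin q → Equiv.Perm (Fin t),
        gap (fun x => φ (x ∘ rowPerm B)) (Pi.single v 1 + Pi.single w 1) ≤
      (t.factorial : ℝ) ^ q * (2 * η * ∑ x, |φ x|) := by
  set e : Fin t → ZMod 2 := Pi.single v 1 + Pi.single w 1 with he
  set S := ∑ x, |φ x| with hS
  have hS0 : 0 ≤ S := sum_nonneg fun _ _ => abs_nonneg _
  set μ := S / 2 ^ (q * t) with hμ
  have hchi : ∀ U, chi U e = zsgn (U v) * zsgn (U w) := by
    intro U
    have h1 : ∀ z : Fin t, chi U (Pi.single z 1) = zsgn (U z) := by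
      intro z
      rw [chi, Finset.prod_eq_single z]
      · simp
      · intro j _ hj; simp [hj]
      · simp
    rw [he, chi_add_right, h1, h1]
  have h1 : ∑ B : Fin q → Equiv.Perm (Fin t), gap (fun x => φ (x ∘ rowPerm B)) e ^ 2 ≤
      (2 ^ (q * t)) ^ 2 *
        ((t.factorial : ℝ) ^ q * (4 * t * (μ ^ 2 * (t * (12 * l / t : ℝ) ^ q)))) := by
    calc _ ≤ ∑ B : Fin q → Equiv.Perm (Fin t), (2 ^ (q * t)) ^ 2 *
        ∑ U : Fin t → ZMod 2, (1 - chi U e) ^ 2 *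
          fhat φ ((U ∘ Prod.snd) ∘ rowPerm B) ^ 2 := by
          refine sum_le_sum fun B _ => ?_
          have := gap_sq_le (fun x => φ (x ∘ rowPerm B)) e
          simpa only [fhat_comp_rowPerm] using this
      _ ≤ _ := by
          rw [← mul_sum]
          refine mul_le_mul_of_nonneg_left ?_ (by positivity)
          refine sum_rowPerm_fhat_le hq φ (fun U => (1 - chi U e) ^ 2)
            ?_ ?_ (by positivity) fun u hu hut => rowLevel_bound hq φ hφ hμ hl hμl hX hu hut
          · intro U
            have h2 := abs_le.1 (abs_chi U e).le
            nlinarith [h2.1, h2.2]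
          · intro U hU
            have hne : zsgn (U v) * zsgn (U w) ≠ 1 := by
              intro h; apply hU; simp only [hchi, h]; norm_num
            have hex : (∃ z, U z = 1) ∧ ∃ z, U z = 0 := by
              rcases zmod_two_cases (U v) with a | a <;> rcases zmod_two_cases (U w) with b | b
              · rw [a, b] at hne; simp at hne
              · exact ⟨⟨w, b⟩, ⟨v, a⟩⟩
              · exact ⟨⟨v, a⟩, ⟨w, b⟩⟩
              · rw [a, b] at hne; simp at hne
            obtain ⟨⟨z, hz⟩, ⟨z', hz'⟩⟩ := hex
            have h3 : 0 < wt U := by rw [wt_eq_card]; exact Fintype.card_pos_iff.2 ⟨⟨z, hz⟩⟩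
            have h4 : 0 < wt (U + 1) := by
              rw [wt_eq_card]; exact Fintype.card_pos_iff.2 ⟨⟨z', by simp [hz']⟩⟩
            have h5 := wt_add_one U
            omega
  have hcard : ((univ : Finset (Fin q → Equiv.Perm (Fin t))).card : ℝ) = (t.factorial : ℝ) ^ q := by
    simp [Fintype.card_perm]
  have h2 := sq_sum_le_card_mul_sum_sq (s := (univ : Finset (Fin q → Equiv.Perm (Fin t))))
    (f := fun B => gap (fun x => φ (x ∘ rowPerm B)) e)
  rw [hcard] at h2
  refine le_of_sq_le_sq (h2.trans ?_) (by positivity)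
  calc (t.factorial : ℝ) ^ q *
        ∑ B : Fin q → Equiv.Perm (Fin t), gap (fun x => φ (x ∘ rowPerm B)) e ^ 2
      ≤ (t.factorial : ℝ) ^ q * ((2 ^ (q * t)) ^ 2 *
        ((t.factorial : ℝ) ^ q * (4 * t * (μ ^ 2 * (t * (12 * l / t : ℝ) ^ q))))) := by gcongr
    _ = ((t.factorial : ℝ) ^ q * 2 * S) ^ 2 * (t * (t * (12 * l / t : ℝ) ^ q)) := by
        rw [hμ]; field_simp; ring
    _ ≤ ((t.factorial : ℝ) ^ q * 2 * S) ^ 2 * η ^ 2 := by gcongr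
    _ = _ := by ring

/-- After a random permutation of the rows, a function with few values reveals little about the
sum of the rows. -/
lemma sum_gap_message_le {M : Type*} [Fintype M] [DecidableEq M] (hq : 0 < q)
    (T : (Fin q × Fin t → ZMod 2) → M) {l : ℕ} (hl : 0 < l)
    {η : ℝ} (hη : 0 ≤ η) (hX : (t : ℝ) * (12 * l / t : ℝ) ^ q ≤ 1)
    (hηX : (t : ℝ) * (t * (12 * l / t : ℝ) ^ q) ≤ η ^ 2) (v w : Fin t) :
    ∑ B : Fin q → Equiv.Perm (Fin t), ∑ τ,
        gap (fun x => if T (x ∘ rowPerm B) = τ then 1 else 0) (Pi.single v 1 + Pi.single w 1) ≤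
      (t.factorial : ℝ) ^ q * (2 ^ (q * t) * (2 * Fintype.card M / 2 ^ (q * l) + 2 * η)) := by
  set S : M → ℝ := fun τ => ∑ x, |if T x = τ then (1 : ℝ) else 0| with hS
  have hcard : ((univ : Finset (Fin q → Equiv.Perm (Fin t))).card : ℝ) = (t.factorial : ℝ) ^ q := by
    simp [Fintype.card_perm]
  have hS0 : ∀ τ, 0 ≤ S τ := fun τ => sum_nonneg fun _ _ => abs_nonneg _
  have hSsum : ∑ τ, S τ = 2 ^ (q * t) := by
    have h1 : ∀ (x : Fin q × Fin t → ZMod 2) τ, |if T x = τ then (1 : ℝ) else 0| =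
        if T x = τ then 1 else 0 := fun x τ => by split_ifs <;> simp
    simp only [hS, h1]
    rw [sum_comm]
    simp [ZMod.card]
  rw [sum_comm]
  calc _ ≤ ∑ τ, (t.factorial : ℝ) ^ q * (2 * 2 ^ (q * t) / 2 ^ (q * l) + 2 * η * S τ) := by
        refine sum_le_sum fun τ _ => ?_
        rcases le_total 1 (S τ / 2 ^ (q * t) * 2 ^ (q * l)) with h | h
        · refine (sum_gap_rowPerm_le hq (fun x => if T x = τ then 1 else 0)
            (fun x => by split_ifs <;> simp) hl h hη hX hηX v w).trans ?_
          gcongr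
          exact le_add_of_nonneg_left (by positivity)
        -- A message sent on fewer than a 2^(-ql) fraction of the cube is too rare for the Fourier
        -- bound. The trivial bound `gap_le` is affordable, because there are only `Fintype.card M`
        -- messages.
        · have hSl : S τ ≤ 2 ^ (q * t) / 2 ^ (q * l) := by
            rw [le_div_iff₀ (by positivity)]
            rw [div_mul_eq_mul_div, div_le_iff₀ (by positivity), one_mul] at h
            exact h
          calc _ ≤ ∑ B : Fin q → Equiv.Perm (Fin t), 2 * S τ := by
                refine sum_le_sum fun B _ => (gap_le _ _).trans (le_of_eq ?_)
                congr 1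
                set E : (Fin q × Fin t → ZMod 2) ≃ (Fin q × Fin t → ZMod 2) :=
                  (rowPerm B).symm.arrowCongr (Equiv.refl _)
                have hE : ∀ U, E U = U ∘ rowPerm B := fun U => by
                  funext i; simp [E, Equiv.arrowCongr]
                rw [hS]
                simp only
                rw [← E.sum_comp fun x => |if T x = τ then (1 : ℝ) else 0|]
                simp only [hE]
            _ ≤ _ := by
                rw [sum_const, nsmul_eq_mul, hcard]
                have := hS0 τ
                gcongr
                calc 2 * S τ ≤ 2 * (2 ^ (q * t) / 2 ^ (q * l)) := by gcongr
                  _ = 2 * 2 ^ (q * t) / 2 ^ (q * l) := by ring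
                  _ ≤ _ := le_add_of_nonneg_right (by positivity)
    _ = _ := by
        rw [← mul_sum, sum_add_distrib, ← mul_sum, hSsum, sum_const, card_univ, nsmul_eq_mul]
        ring

end Gap

/-! ### Mixing of interleaved products -/

/-- The interleaved product `a₀ b₀ a₁ b₁ ⋯`. -/
def altProd {Γ : Type*} [Group Γ] {q : ℕ} (a b : Fin q → Γ) : Γ :=
  (List.ofFn fun i => a i * b i).prod

/-- An embedding of the cube `Fin t → ZMod 2` as a subgroup of `Γ` whose coordinate permutations
are induced by conjugation in `Γ`. -/
structure CubeEmbedding (Γ : Type*) [Group Γ] (t : ℕ) where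
  /-- The embedding. -/
  σ : (Fin t → ZMod 2) → Γ
  map_add : ∀ x y, σ (x + y) = σ x * σ y
  inj : Function.Injective σ
  conj : ∀ π : Equiv.Perm (Fin t), ∃ g, ∀ x, g * σ x * g⁻¹ = σ (x ∘ π)

namespace CubeEmbedding

variable {Γ : Type*} [Group Γ] {t : ℕ} (c : CubeEmbedding Γ t)

lemma map_zero : c.σ 0 = 1 := by
  have := c.map_add 0 0
  rw [add_zero] at this
  exact (mul_eq_left.1 this.symm)

lemma telescope {q : ℕ} (D : Fin (q + 1) → Γ) (x : Fin q → Fin t → ZMod 2) :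
    (List.ofFn fun i : Fin q => D i.castSucc * c.σ (x i) * (D i.succ)⁻¹).prod =
      D 0 * c.σ (∑ i, x i) * (D (Fin.last q))⁻¹ := by
  induction q with
  | zero => simp [c.map_zero]
  | succ q ih =>
    rw [List.ofFn_succ, List.prod_cons]
    have := ih (fun i => D i.succ) (fun i => x i.succ)
    simp only [Fin.succ_castSucc] at this
    rw [this, Fin.sum_univ_succ, c.map_add, Fin.succ_last]
    simp only [Fin.castSucc_zero, Fin.succ_zero_eq_one, mul_assoc, inv_mul_cancel_left]

end CubeEmbedding

/-- The elements of `Γ` that correspond to vectors with at most two nonzero entries in some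
embedded cube. -/
def IsCubeShift {Γ : Type*} [Group Γ] (t : ℕ) (g : Γ) : Prop :=
  ∃ (c : CubeEmbedding Γ t) (h : Γ) (v w : Fin t),
    g = h * c.σ (Pi.single v 1 + Pi.single w 1) * h⁻¹

/-! ### Telescoping lift of a cube array to a tuple of factors -/

section Lift

variable {Γ : Type*} [Group Γ] {q t : ℕ}

/-- The tuple with entries `dᵢ σ(xᵢ) γᵢ⁻¹`. -/
def cubeLift (c : CubeEmbedding Γ t) (d γ : Fin q → Γ) (x : Fin q × Fin t → ZMod 2) : Fin q → Γ :=
  fun i => d i * c.σ (fun v => x (i, v)) * (γ i)⁻¹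

/-- The tuple with entries `bᵢ dᵢ₊₁`, where `d` is continued by `h`. -/
def shiftMul (h : Γ) (d b : Fin q → Γ) : Fin q → Γ :=
  fun i => b i * (Fin.snoc d h : Fin (q + 1) → Γ) i.succ

/-- Entry i of the tuple determines dᵢ once dᵢ₊₁ is known, so d is recovered backwards from h. -/
lemma cubeLift_shiftMul_injective (c : CubeEmbedding Γ t) (h : Γ) (b : Fin q → Γ)
    (x : Fin q × Fin t → ZMod 2) :
    Function.Injective fun d => cubeLift c d (shiftMul h d b) x := by
  intro d d' hd
  have key : ∀ j : Fin (q + 1), (Fin.snoc d h : Fin (q + 1) → Γ) j =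
      (Fin.snoc d' h : Fin (q + 1) → Γ) j := by
    intro j
    induction j using Fin.reverseInduction with
    | last => simp
    | cast i ih =>
      have := congrFun hd i
      simp only [cubeLift, shiftMul] at this
      rw [ih] at this
      simpa using this
  funext i
  simpa using key i.castSucc

lemma altProd_cubeLift_shiftMul (c : CubeEmbedding Γ t) (h : Γ) (b d : Fin q → Γ)
    (x : Fin q × Fin t → ZMod 2) :
    altProd (cubeLift c d (shiftMul h d b) x) b =
      (Fin.snoc d h : Fin (q + 1) → Γ) 0 * c.σ (rowSum x) * h⁻¹ := by
  have h1 := c.telescope (Fin.snoc d h : Fin (q + 1) → Γ) (fun i v => x (i, v))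
  have h2 : (∑ i, fun v => x (i, v)) = rowSum x := by funext v; simp [rowSum]
  rw [h2, Fin.snoc_last] at h1
  rw [← h1, altProd]
  congr 2
  funext i
  rw [Fin.snoc_castSucc, cubeLift, shiftMul, mul_inv_rev]
  simp only [mul_assoc, inv_mul_cancel, mul_one]

end Lift

/-! ### From invariance under cube shifts to near-uniformity -/

section Mixing

variable {Γ : Type*} [Group Γ] [Fintype Γ] [DecidableEq Γ] {q t : ℕ}
variable {M : Type*} [Fintype M] [DecidableEq M]

lemma sum_abs_cube_fiber (c : CubeEmbedding Γ t) (D₀ h : Γ) (e : Fin t → ZMod 2)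
    (φ : (Fin q × Fin t → ZMod 2) → ℝ) :
    ∑ p, |∑ x, φ x * ((if D₀ * c.σ (rowSum x) * h⁻¹ = p then 1 else 0) -
      (if D₀ * c.σ (rowSum x) * h⁻¹ = p * (h * c.σ e * h⁻¹) then 1 else 0))| = gap φ e := by
  symm
  refine Fintype.sum_of_injective (fun y => D₀ * c.σ y * h⁻¹) ?_ _ _ ?_ ?_
  · intro y y' hy
    simpa using c.inj (mul_left_cancel (mul_right_cancel hy))
  · intro p hp
    rw [abs_eq_zero]
    refine sum_eq_zero fun x _ => ?_
    rw [if_neg, if_neg, sub_zero, mul_zero]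
    · intro hx
      apply hp
      refine ⟨rowSum x + e, ?_⟩
      have h1 : c.σ e * c.σ e = 1 := by
        rw [← c.map_add, zmod_two_pi_add_self, c.map_zero]
      simp only [c.map_add]
      calc D₀ * (c.σ (rowSum x) * c.σ e) * h⁻¹
          = (D₀ * c.σ (rowSum x) * h⁻¹) * (h * c.σ e * h⁻¹) := by group
        _ = p * (h * (c.σ e * c.σ e) * h⁻¹) := by rw [hx]; group
        _ = p := by rw [h1]; group
    · intro hx
      exact hp ⟨rowSum x, hx⟩
  · intro y
    congr 1
    refine sum_congr rfl fun x _ => ?_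
    have e1 : (D₀ * c.σ (rowSum x) * h⁻¹ = D₀ * c.σ y * h⁻¹) ↔ rowSum x = y := by
      rw [mul_left_inj, mul_right_inj, c.inj.eq_iff]
    have e2 : (D₀ * c.σ (rowSum x) * h⁻¹ = D₀ * c.σ y * h⁻¹ * (h * c.σ e * h⁻¹)) ↔
        rowSum x = y + e := by
      rw [show D₀ * c.σ y * h⁻¹ * (h * c.σ e * h⁻¹) = D₀ * (c.σ y * c.σ e) * h⁻¹ by group,
        ← c.map_add, mul_left_inj, mul_right_inj, c.inj.eq_iff]
    simp only [e1, e2]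

/-- The number of `a` with message `τ` whose interleaved product with `b` is `p`. -/
noncomputable def fiberCount (T : (Fin q → Γ) → M) (b : Fin q → Γ) (τ : M) (p : Γ) : ℝ :=
  ∑ a, (if T a = τ then 1 else 0) * (if altProd a b = p then 1 else 0)

/-- For each fixed x the substitution of the lift for a is a bijection in d, so averaging over x
costs nothing and the product depends on x through the row sum only. After taking absolute values, b
is replaced by γ = `shiftMul h d b`; for fixed d this is a bijection, and d and γ become
independent. -/
lemma sum_fiberCount_shift_le_gap (T : (Fin q → Γ) → M) (c : CubeEmbedding Γ t) (h : Γ)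
    (e : Fin t → ZMod 2) :
    2 ^ (q * t) * ∑ b, ∑ τ, ∑ p,
        |fiberCount T b τ p - fiberCount T b τ (p * (h * c.σ e * h⁻¹))| ≤
      ∑ d : Fin q → Γ, ∑ γ : Fin q → Γ, ∑ τ,
        gap (fun x => if T (cubeLift c d γ x) = τ then 1 else 0) e := by
  have h1 : ∀ b τ p, 2 ^ (q * t) *
      |fiberCount T b τ p - fiberCount T b τ (p * (h * c.σ e * h⁻¹))| ≤
      ∑ d : Fin q → Γ, |∑ x : Fin q × Fin t → ZMod 2,
        (if T (cubeLift c d (shiftMul h d b) x) = τ then (1 : ℝ) else 0) *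
        ((if (Fin.snoc d h : Fin (q + 1) → Γ) 0 * c.σ (rowSum x) * h⁻¹ = p then 1 else 0) -
        (if (Fin.snoc d h : Fin (q + 1) → Γ) 0 * c.σ (rowSum x) * h⁻¹ = p * (h * c.σ e * h⁻¹)
          then 1 else 0))| := by
    intro b τ p
    set ψ : (Fin q → Γ) → ℝ := fun a => (if T a = τ then (1 : ℝ) else 0) *
      ((if altProd a b = p then 1 else 0) -
        (if altProd a b = p * (h * c.σ e * h⁻¹) then 1 else 0)) with hψ
    have h2 : fiberCount T b τ p - fiberCount T b τ (p * (h * c.σ e * h⁻¹)) = ∑ a, ψ a := by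
      rw [fiberCount, fiberCount, ← sum_sub_distrib]
      exact sum_congr rfl fun a _ => by rw [hψ]; ring
    have h3 : ∀ x : Fin q × Fin t → ZMod 2, ∑ a, ψ a = ∑ d : Fin q → Γ,
        ψ (cubeLift c d (shiftMul h d b) x) := fun x =>
      (Equiv.sum_comp (Equiv.ofBijective _ (Finite.injective_iff_bijective.1
        (cubeLift_shiftMul_injective c h b x))) ψ).symm
    calc 2 ^ (q * t) * |fiberCount T b τ p - fiberCount T b τ (p * (h * c.σ e * h⁻¹))|
        = |∑ x : Fin q × Fin t → ZMod 2, ∑ a, ψ a| := by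
          rw [h2, sum_const, nsmul_eq_mul, abs_mul]
          simp [ZMod.card]
      _ = |∑ d : Fin q → Γ, ∑ x : Fin q × Fin t → ZMod 2,
            ψ (cubeLift c d (shiftMul h d b) x)| := by
          rw [sum_congr rfl fun x _ => h3 x, sum_comm]
      _ ≤ ∑ d : Fin q → Γ, |∑ x : Fin q × Fin t → ZMod 2,
            ψ (cubeLift c d (shiftMul h d b) x)| := abs_sum_le_sum_abs _ _
      _ = _ := by simp only [hψ, altProd_cubeLift_shiftMul]
  calc 2 ^ (q * t) * ∑ b, ∑ τ, ∑ p,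
        |fiberCount T b τ p - fiberCount T b τ (p * (h * c.σ e * h⁻¹))|
      = ∑ b, ∑ τ, ∑ p, 2 ^ (q * t) *
        |fiberCount T b τ p - fiberCount T b τ (p * (h * c.σ e * h⁻¹))| := by
        simp only [mul_sum]
    _ ≤ ∑ b : Fin q → Γ, ∑ τ, ∑ d : Fin q → Γ,
          gap (fun x => if T (cubeLift c d (shiftMul h d b) x) = τ then 1 else 0) e := by
        refine sum_le_sum fun b _ => sum_le_sum fun τ _ => ?_
        refine (sum_le_sum fun p _ => h1 b τ p).trans (le_of_eq ?_)
        rw [sum_comm]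
        exact sum_congr rfl fun d _ => sum_abs_cube_fiber c _ h e _
    _ = ∑ b : Fin q → Γ, ∑ d : Fin q → Γ, ∑ τ,
          gap (fun x => if T (cubeLift c d (shiftMul h d b) x) = τ then 1 else 0) e :=
        sum_congr rfl fun b _ => sum_comm
    _ = _ := by
        rw [sum_comm]
        refine sum_congr rfl fun d _ => ?_
        exact Equiv.sum_comp (Equiv.piCongrRight fun i : Fin q =>
          Equiv.mulRight ((Fin.snoc d h : Fin (q + 1) → Γ) i.succ))
          fun γ => ∑ τ, gap (fun x => if T (cubeLift c d γ x) = τ then 1 else 0) e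

lemma sum_fiberCount_cubeShift_le (hq : 0 < q) (T : (Fin q → Γ) → M) {g : Γ}
    (hg : IsCubeShift t g) {l : ℕ} (hl : 0 < l) {η : ℝ} (hη : 0 ≤ η)
    (hX : (t : ℝ) * (12 * l / t : ℝ) ^ q ≤ 1)
    (hηX : (t : ℝ) * (t * (12 * l / t : ℝ) ^ q) ≤ η ^ 2) :
    ∑ b, ∑ τ, ∑ p, |fiberCount T b τ p - fiberCount T b τ (p * g)| ≤
      (Fintype.card Γ : ℝ) ^ (2 * q) * (2 * Fintype.card M / 2 ^ (q * l) + 2 * η) := by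
  obtain ⟨c, h, v, w, rfl⟩ := hg
  set e : Fin t → ZMod 2 := Pi.single v 1 + Pi.single w 1 with he
  set ε : ℝ := 2 * Fintype.card M / 2 ^ (q * l) + 2 * η with hε
  -- Multiplying dᵢ and γᵢ on the right by the same group element conjugates σ(xᵢ), that is,
  -- permutes row i. Summed over all d and γ the expression is unchanged, so it equals its average
  -- over all row permutations.
  choose G hG using c.conj
  set S := ∑ d : Fin q → Γ, ∑ γ : Fin q → Γ, ∑ τ,
        gap (fun x => if T (cubeLift c d γ x) = τ then 1 else 0) e with hS
  have h1 : ∀ B : Fin q → Equiv.Perm (Fin t), S = ∑ d : Fin q → Γ, ∑ γ : Fin q → Γ, ∑ τ,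
        gap (fun x => if T (cubeLift c d γ (x ∘ rowPerm B)) = τ then 1 else 0) e := by
    intro B
    set E : (Fin q → Γ) ≃ (Fin q → Γ) := Equiv.piCongrRight fun i => Equiv.mulRight (G (B i))
    have hE : ∀ d i, E d i = d i * G (B i) := fun d i => rfl
    have hlift : ∀ d γ x, cubeLift c (E d) (E γ) x = cubeLift c d γ (x ∘ rowPerm B) := by
      intro d γ x
      funext i
      have h2 := hG (B i) fun v => x (i, v)
      have h3 : (fun v => (x ∘ rowPerm B) (i, v)) = (fun v => x (i, v)) ∘ B i := rfl
      simp only [cubeLift, hE]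
      rw [h3, ← h2]
      group
    rw [hS, ← E.sum_comp]
    refine sum_congr rfl fun d _ => ?_
    rw [← E.sum_comp]
    simp only [hlift]
  have h2 : (t.factorial : ℝ) ^ q * S ≤ (t.factorial : ℝ) ^ q *
      (2 ^ (q * t) * ((Fintype.card Γ : ℝ) ^ (2 * q) * ε)) := by
    calc (t.factorial : ℝ) ^ q * S
        = ∑ B : Fin q → Equiv.Perm (Fin t), S := by
          rw [sum_const, nsmul_eq_mul]; simp [Fintype.card_perm]
      _ = ∑ d : Fin q → Γ, ∑ γ : Fin q → Γ, ∑ B : Fin q → Equiv.Perm (Fin t), ∑ τ,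
          gap (fun x => if T (cubeLift c d γ (x ∘ rowPerm B)) = τ then 1 else 0) e := by
          rw [sum_congr rfl fun B _ => h1 B, sum_comm]
          exact sum_congr rfl fun d _ => sum_comm
      _ ≤ ∑ d : Fin q → Γ, ∑ γ : Fin q → Γ, (t.factorial : ℝ) ^ q * (2 ^ (q * t) * ε) :=
          sum_le_sum fun d _ => sum_le_sum fun γ _ =>
            sum_gap_message_le hq (fun x => T (cubeLift c d γ x)) hl hη hX hηX v w
      _ = _ := by
          simp only [sum_const, nsmul_eq_mul, card_univ, Fintype.card_fun, Fintype.card_fin,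
            Nat.cast_pow]
          rw [two_mul, pow_add]
          ring
  have h3 : S ≤ 2 ^ (q * t) * ((Fintype.card Γ : ℝ) ^ (2 * q) * ε) :=
    le_of_mul_le_mul_left h2 (pow_pos (by exact_mod_cast t.factorial_pos) _)
  exact le_of_mul_le_mul_left ((sum_fiberCount_shift_le_gap T c h e).trans h3) (by positivity)

lemma sum_fiberCount_shift_prod_le (T : (Fin q → Γ) → M) {δ : ℝ} (L : List Γ)
    (hL : ∀ g ∈ L, ∑ b, ∑ τ, ∑ p, |fiberCount T b τ p - fiberCount T b τ (p * g)| ≤ δ) :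
    ∑ b, ∑ τ, ∑ p, |fiberCount T b τ p - fiberCount T b τ (p * L.prod)| ≤ L.length * δ := by
  induction L with
  | nil => simp
  | cons g L ih =>
    have h1 := ih fun g' hg' => hL g' (List.mem_cons_of_mem _ hg')
    have h2 := hL g List.mem_cons_self
    calc ∑ b, ∑ τ, ∑ p, |fiberCount T b τ p - fiberCount T b τ (p * (g :: L).prod)|
        ≤ ∑ b, ∑ τ, ∑ p, (|fiberCount T b τ p - fiberCount T b τ (p * g)| +
            |fiberCount T b τ (p * g) - fiberCount T b τ (p * g * L.prod)|) := by
          refine sum_le_sum fun b _ => sum_le_sum fun τ _ => sum_le_sum fun p _ => ?_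
          rw [List.prod_cons, ← mul_assoc]
          exact abs_sub_le _ _ _
      _ = ∑ b, ∑ τ, ∑ p, |fiberCount T b τ p - fiberCount T b τ (p * g)| +
          ∑ b, ∑ τ, ∑ p, |fiberCount T b τ p - fiberCount T b τ (p * L.prod)| := by
          simp only [sum_add_distrib]
          congr 1
          refine sum_congr rfl fun b _ => sum_congr rfl fun τ _ => ?_
          exact Equiv.sum_comp (Equiv.mulRight g)
            fun p => |fiberCount T b τ p - fiberCount T b τ (p * L.prod)|
      _ ≤ δ + L.length * δ := add_le_add h2 h1
      _ = _ := by rw [List.length_cons]; push_cast; ring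

/-- A message about the factors `a` says little about the interleaved product of `a` with random
factors `b`, even if `b` is known. -/
lemma sum_fiberCount_sub_average_le (hq : 0 < q) (T : (Fin q → Γ) → M) {l : ℕ} (hl : 0 < l)
    {η : ℝ} (hη : 0 ≤ η) (hX : (t : ℝ) * (12 * l / t : ℝ) ^ q ≤ 1)
    (hηX : (t : ℝ) * (t * (12 * l / t : ℝ) ^ q) ≤ η ^ 2) {m : ℕ}
    (hΓ : ∀ g : Γ, ∃ L : List Γ, L.length ≤ m ∧ (∀ x ∈ L, IsCubeShift t x) ∧ L.prod = g) :
    ∑ b, ∑ τ, ∑ p, |fiberCount T b τ p - (∑ p', fiberCount T b τ p') / Fintype.card Γ| ≤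
      (Fintype.card Γ : ℝ) ^ (2 * q) * (m * (2 * Fintype.card M / 2 ^ (q * l) + 2 * η)) := by
  set δ : ℝ := (Fintype.card Γ : ℝ) ^ (2 * q) * (2 * Fintype.card M / 2 ^ (q * l) + 2 * η) with hδ
  have hδ0 : 0 ≤ δ := by positivity
  have hc : (0 : ℝ) < Fintype.card Γ := by exact_mod_cast Fintype.card_pos
  have h1 : ∀ g : Γ, ∑ b, ∑ τ, ∑ p, |fiberCount T b τ p - fiberCount T b τ (p * g)| ≤ m * δ := by
    intro g
    obtain ⟨L, hLm, hL, rfl⟩ := hΓ g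
    refine (sum_fiberCount_shift_prod_le T L
      fun g hg => sum_fiberCount_cubeShift_le hq T (hL g hg) hl hη hX hηX).trans ?_
    exact mul_le_mul_of_nonneg_right (by exact_mod_cast hLm) hδ0
  have h2 : ∀ b τ p, |fiberCount T b τ p - (∑ p', fiberCount T b τ p') / Fintype.card Γ| ≤
      (∑ g, |fiberCount T b τ p - fiberCount T b τ (p * g)|) / Fintype.card Γ := by
    intro b τ p
    have h3 : fiberCount T b τ p - (∑ p', fiberCount T b τ p') / Fintype.card Γ =
        (∑ g, (fiberCount T b τ p - fiberCount T b τ (p * g))) / Fintype.card Γ := by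
      rw [sum_sub_distrib, sum_const, card_univ, nsmul_eq_mul, sub_div,
        mul_div_cancel_left₀ _ hc.ne']
      congr 2
      exact (Equiv.sum_comp (Equiv.mulLeft p) fun p' => fiberCount T b τ p').symm
    rw [h3, abs_div, abs_of_pos hc]
    gcongr
    exact abs_sum_le_sum_abs _ _
  calc _ ≤ ∑ b, ∑ τ, ∑ p, (∑ g, |fiberCount T b τ p - fiberCount T b τ (p * g)|) /
        Fintype.card Γ :=
        sum_le_sum fun b _ => sum_le_sum fun τ _ => sum_le_sum fun p _ => h2 b τ p
    _ = (∑ g, ∑ b, ∑ τ, ∑ p, |fiberCount T b τ p - fiberCount T b τ (p * g)|) /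
        Fintype.card Γ := by
        simp only [← sum_div]
        congr 1
        symm
        rw [sum_comm]
        refine sum_congr rfl fun b _ => ?_
        rw [sum_comm]
        exact sum_congr rfl fun τ _ => sum_comm
    _ ≤ (∑ g : Γ, m * δ) / Fintype.card Γ := by
        gcongr with g
        exact h1 g
    _ = _ := by
        rw [sum_const, card_univ, nsmul_eq_mul, mul_div_cancel_left₀ _ hc.ne', hδ]; ring

end Mixing

/-! ### Round elimination -/

/-- `IsProt M r f` means that `f x y` is the (possibly fractional) output of an `r`-round protocol
with messages from `M` in which the holder of `x` speaks first. -/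
def IsProt (M : Type) : ℕ → ∀ {X Y : Type}, (X → Y → ℝ) → Prop
  | 0, X, _, f => ∃ h : X → ℝ, (∀ x, 0 ≤ h x ∧ h x ≤ 1) ∧ ∀ x y, f x y = h x
  | r + 1, X, Y, f => ∃ (T : X → M) (F : M → Y → X → ℝ),
      (∀ τ, IsProt M r (F τ)) ∧ ∀ x y, f x y = F (T x) y x

lemma IsProt.comp {M : Type} {r : ℕ} : ∀ {X Y X' Y' : Type} {f : X → Y → ℝ}, IsProt M r f →
    ∀ (φ : X' → X) (ψ : Y' → Y), IsProt M r fun x y => f (φ x) (ψ y) := by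
  induction r with
  | zero =>
    rintro X Y X' Y' f ⟨h, h01, hf⟩ φ ψ
    exact ⟨fun x => h (φ x), fun x => h01 _, fun x y => hf _ _⟩
  | succ r ih =>
    rintro X Y X' Y' f ⟨T, F, hF, hf⟩ φ ψ
    exact ⟨fun x => T (φ x), fun τ y x => F τ (ψ y) (φ x), fun τ => ih (hF τ) ψ φ,
      fun x y => hf _ _⟩

lemma IsProt.mem_Icc {M : Type} {r : ℕ} : ∀ {X Y : Type} {f : X → Y → ℝ}, IsProt M r f →
    ∀ x y, 0 ≤ f x y ∧ f x y ≤ 1 := by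
  induction r with
  | zero =>
    rintro X Y f ⟨h, h01, hf⟩ x y
    rw [hf]; exact h01 x
  | succ r ih =>
    rintro X Y f ⟨T, F, hF, hf⟩ x y
    rw [hf]; exact ih (hF _) y x

/-! ### Completing and contracting interleaved products -/

section AltProd

variable {G : Type*} [Group G]

lemma altProd_update_last {q : ℕ} (a b : Fin (q + 1) → G) (x : G) :
    altProd a (Function.update b (Fin.last q) (b (Fin.last q) * x)) = altProd a b * x := by
  have h : ∀ b : Fin (q + 1) → G, altProd a b =
      (List.ofFn fun i : Fin q => a i.castSucc * b i.castSucc).prod *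
        (a (Fin.last q) * b (Fin.last q)) := by
    intro b
    rw [altProd, List.ofFn_succ', List.concat_eq_append, List.prod_append, List.prod_singleton]
  rw [h, h]
  have h2 : ∀ i : Fin q, Function.update b (Fin.last q) (b (Fin.last q) * x) i.castSucc =
      b i.castSucc := fun i => Function.update_of_ne (Fin.castSucc_lt_last i).ne _ _
  simp only [h2, Function.update_self, mul_assoc]

lemma altProd_apply {q J : ℕ} (a b : Fin q → Fin J → G) (j : Fin J) :
    altProd a b j = altProd (fun i => a i j) (fun i => b i j) := by
  have := map_list_prod (Pi.evalMonoidHom (fun _ : Fin J => G) j) (List.ofFn fun i => a i * b i)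
  rw [List.map_ofFn] at this
  exact this

/-- The tuple that agrees with `b` except in the last entry, which makes the interleaved product
with `a` equal to `c`. -/
def completeTo {q : ℕ} (a b : Fin (q + 1) → G) (c : G) : Fin (q + 1) → G :=
  Function.update b (Fin.last q) (b (Fin.last q) * ((altProd a b)⁻¹ * c))

lemma altProd_completeTo {q : ℕ} (a b : Fin (q + 1) → G) (c : G) :
    altProd a (completeTo a b c) = c := by
  rw [completeTo, altProd_update_last, mul_inv_cancel_left]

/-- With b and the target c independent and uniform, the completed tuple is uniform: for fixed b, c
determines the factor applied to the last entry bijectively. -/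
lemma sum_completeTo [Fintype G] [DecidableEq G] {q : ℕ} (a : Fin (q + 1) → G)
    (Φ : (Fin (q + 1) → G) → ℝ) :
    ∑ b, ∑ c, Φ (completeTo a b c) = Fintype.card G * ∑ b, Φ b := by
  set sh : G → (Fin (q + 1) → G) → (Fin (q + 1) → G) := fun x b =>
    Function.update b (Fin.last q) (b (Fin.last q) * x) with hsh
  have hinv : ∀ x b, sh x⁻¹ (sh x b) = b := by
    intro x b
    simp [hsh]
  calc ∑ b, ∑ c, Φ (completeTo a b c) = ∑ b, ∑ x, Φ (sh x b) := by
        refine sum_congr rfl fun b _ => ?_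
        exact Equiv.sum_comp (Equiv.mulLeft (altProd a b)⁻¹) fun x => Φ (sh x b)
    _ = ∑ x : G, ∑ b, Φ b := by
        rw [sum_comm]
        refine sum_congr rfl fun x _ => ?_
        exact Equiv.sum_comp ⟨sh x, sh x⁻¹, hinv x, fun b => by
          have := hinv x⁻¹ b; rwa [inv_inv] at this⟩ Φ
    _ = _ := by rw [sum_const, card_univ, nsmul_eq_mul]

/-- A uniform first factor makes the product uniform, whatever the other factors are. -/
lemma card_mul_sum_altProd_eq [Fintype G] [DecidableEq G] {J : ℕ} (hJ : 0 < J) (p : Fin J → G)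
    (g : G) :
    (Fintype.card G : ℝ) * ∑ c : Fin J → G, (if altProd c p = g then 1 else 0) =
      (Fintype.card G : ℝ) ^ J := by
  obtain ⟨J, rfl⟩ : ∃ J', J = J' + 1 := ⟨J - 1, by omega⟩
  rw [← (Fin.consEquiv fun _ => G).sum_comp, Fintype.sum_prod_type, sum_comm]
  have h1 : ∀ c' : Fin J → G, ∑ c₀ : G,
      (if altProd ((Fin.consEquiv fun _ => G) (c₀, c')) p = g then (1 : ℝ) else 0) = 1 := by
    intro c'
    have h2 : ∀ c₀, altProd ((Fin.consEquiv fun _ => G) (c₀, c')) p =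
        c₀ * (p 0 * altProd c' fun i => p i.succ) := by
      intro c₀
      simp [altProd, Fin.consEquiv, List.ofFn_succ, mul_assoc]
    simp only [h2, ← eq_mul_inv_iff_mul_eq]
    simp
  rw [sum_congr rfl fun c' _ => h1 c']
  simp
  ring

end AltProd

/-! ### Removing the first round -/

section Elimination

variable {G : Type} [Group G] [Fintype G] [DecidableEq G]

/-- The sum of `f` over all pairs with interleaved product `g`. -/
noncomputable def condSum {n : ℕ} (g : G) (f : (Fin n → G) → (Fin n → G) → ℝ) : ℝ :=
  ∑ a, ∑ b, if altProd a b = g then f a b else 0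

/-- Every value is taken by the same number of pairs, so |G| times the sum over one fibre, divided
by the number of all pairs, is a conditional expectation. Thus δ bounds the advantage for r rounds,
and ε is the price of treating the second-half product p as independent of the first message. -/
lemma condSum_step {M : Type} [Fintype M] [DecidableEq M] {r J q : ℕ} (hJ : 0 < J) {δ ε : ℝ}
    (hmix : ∀ T : (Fin (q + 1) → Fin J → G) → M,
      ∑ b, ∑ τ, ∑ p, |fiberCount T b τ p - (∑ p', fiberCount T b τ p') /
          Fintype.card (Fin J → G)| ≤ (Fintype.card (Fin J → G) : ℝ) ^ (2 * (q + 1)) * ε)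
    (ih : ∀ f : (Fin J → G) → (Fin J → G) → ℝ, IsProt M r f → ∀ g g',
      Fintype.card G * (condSum g f - condSum g' f) ≤ δ * (Fintype.card (Fin J → G) : ℝ) ^ 2)
    (f : (Fin (q + 1) → Fin J → G) × (Fin (q + 1) → Fin J → G) →
      (Fin (q + 1) → Fin J → G) × (Fin (q + 1) → Fin J → G) → ℝ)
    (hf : IsProt M (r + 1) f) (g g' : G) :
    Fintype.card G *
      ((∑ a, ∑ b, if altProd (altProd a.1 b.1) (altProd a.2 b.2) = g then f a b else 0) -
        ∑ a, ∑ b, if altProd (altProd a.1 b.1) (altProd a.2 b.2) = g' then f a b else 0) ≤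
      (δ + ε) * (Fintype.card (Fin J → G) : ℝ) ^ (4 * (q + 1)) := by
  obtain ⟨T, F, hF, hfF⟩ := hf
  set cG : ℝ := ((Fintype.card G : ℕ) : ℝ) with hcG
  set cΓ : ℝ := ((Fintype.card (Fin J → G) : ℕ) : ℝ) with hcΓ
  have hcG0 : 0 < cG := by rw [hcG]; exact_mod_cast Fintype.card_pos
  have hcΓ0 : 0 < cΓ := by rw [hcΓ]; exact_mod_cast Fintype.card_pos
  -- the difference for fixed public information, first message, and contracted input
  set K : (Fin (q + 1) → Fin J → G) → (Fin (q + 1) → Fin J → G) → (Fin (q + 1) → Fin J → G) →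
      G → M → (Fin J → G) → (Fin (q + 1) → Fin J → G) → ℝ := fun a₁ b₁ b₂ g τ p a₂ =>
    ∑ c, if altProd c p = g then F τ (completeTo a₁ b₁ c, b₂) (a₁, a₂) else 0 with hK
  have hnest : ∀ g, cΓ * (∑ a : (Fin (q + 1) → Fin J → G) × (Fin (q + 1) → Fin J → G),
      ∑ b : (Fin (q + 1) → Fin J → G) × (Fin (q + 1) → Fin J → G),
      if altProd (altProd a.1 b.1) (altProd a.2 b.2) = g then f a b else 0) =
      ∑ a₁, ∑ b₁, ∑ b₂, ∑ a₂, K a₁ b₁ b₂ g (T (a₁, a₂)) (altProd a₂ b₂) a₂ := by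
    intro g
    simp only [Fintype.sum_prod_type, mul_sum]
    refine sum_congr rfl fun a₁ _ => ?_
    calc _ = ∑ a₂, ∑ b₂, cΓ * ∑ b₁, (if altProd (altProd a₁ b₁) (altProd a₂ b₂) = g then
          f (a₁, a₂) (b₁, b₂) else 0) := by
          refine sum_congr rfl fun a₂ _ => ?_
          rw [sum_comm]
          simp only [mul_sum]
      _ = ∑ a₂, ∑ b₂, ∑ b₁, K a₁ b₁ b₂ g (T (a₁, a₂)) (altProd a₂ b₂) a₂ := by
          refine sum_congr rfl fun a₂ _ => sum_congr rfl fun b₂ _ => ?_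
          rw [hcΓ, ← sum_completeTo a₁ fun b₁ =>
            if altProd (altProd a₁ b₁) (altProd a₂ b₂) = g then f (a₁, a₂) (b₁, b₂) else 0]
          simp only [altProd_completeTo, hK, hfF]
      _ = ∑ a₂, ∑ b₁, ∑ b₂, K a₁ b₁ b₂ g (T (a₁, a₂)) (altProd a₂ b₂) a₂ :=
          sum_congr rfl fun a₂ _ => sum_comm
      _ = _ := by
          rw [sum_comm]
          exact sum_congr rfl fun b₁ _ => sum_comm
  have hK0 : ∀ a₁ b₁ b₂ g τ p a₂, 0 ≤ K a₁ b₁ b₂ g τ p a₂ := by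
    intro a₁ b₁ b₂ g τ p a₂
    refine sum_nonneg fun c _ => ?_
    split_ifs
    · exact ((hF τ).mem_Icc _ _).1
    · exact le_rfl
  have hK1 : ∀ a₁ b₁ b₂ g τ p a₂, cG * K a₁ b₁ b₂ g τ p a₂ ≤ cΓ := by
    intro a₁ b₁ b₂ g τ p a₂
    have h1 : K a₁ b₁ b₂ g τ p a₂ ≤ ∑ c : Fin J → G, (if altProd c p = g then 1 else 0) := by
      refine sum_le_sum fun c _ => ?_
      split_ifs
      · exact ((hF τ).mem_Icc _ _).2
      · exact le_rfl
    have h2 := card_mul_sum_altProd_eq hJ p g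
    calc cG * K a₁ b₁ b₂ g τ p a₂
        ≤ cG * ∑ c : Fin J → G, (if altProd c p = g then 1 else 0) := by gcongr
      _ = cΓ := by rw [hcG, h2, hcΓ]; simp
  have hmain : ∀ a₁ b₁ b₂, cG * ∑ a₂, (K a₁ b₁ b₂ g (T (a₁, a₂)) (altProd a₂ b₂) a₂ -
      K a₁ b₁ b₂ g' (T (a₁, a₂)) (altProd a₂ b₂) a₂) ≤
      cΓ ^ (q + 1) * (cΓ * δ) + cΓ * ∑ τ, ∑ p, |fiberCount (fun a₂ => T (a₁, a₂)) b₂ τ p -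
        (∑ p', fiberCount (fun a₂ => T (a₁, a₂)) b₂ τ p') / cΓ| := by
    intro a₁ b₁ b₂
    set Δ : M → (Fin J → G) → (Fin (q + 1) → Fin J → G) → ℝ := fun τ p a₂ =>
      K a₁ b₁ b₂ g τ p a₂ - K a₁ b₁ b₂ g' τ p a₂ with hΔ
    set w : M → (Fin J → G) → ℝ := fiberCount (fun a₂ => T (a₁, a₂)) b₂ with hw
    set wb : M → ℝ := fun τ => (∑ p', w τ p') / cΓ with hwb
    have hw0 : ∀ τ p, 0 ≤ w τ p := fun τ p => sum_nonneg fun a _ => by split_ifs <;> simp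
    -- The reduced player knows p and the fixed message and takes the second half a₂ that maximizes
    -- the difference. It need not be consistent with either, since maximizing only increases the
    -- advantage.
    have hmax : ∀ τ p, ∃ a₀, ∀ a, Δ τ p a ≤ Δ τ p a₀ := fun τ p => Finite.exists_max _
    choose ω hω using hmax
    have hΔabs : ∀ τ p a, cG * |Δ τ p a| ≤ cΓ := by
      intro τ p a
      rw [show cG * |Δ τ p a| = |cG * Δ τ p a| by rw [abs_mul, abs_of_pos hcG0], abs_le, hΔ]
      simp only [mul_sub]
      have h1 := hK1 a₁ b₁ b₂ g τ p a
      have h2 := hK1 a₁ b₁ b₂ g' τ p a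
      have h3 := mul_nonneg hcG0.le (hK0 a₁ b₁ b₂ g τ p a)
      have h4 := mul_nonneg hcG0.le (hK0 a₁ b₁ b₂ g' τ p a)
      constructor <;> linarith
    -- With a₁, b₁, b₂ and τ fixed, the holder of c completes b₁ and speaks first, while the holder
    -- of p uses ω τ p. This is an r-round protocol for the interleaved product of c and p.
    have hind : ∀ τ, cG * ∑ p, Δ τ p (ω τ p) ≤ δ * cΓ ^ 2 := by
      intro τ
      have h1 := ih (fun c p => F τ (completeTo a₁ b₁ c, b₂) (a₁, ω τ p))
        ((hF τ).comp (fun c => (completeTo a₁ b₁ c, b₂)) fun p => (a₁, ω τ p)) g g'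
      refine le_trans (le_of_eq ?_) h1
      congr 1
      rw [hΔ, sum_sub_distrib, condSum, condSum, sum_comm, hK]
      congr 1
      rw [sum_comm]
    have hsumw : ∑ τ, ∑ p, w τ p = cΓ ^ (q + 1) := by
      simp only [hw, fiberCount]
      calc _ = ∑ a : Fin (q + 1) → Fin J → G, ∑ τ, ∑ p, (if T (a₁, a) = τ then (1 : ℝ) else 0) *
            (if altProd a b₂ = p then 1 else 0) := by
            rw [sum_comm]
            rw [sum_congr rfl fun p _ => sum_comm]
            rw [sum_comm]
            refine sum_congr rfl fun a _ => sum_comm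
        _ = _ := by
            simp [hcΓ]
    calc cG * ∑ a₂, (K a₁ b₁ b₂ g (T (a₁, a₂)) (altProd a₂ b₂) a₂ -
          K a₁ b₁ b₂ g' (T (a₁, a₂)) (altProd a₂ b₂) a₂)
        ≤ cG * ∑ a₂, Δ (T (a₁, a₂)) (altProd a₂ b₂) (ω (T (a₁, a₂)) (altProd a₂ b₂)) := by
          gcongr with a₂
          exact hω _ _ a₂
      _ = cG * ∑ τ, ∑ p, w τ p * Δ τ p (ω τ p) := by
          congr 1
          simp only [hw, fiberCount, sum_mul]
          rw [sum_congr rfl fun τ _ => sum_comm, sum_comm]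
          refine sum_congr rfl fun a _ => ?_
          simp
      -- Replace the weight w τ p by its mean over p. The mean part is the advantage for uniform p,
      -- and the deviation is multiplied by at most |Γ|.
      _ ≤ ∑ τ, (wb τ * (cG * ∑ p, Δ τ p (ω τ p)) + ∑ p, |w τ p - wb τ| * cΓ) := by
          rw [mul_sum]
          refine sum_le_sum fun τ _ => ?_
          rw [mul_sum, mul_sum, mul_sum, ← sum_add_distrib]
          refine sum_le_sum fun p _ => ?_
          have h1 : (w τ p - wb τ) * (cG * Δ τ p (ω τ p)) ≤ |w τ p - wb τ| * cΓ := by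
            refine (le_abs_self _).trans ?_
            rw [abs_mul, abs_mul, abs_of_pos hcG0]
            exact mul_le_mul_of_nonneg_left (hΔabs _ _ _) (abs_nonneg _)
          linarith
      _ ≤ ∑ τ, (wb τ * (δ * cΓ ^ 2) + ∑ p, |w τ p - wb τ| * cΓ) := by
          refine sum_le_sum fun τ _ => add_le_add (mul_le_mul_of_nonneg_left (hind τ) ?_) le_rfl
          exact div_nonneg (sum_nonneg fun p _ => hw0 τ p) hcΓ0.le
      _ = _ := by
          rw [sum_add_distrib, ← sum_mul, mul_sum]
          congr 1
          · rw [hwb, ← sum_div, hsumw]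
            field_simp
          · refine sum_congr rfl fun τ _ => ?_
            rw [← sum_mul, mul_comm]
  have hfin : cΓ * (cG *
      ((∑ a, ∑ b, if altProd (altProd a.1 b.1) (altProd a.2 b.2) = g then f a b else 0) -
        ∑ a, ∑ b, if altProd (altProd a.1 b.1) (altProd a.2 b.2) = g' then f a b else 0)) ≤
      cΓ * ((δ + ε) * cΓ ^ (4 * (q + 1))) := by
    have e1 : cΓ * (cG *
        ((∑ a, ∑ b, if altProd (altProd a.1 b.1) (altProd a.2 b.2) = g then f a b else 0) -
        ∑ a, ∑ b, if altProd (altProd a.1 b.1) (altProd a.2 b.2) = g' then f a b else 0)) =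
        ∑ a₁, ∑ b₁, ∑ b₂, cG * ∑ a₂, (K a₁ b₁ b₂ g (T (a₁, a₂)) (altProd a₂ b₂) a₂ -
          K a₁ b₁ b₂ g' (T (a₁, a₂)) (altProd a₂ b₂) a₂) := by
      rw [mul_left_comm, mul_sub, hnest, hnest]
      simp only [sum_sub_distrib, ← mul_sum]
    rw [e1]
    calc _ ≤ ∑ a₁ : Fin (q + 1) → Fin J → G, ∑ b₁ : Fin (q + 1) → Fin J → G, ∑ b₂,
          (cΓ ^ (q + 1) * (cΓ * δ) + cΓ * ∑ τ, ∑ p, |fiberCount (fun a₂ => T (a₁, a₂)) b₂ τ p -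
            (∑ p', fiberCount (fun a₂ => T (a₁, a₂)) b₂ τ p') / cΓ|) :=
          sum_le_sum fun a₁ _ => sum_le_sum fun b₁ _ => sum_le_sum fun b₂ _ => hmain a₁ b₁ b₂
      _ ≤ ∑ a₁ : Fin (q + 1) → Fin J → G, ∑ b₁ : Fin (q + 1) → Fin J → G,
          (cΓ ^ (q + 1) * (cΓ ^ (q + 1) * (cΓ * δ)) + cΓ * (cΓ ^ (2 * (q + 1)) * ε)) := by
          refine sum_le_sum fun a₁ _ => sum_le_sum fun b₁ _ => ?_
          rw [sum_add_distrib, ← mul_sum univ _ cΓ]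
          refine add_le_add (le_of_eq ?_) (mul_le_mul_of_nonneg_left (hmix _) hcΓ0.le)
          rw [sum_const, nsmul_eq_mul]
          simp [hcΓ]
      _ = _ := by
          have : ((univ : Finset (Fin (q + 1) → Fin J → G)).card : ℝ) = cΓ ^ (q + 1) := by
            simp [hcΓ]
          rw [sum_const, sum_const, nsmul_eq_mul, nsmul_eq_mul, this]
          ring
  exact le_of_mul_le_mul_left hfin hcΓ0

/-- Splitting a sequence into `J` consecutive pairs of blocks of length `q`. -/
def blockEquiv (G : Type) (J q : ℕ) :
    (Fin (J * (q + q)) → G) ≃ (Fin q → Fin J → G) × (Fin q → Fin J → G) where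
  toFun a := (fun i j => a (finProdFinEquiv (j, Fin.castAdd q i)),
    fun i j => a (finProdFinEquiv (j, Fin.natAdd q i)))
  invFun u k := Fin.addCases (fun i => u.1 i (finProdFinEquiv.symm k).1)
    (fun i => u.2 i (finProdFinEquiv.symm k).1) (finProdFinEquiv.symm k).2
  left_inv a := by
    funext k
    obtain ⟨⟨j, s⟩, rfl⟩ := finProdFinEquiv.surjective k
    simp only [Equiv.symm_apply_apply]
    induction s using Fin.addCases <;> simp only [Fin.addCases_left, Fin.addCases_right]
  right_inv u := by
    ext i j <;> simp only [Equiv.symm_apply_apply, Fin.addCases_left, Fin.addCases_right]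

/-- In block j the product is (first half)(second half), and these are the j-th coordinates of two
interleaved products over G^J. So the long product is again interleaved, now with J factors from
each. -/
lemma altProd_blockEquiv {G : Type} [Group G] {J q : ℕ} (a b : Fin (J * (q + q)) → G) :
    altProd (altProd (blockEquiv G J q a).1 (blockEquiv G J q b).1)
      (altProd (blockEquiv G J q a).2 (blockEquiv G J q b).2) = altProd a b := by
  conv_rhs => rw [altProd, List.ofFn_mul, List.prod_flatten, List.map_ofFn]
  rw [altProd]
  congr 2
  funext j
  rw [altProd_apply, altProd_apply, altProd, altProd, Function.comp_apply, List.ofFn_add,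
    List.prod_append]
  have h : ∀ s : Fin (q + q), finProdFinEquiv (j, s) = ⟨j * (q + q) + s, by
      have := (finProdFinEquiv (j, s)).2
      simp only [finProdFinEquiv_apply_val] at this
      rw [mul_comm, add_comm]; exact this⟩ := by
    intro s
    ext
    simp [mul_comm, add_comm]
  simp only [blockEquiv, Equiv.coe_fn_mk, h]
  rfl

lemma IsCubeShift.mulSingle {G : Type} [Group G] {t J : ℕ} {x : G} (hx : IsCubeShift t x)
    (j : Fin J) : IsCubeShift t (Pi.mulSingle j x : Fin J → G) := by
  obtain ⟨c, h, v, w, rfl⟩ := hx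
  refine ⟨⟨fun x => Pi.mulSingle j (c.σ x), fun x y => ?_, ?_, fun π => ?_⟩,
    Pi.mulSingle j h, v, w, ?_⟩
  · rw [c.map_add, Pi.mulSingle_mul]
  · exact (Pi.mulSingle_injective j).comp c.inj
  · obtain ⟨g, hg⟩ := c.conj π
    refine ⟨Pi.mulSingle j g, fun x => ?_⟩
    rw [← hg, Pi.mulSingle_mul, Pi.mulSingle_mul, Pi.mulSingle_inv]
  · rw [Pi.mulSingle_mul, Pi.mulSingle_mul, Pi.mulSingle_inv]

lemma exists_list_cubeShift_pi {G : Type} [Group G] {t m : ℕ}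
    (hG : ∀ g : G, ∃ L : List G, L.length ≤ m ∧ (∀ x ∈ L, IsCubeShift t x) ∧ L.prod = g) {J : ℕ}
    (g : Fin J → G) :
    ∃ L : List (Fin J → G), L.length ≤ J * m ∧ (∀ x ∈ L, IsCubeShift t x) ∧ L.prod = g := by
  have key : ∀ s : Finset (Fin J), ∀ g : Fin J → G, (∀ i ∉ s, g i = 1) →
      ∃ L : List (Fin J → G), L.length ≤ s.card * m ∧ (∀ x ∈ L, IsCubeShift t x) ∧
        L.prod = g := by
    intro s
    induction s using Finset.induction_on with
    | empty =>
      intro g hg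
      refine ⟨[], by simp, by simp, ?_⟩
      funext i
      simp [hg i]
    | insert j s hj ih =>
      intro g hg
      obtain ⟨L₁, hL₁, hs₁, hp₁⟩ := hG (g j)
      obtain ⟨L₂, hL₂, hs₂, hp₂⟩ := ih (Function.update g j 1) fun i hi => by
        by_cases hij : i = j
        · subst hij; simp
        · rw [Function.update_of_ne hij]; exact hg i (by simp [hij, hi])
      refine ⟨L₁.map (MonoidHom.mulSingle (fun _ : Fin J => G) j) ++ L₂, ?_, ?_, ?_⟩
      · rw [List.length_append, List.length_map, card_insert_of_notMem hj, add_mul, one_mul]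
        omega
      · intro x hx
        rcases List.mem_append.1 hx with hx | hx
        · obtain ⟨y, hy, rfl⟩ := List.mem_map.1 hx
          exact (hs₁ y hy).mulSingle j
        · exact hs₂ x hx
      · rw [List.prod_append, ← map_list_prod, hp₁, hp₂]
        funext i
        by_cases hij : i = j
        · subst hij; simp
        · simp [hij]
  simpa using key univ g (by simp)

/-- For every a exactly one b gives the product g, so an output depending on a alone has the same
sum for all g. -/
lemma condSum_one {n : ℕ} (hn : n = 1) (h : (Fin n → G) → ℝ) (g : G) :
    condSum g (fun a _ => h a) = ∑ a, h a := by
  subst hn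
  refine sum_congr rfl fun a _ => ?_
  rw [← Finset.sum_filter, sum_const, nsmul_eq_mul]
  have : (univ.filter fun b : Fin 1 → G => altProd a b = g) = {fun _ => (a 0)⁻¹ * g} := by
    ext b
    have h2 : altProd a b = a 0 * b 0 := by simp [altProd]
    simp only [mem_filter, mem_univ, true_and, mem_singleton, h2]
    constructor
    · rintro rfl
      funext i
      rw [Subsingleton.elim i 0]; simp
    · rintro rfl; simp
  rw [this, card_singleton, Nat.cast_one, one_mul]

/-- A protocol with few rounds and few messages cannot tell the values of the interleaved product
apart. -/
theorem condSum_sub_le {M : Type} [Fintype M] [DecidableEq M] {q t m : ℕ} (hq : 0 < q)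
    (hG : ∀ g : G, ∃ L : List G, L.length ≤ m ∧ (∀ x ∈ L, IsCubeShift t x) ∧ L.prod = g)
    {l : ℕ} (hl : 0 < l) {η : ℝ} (hη : 0 ≤ η) (hX : (t : ℝ) * (12 * l / t : ℝ) ^ q ≤ 1)
    (hηX : (t : ℝ) * (t * (12 * l / t : ℝ) ^ q) ≤ η ^ 2) (r : ℕ) {n : ℕ} (hn : n = (q + q) ^ r)
    (f : (Fin n → G) → (Fin n → G) → ℝ) (hf : IsProt M r f) (g g' : G) :
    Fintype.card G * (condSum g f - condSum g' f) ≤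
      ((q + q : ℝ) ^ r * (m * (2 * Fintype.card M / 2 ^ (q * l) + 2 * η))) *
        (Fintype.card (Fin n → G) : ℝ) ^ 2 := by
  set ε : ℝ := m * (2 * Fintype.card M / 2 ^ (q * l) + 2 * η) with hε
  have hε0 : 0 ≤ ε := by positivity
  induction r generalizing n g g' with
  | zero =>
    obtain ⟨h, h01, hf⟩ := hf
    have h1 : ∀ g, condSum g f = ∑ a, h a := fun g => by
      rw [show f = fun a _ => h a from funext fun a => funext fun b => hf a b]
      exact condSum_one (hn.trans (pow_zero _)) h g
    rw [h1, h1, sub_self, mul_zero]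
    positivity
  | succ r ih =>
    obtain ⟨q, rfl⟩ : ∃ q', q = q' + 1 := ⟨q - 1, by omega⟩
    obtain ⟨J, hJ⟩ : ∃ J, J = (q + 1 + (q + 1)) ^ r := ⟨_, rfl⟩
    have hJ0 : 0 < J := by rw [hJ]; positivity
    obtain rfl : n = J * (q + 1 + (q + 1)) := by rw [hn, hJ, pow_succ]
    -- The error of this round carries the factor J, because generating G^J one coordinate at a time
    -- takes J·m cube shifts.
    have hstep := condSum_step (G := G) (M := M) (r := r) (q := q) hJ0
      (δ := (((q + 1 : ℕ) : ℝ) + ((q + 1 : ℕ) : ℝ)) ^ r * ε) (ε := J * ε)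
      (fun T => by
        have := sum_fiberCount_sub_average_le (Nat.succ_pos q) T hl hη hX hηX
          (exists_list_cubeShift_pi hG (J := J))
        refine this.trans (le_of_eq ?_)
        rw [hε, Nat.cast_mul, mul_assoc (J : ℝ)])
      (fun f hf g g' => ih hJ f hf g g')
    set E := blockEquiv G J (q + 1) with hE
    have h := hstep (fun a b => f (E.symm a) (E.symm b)) (hf.comp E.symm E.symm) g g'
    have hc : ∀ g, condSum g f = ∑ a, ∑ b,
        if altProd (altProd a.1 b.1) (altProd a.2 b.2) = g then f (E.symm a) (E.symm b) else 0 := by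
      intro g
      rw [← E.sum_comp]
      refine sum_congr rfl fun a _ => ?_
      rw [← E.sum_comp]
      refine sum_congr rfl fun b _ => ?_
      rw [hE, altProd_blockEquiv]
      simp only [Equiv.symm_apply_apply]
    rw [hc, hc]
    refine h.trans ?_
    have hJr : (J : ℝ) = (((q + 1 : ℕ) : ℝ) + ((q + 1 : ℕ) : ℝ)) ^ r := by rw [hJ]; push_cast; ring
    have hcard : (Fintype.card (Fin (J * (q + 1 + (q + 1))) → G) : ℝ) ^ 2 =
        (Fintype.card (Fin J → G) : ℝ) ^ (4 * (q + 1)) := by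
      simp only [Fintype.card_fun, Fintype.card_fin, Nat.cast_pow, ← pow_mul]
      congr 1
      ring
    rw [hcard]
    refine mul_le_mul_of_nonneg_right ?_ (by positivity)
    -- The new error equals the accumulated bound, so the total doubles, and 2 is at most the number
    -- of factors in a block.
    rw [hJr, ← two_mul, pow_succ]
    have h1 : (1 : ℝ) ≤ ((q + 1 : ℕ) : ℝ) := by exact_mod_cast Nat.succ_pos q
    have h2 : 0 ≤ (((q + 1 : ℕ) : ℝ) + ((q + 1 : ℕ) : ℝ)) ^ r * ε := by positivity
    nlinarith

end Elimination

/-! ### Cubes in the alternating group -/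

section Alternating

variable {α β : Type} [Fintype α] [DecidableEq α] [Fintype β] [DecidableEq β]

/-- The homomorphism that lets a permutation of `β` act on two disjoint copies of `β` in `α`. -/
noncomputable def doubleHom (ι : β × Bool ↪ α) : Equiv.Perm β →* alternatingGroup α :=
  MonoidHom.mk' (fun f => ⟨Equiv.Perm.viaEmbeddingHom ι (Equiv.prodCongrLeft fun _ => f), by
    rw [Equiv.Perm.mem_alternatingGroup, Equiv.Perm.viaEmbeddingHom_apply,
      Equiv.Perm.viaEmbedding, Equiv.Perm.sign_extendDomain, Equiv.Perm.sign_prodCongrLeft]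
    simp [Int.units_sq]⟩) fun f g => by
      ext x
      rw [Subgroup.coe_mul, ← map_mul]
      rfl

lemma doubleHom_injective (ι : β × Bool ↪ α) : Function.Injective (doubleHom ι) := by
  intro f g h
  have h1 := Equiv.Perm.viaEmbeddingHom_injective ι (congrArg Subtype.val h)
  ext x
  have h2 := congrArg (fun e => (e (x, true)).1) h1
  simpa using h2

lemma coe_doubleHom_swap (ι : β × Bool ↪ α) (x y : β) :
    (doubleHom ι (Equiv.swap x y) : Equiv.Perm α) =
      Equiv.swap (ι (x, false)) (ι (y, false)) * Equiv.swap (ι (x, true)) (ι (y, true)) := by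
  by_cases hxy : x = y
  · subst hxy; simp [← Equiv.Perm.one_def]
  ext z
  by_cases hz : z ∈ Set.range ι
  · obtain ⟨⟨w, b⟩, rfl⟩ := hz
    have h1 : ((doubleHom ι (Equiv.swap x y) : Equiv.Perm α)) (ι (w, b)) =
        ι (Equiv.swap x y w, b) := by
      exact Equiv.Perm.viaEmbedding_apply _ ι (w, b)
    rw [h1, Equiv.Perm.mul_apply, ι.injective.swap_apply, ι.injective.swap_apply]
    congr 1
    rw [Equiv.swap_apply_def]
    cases b <;> by_cases hx : w = x <;> by_cases hy : w = y <;>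
      simp [Equiv.swap_apply_def, hx, hy, Ne.symm hxy]
  · have h1 : ((doubleHom ι (Equiv.swap x y) : Equiv.Perm α)) z = z :=
      Equiv.Perm.viaEmbedding_apply_of_notMem _ ι z hz
    have h2 : ∀ u, z ≠ ι u := fun u hu => hz ⟨u, hu.symm⟩
    rw [h1, Equiv.Perm.mul_apply, Equiv.swap_apply_of_ne_of_ne (h2 _) (h2 _),
      Equiv.swap_apply_of_ne_of_ne (h2 _) (h2 _)]

/-- A vector over `ZMod 2` flips pairs. -/
def flipPerm {t : ℕ} (x : Fin t → ZMod 2) : Equiv.Perm (Fin t × ZMod 2) where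
  toFun u := (u.1, u.2 + x u.1)
  invFun u := (u.1, u.2 - x u.1)
  left_inv u := by simp
  right_inv u := by simp

lemma flipPerm_single_add_single {t : ℕ} {v w : Fin t} (h : v ≠ w) :
    flipPerm (Pi.single v 1 + Pi.single w 1) =
      Equiv.swap (v, 0) (v, 1) * Equiv.swap (w, 0) (w, 1) := by
  ext1 ⟨u, i⟩
  have h2 : i = 0 ∨ i = 1 := zmod_two_cases i
  have h3 : (1 : ZMod 2) + 1 = 0 := rfl
  rcases h2 with rfl | rfl <;> by_cases hv : u = v <;> by_cases hw : u = w <;>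
    simp_all [flipPerm, Equiv.swap_apply_def]

/-- The cube of pair flips in the alternating group. -/
noncomputable def flipCube {t : ℕ} (ι : (Fin t × ZMod 2) × Bool ↪ α) :
    CubeEmbedding (alternatingGroup α) t where
  σ x := doubleHom ι (flipPerm x)
  map_add x y := by
    rw [← map_mul]
    congr 1
    ext1 u
    simp only [flipPerm, Equiv.coe_fn_mk, Equiv.Perm.mul_apply, Pi.add_apply, Prod.mk.injEq,
      true_and]
    ring
  inj := by
    refine (doubleHom_injective ι).comp fun x y h => ?_
    funext v
    simpa [flipPerm] using congrArg (fun e => (e (v, 0)).2) h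
  conj π := by
    refine ⟨doubleHom ι (Equiv.prodCongr π.symm (Equiv.refl _)), fun x => ?_⟩
    rw [← map_inv, ← map_mul, ← map_mul]
    congr 1
    ext1 u
    simp [flipPerm, Equiv.Perm.inv_def, Equiv.Perm.mul_apply]

/-- Products of four disjoint transpositions are cube shifts. -/
lemma isCubeShift_four_swaps {t : ℕ} (ht : 2 ≤ t) (hα : t * 4 ≤ Fintype.card α)
    (y : Fin 8 ↪ α) (g : alternatingGroup α)
    (hg : (g : Equiv.Perm α) = Equiv.swap (y 0) (y 1) * Equiv.swap (y 2) (y 3) *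
      (Equiv.swap (y 4) (y 5) * Equiv.swap (y 6) (y 7))) : IsCubeShift t g := by
  obtain ⟨ι₀⟩ : Nonempty ((Fin t × ZMod 2) × Bool ↪ α) := by
    refine Function.Embedding.nonempty_of_card_le ?_
    simp only [Fintype.card_prod, Fintype.card_fin, ZMod.card, Fintype.card_bool]
    omega
  set v : Fin t := ⟨0, by omega⟩ with hv
  set w : Fin t := ⟨1, by omega⟩ with hw
  have hvw : v ≠ w := by simp [hv, hw]
  set x : Fin 8 → α := ![ι₀ ((v, 0), false), ι₀ ((v, 1), false), ι₀ ((v, 0), true),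
    ι₀ ((v, 1), true), ι₀ ((w, 0), false), ι₀ ((w, 1), false), ι₀ ((w, 0), true),
    ι₀ ((w, 1), true)] with hx
  have hxi : Function.Injective x := by
    intro i j hij
    fin_cases i <;> fin_cases j <;> simp [hx, hvw, hvw.symm] at hij ⊢
  -- The symmetric group is 8-transitive, so relabelling the points of one flip cube by ρ moves its
  -- four transpositions to the prescribed ones.
  obtain ⟨ρ, hρ⟩ := (Equiv.Perm.isMultiplyPretransitive α 8).exists_smul_eq ⟨x, hxi⟩ y
  have hρ' : ∀ i, ρ (x i) = y i := fun i => by rw [← hρ]; rfl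
  refine ⟨flipCube (ι₀.trans ρ.toEmbedding), 1, v, w, ?_⟩
  rw [one_mul, inv_one, mul_one]
  apply Subtype.ext
  simp only [flipCube]
  rw [flipPerm_single_add_single hvw, map_mul, Subgroup.coe_mul, coe_doubleHom_swap,
    coe_doubleHom_swap, hg]
  simp only [← hρ']
  rfl

lemma exists_fin_six_avoiding (hα : 10 ≤ Fintype.card α) (a b c d : α) :
    ∃ e : Fin 6 ↪ α, ∀ i, e i ≠ a ∧ e i ≠ b ∧ e i ≠ c ∧ e i ≠ d := by
  have h : Fintype.card (Fin 6) ≤ Fintype.card {x // x ∈ ({a, b, c, d} : Finset α)ᶜ} := by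
    rw [Fintype.card_fin, Fintype.card_coe, card_compl]
    have := card_le_four (a := a) (b := b) (c := c) (d := d)
    omega
  obtain ⟨e⟩ := Function.Embedding.nonempty_of_card_le h
  refine ⟨e.trans (Function.Embedding.subtype _), fun i => ?_⟩
  have := (e i).2
  simp only [mem_compl, mem_insert, mem_singleton, not_or] at this
  exact this

/-- Insert three transpositions and their inverses between s and s'. They need six points avoiding
the at most four points of s and s', hence the ten points. -/
lemma exists_cubeShift_mul_eq {t : ℕ} (ht : 2 ≤ t) (hα : t * 4 ≤ Fintype.card α)
    (hα' : 10 ≤ Fintype.card α) {s s' : Equiv.Perm α} (hs : s.IsSwap) (hs' : s'.IsSwap) :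
    ∃ x y : alternatingGroup α, IsCubeShift t x ∧ IsCubeShift t y ∧
      ((x * y : alternatingGroup α) : Equiv.Perm α) = s * s' := by
  obtain ⟨a, b, hab, rfl⟩ := hs
  obtain ⟨c, d, hcd, rfl⟩ := hs'
  obtain ⟨e, he⟩ := exists_fin_six_avoiding hα' a b c d
  have hne : ∀ i j, i ≠ j → e i ≠ e j := fun i j h => e.injective.ne h
  have hy : Function.Injective ![a, b, e 0, e 1, e 2, e 3, e 4, e 5] := by
    intro i j hij
    fin_cases i <;> fin_cases j <;>
      simp [hab, hab.symm, (he _).1, (he _).2.1, ((he _).1).symm, ((he _).2.1).symm] at hij ⊢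
  have hz : Function.Injective ![e 4, e 5, e 2, e 3, e 0, e 1, c, d] := by
    intro i j hij
    fin_cases i <;> fin_cases j <;>
      simp [hcd, hcd.symm, (he _).2.2.1, (he _).2.2.2, ((he _).2.2.1).symm,
        ((he _).2.2.2).symm] at hij ⊢
  have hmem : ∀ y : Fin 8 ↪ α, Equiv.swap (y 0) (y 1) * Equiv.swap (y 2) (y 3) *
      (Equiv.swap (y 4) (y 5) * Equiv.swap (y 6) (y 7)) ∈ alternatingGroup α := by
    intro y
    rw [Equiv.Perm.mem_alternatingGroup]
    simp [y.injective.ne]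
  refine ⟨⟨_, hmem ⟨_, hy⟩⟩, ⟨_, hmem ⟨_, hz⟩⟩, isCubeShift_four_swaps ht hα ⟨_, hy⟩ _ rfl,
    isCubeShift_four_swaps ht hα ⟨_, hz⟩ _ rfl, ?_⟩
  simp [mul_assoc]

lemma exists_list_swap (g : Equiv.Perm α) :
    ∃ L : List (Equiv.Perm α), L.length ≤ #g.support ∧ (∀ x ∈ L, x.IsSwap) ∧ L.prod = g := by
  induction hn : #g.support using Nat.strong_induction_on generalizing g with
  | _ n ih =>
    subst hn
    by_cases hg : g = 1
    · exact ⟨[], by simp, by simp, by simp [hg]⟩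
    obtain ⟨a, ha⟩ : ∃ a, g a ≠ a := by
      by_contra! h
      exact hg (Equiv.ext h)
    have hlt := Equiv.Perm.card_support_swap_mul ha
    obtain ⟨L, hL, hs, hp⟩ := ih _ hlt _ rfl
    refine ⟨Equiv.swap a (g a) :: L, ?_, ?_, ?_⟩
    · rw [List.length_cons]; omega
    · intro x hx
      rcases List.mem_cons.1 hx with rfl | hx
      · exact ⟨a, g a, ha.symm, rfl⟩
      · exact hs x hx
    · rw [List.prod_cons, hp, ← mul_assoc, Equiv.swap_mul_self, one_mul]

lemma exists_list_cubeShift_of_swaps {t : ℕ} (ht : 2 ≤ t) (hα : t * 4 ≤ Fintype.card α)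
    (hα' : 10 ≤ Fintype.card α) : ∀ L : List (Equiv.Perm α), Even L.length →
      (∀ x ∈ L, x.IsSwap) → ∃ L' : List (alternatingGroup α), L'.length = L.length ∧
        (∀ x ∈ L', IsCubeShift t x) ∧ (L'.prod : Equiv.Perm α) = L.prod
  | [], _, _ => ⟨[], rfl, by simp, by simp⟩
  | [_], h, _ => by simp at h
  | s :: s' :: L, h, hs => by
    obtain ⟨L', hl, hc, hp⟩ := exists_list_cubeShift_of_swaps ht hα hα' L
      (by simpa [Nat.even_add_one] using h) fun x hx => hs x (by simp [hx])
    obtain ⟨x, y, hx, hy, hxy⟩ := exists_cubeShift_mul_eq ht hα hα' (hs s (by simp))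
      (hs s' (by simp))
    refine ⟨x :: y :: L', by simp [hl], by simpa [hx, hy] using hc, ?_⟩
    rw [List.prod_cons, List.prod_cons, List.prod_cons, List.prod_cons, ← mul_assoc, ← mul_assoc,
      Subgroup.coe_mul, hp, hxy]

/-- Every even permutation is a product of a linear number of cube shifts. -/
lemma exists_list_cubeShift {t : ℕ} (ht : 2 ≤ t) (hα : t * 4 ≤ Fintype.card α)
    (hα' : 10 ≤ Fintype.card α) (g : alternatingGroup α) :
    ∃ L : List (alternatingGroup α), L.length ≤ Fintype.card α ∧ (∀ x ∈ L, IsCubeShift t x) ∧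
      L.prod = g := by
  obtain ⟨L, hL, hs, hp⟩ := exists_list_swap (g : Equiv.Perm α)
  have hev : Even L.length := by
    have h1 := Equiv.Perm.sign_prod_list_swap hs
    rw [hp, Equiv.Perm.mem_alternatingGroup.1 g.2] at h1
    by_contra hodd
    rw [Nat.not_even_iff_odd] at hodd
    rw [hodd.neg_one_pow] at h1
    exact absurd h1 (by decide)
  obtain ⟨L', hl, hc, hp'⟩ := exists_list_cubeShift_of_swaps ht hα hα' L hev hs
  exact ⟨L', hl.trans_le (hL.trans (card_le_univ _)), hc, Subtype.ext (hp'.trans hp)⟩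

end Alternating

/-! ### Graphs of interleaved products -/

section Cycle

variable {V : Type} {H : SimpleGraph V} {P : ℕ} {φ : ℕ → V}

lemma adj_iff_cycleGraph_adj (hP : 3 ≤ P) (hper : Function.Periodic φ P)
    (hinj : Function.Injective fun i : Fin P => φ i)
    (hadj : ∀ u w, H.Adj (φ (u + 1)) w ↔ w = φ u ∨ w = φ (u + 2)) (i j : Fin P) :
    H.Adj (φ i) (φ j) ↔ (SimpleGraph.cycleGraph P).Adj i j := by
  obtain ⟨P, rfl⟩ : ∃ P', P = P' + 2 := ⟨P - 2, by omega⟩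
  have hs : ∀ i : Fin (P + 2), φ ((i + 1 : Fin (P + 2)) : ℕ) = φ (i + 1) := by
    intro i
    rw [Fin.val_add, hper.map_mod_nat, Fin.val_one]
  -- Neighbours are only described at successors u + 1, so i is written cyclically as (i - 1) + 1;
  -- periodicity absorbs the wraparound.
  have h1 : φ i = φ ((i - 1 : Fin (P + 2)) + 1) := by rw [← hs, sub_add_cancel]
  have h2 : φ ((i - 1 : Fin (P + 2)) + 2) = φ (i + 1 : Fin (P + 2)) := by
    rw [hs, ← hper.map_mod_nat (i + 1), ← hper.map_mod_nat (_ + 2)]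
    congr 1
    have h3 : ((i - 1 : Fin (P + 2)) + 1 : Fin (P + 2)) = i := sub_add_cancel _ _
    have h4 : (((i - 1 : Fin (P + 2)) : ℕ) + 1) % (P + 2) = i := by
      rw [← congrArg Fin.val h3, Fin.val_add, Fin.val_one]
    conv_rhs => rw [← h4]
    rw [Nat.mod_add_mod]
  rw [h1, hadj, h2, SimpleGraph.cycleGraph_adj]
  have h3 : ∀ j' : Fin (P + 2), φ j = φ j' ↔ j = j' := fun j' => hinj.eq_iff
  rw [h3, h3]
  constructor
  · rintro (h | h)
    · left; rw [h]; abel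
    · right; rw [h]; abel
  · rintro (h | h)
    · left; rw [← h]; abel
    · right; rw [← h]; abel

lemma nonempty_iso_cycleGraph (hP : 3 ≤ P) (hper : Function.Periodic φ P)
    (hinj : Function.Injective fun i : Fin P => φ i)
    (hadj : ∀ u w, H.Adj (φ (u + 1)) w ↔ w = φ u ∨ w = φ (u + 2))
    (hsurj : Function.Surjective fun i : Fin P => φ i) :
    Nonempty (H ≃g SimpleGraph.cycleGraph P) :=
  ⟨(⟨Equiv.ofBijective _ ⟨hinj, hsurj⟩, fun {i j} =>
    adj_iff_cycleGraph_adj hP hper hinj hadj i j⟩ : SimpleGraph.cycleGraph P ≃g H).symm⟩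

lemma nonempty_component_iso_cycleGraph (hP : 3 ≤ P) (hper : Function.Periodic φ P)
    (hinj : Function.Injective fun i : Fin P => φ i)
    (hadj : ∀ u w, H.Adj (φ (u + 1)) w ↔ w = φ u ∨ w = φ (u + 2)) :
    Nonempty ((H.connectedComponentMk (φ 0)).toSimpleGraph ≃g SimpleGraph.cycleGraph P) := by
  have hreach : ∀ i, H.Reachable (φ i) (φ 0) := by
    intro i
    induction i with
    | zero => exact SimpleGraph.Reachable.refl _
    | succ i ih => exact ((hadj i (φ i)).2 (Or.inl rfl)).reachable.trans ih
  have hclosed : ∀ w, H.Reachable (φ 0) w → ∃ i : Fin P, φ i = w := by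
    intro w hw
    rw [SimpleGraph.reachable_iff_reflTransGen] at hw
    have : ∃ i : ℕ, φ i = w := by
      induction hw with
      | refl => exact ⟨0, rfl⟩
      | tail _ h ih =>
        obtain ⟨i, rfl⟩ := ih
        rw [← hper i, show i + P = i + P - 1 + 1 by omega, hadj] at h
        rcases h with h | h <;> exact ⟨_, h.symm⟩
    obtain ⟨i, rfl⟩ := this
    exact ⟨⟨i % P, Nat.mod_lt _ (by omega)⟩, hper.map_mod_nat i⟩
  have hmem : ∀ i, φ i ∈ (H.connectedComponentMk (φ 0)).supp := fun i => by
    rw [SimpleGraph.ConnectedComponent.mem_supp_iff, SimpleGraph.ConnectedComponent.eq]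
    exact hreach i
  refine ⟨(⟨Equiv.ofBijective (fun i : Fin P =>
    (⟨φ i, hmem i⟩ : (H.connectedComponentMk (φ 0)).supp)) ⟨?_, ?_⟩, fun {i j} =>
    adj_iff_cycleGraph_adj hP hper hinj hadj i j⟩ :
      SimpleGraph.cycleGraph P ≃g (H.connectedComponentMk (φ 0)).toSimpleGraph).symm⟩
  · intro i j h
    exact hinj (congrArg Subtype.val h)
  · rintro ⟨w, hw⟩
    have hw' : w ∈ (H.connectedComponentMk (φ 0)).supp := hw
    rw [SimpleGraph.ConnectedComponent.mem_supp_iff, SimpleGraph.ConnectedComponent.eq] at hw'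
    obtain ⟨i, hi⟩ := hclosed w hw'.symm
    exact ⟨i, Subtype.ext hi⟩

end Cycle

/-! ### Cycles of the graph as orbits of one permutation -/

namespace OMC

variable {n : ℕ} {A B : Matching n}

lemma graph_adj_inl {i : Fin (n / 2)} {w : Fin (n / 2) ⊕ Fin (n / 2)} :
    (graph A B).Adj (Sum.inl i) w ↔ w = Sum.inr (A i) ∨ w = Sum.inr (B i) := by
  rw [graph, SimpleGraph.fromRel_adj]
  constructor
  · rintro ⟨-, ⟨j, hj, h⟩ | ⟨j, rfl, h⟩⟩
    · rw [Sum.inl.injEq] at hj; subst hj; exact h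
    · simp at h
  · rintro (rfl | rfl)
    · exact ⟨by simp, Or.inl ⟨i, rfl, Or.inl rfl⟩⟩
    · exact ⟨by simp, Or.inl ⟨i, rfl, Or.inr rfl⟩⟩

lemma graph_adj_inr {i : Fin (n / 2)} {w : Fin (n / 2) ⊕ Fin (n / 2)} :
    (graph A B).Adj (Sum.inr i) w ↔ w = Sum.inl (A.symm i) ∨ w = Sum.inl (B.symm i) := by
  cases w with
  | inl j =>
    rw [SimpleGraph.adj_comm, graph_adj_inl]
    simp [Equiv.eq_symm_apply, eq_comm]
  | inr j =>
    rw [graph, SimpleGraph.fromRel_adj]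
    simp

/-- The walk through the graph that starts at the left vertex `x` with an edge of `A`. -/
def walkFrom (A B : Matching n) (x : Fin (n / 2)) (u : ℕ) : Fin (n / 2) ⊕ Fin (n / 2) :=
  if u % 2 = 0 then Sum.inl (((A.trans B.symm : Equiv.Perm _) ^ (u / 2)) x)
  else Sum.inr (A (((A.trans B.symm : Equiv.Perm _) ^ (u / 2)) x))

lemma walkFrom_two_mul (x : Fin (n / 2)) (j : ℕ) :
    walkFrom A B x (2 * j) = Sum.inl (((A.trans B.symm : Equiv.Perm _) ^ j) x) := by
  simp [walkFrom]

lemma walkFrom_two_mul_add_one (x : Fin (n / 2)) (j : ℕ) :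
    walkFrom A B x (2 * j + 1) = Sum.inr (A (((A.trans B.symm : Equiv.Perm _) ^ j) x)) := by
  have h : (2 * j + 1) / 2 = j := by omega
  simp [walkFrom, h]

lemma adj_walkFrom (x : Fin (n / 2)) (u : ℕ) (w : Fin (n / 2) ⊕ Fin (n / 2)) :
    (graph A B).Adj (walkFrom A B x (u + 1)) w ↔
      w = walkFrom A B x u ∨ w = walkFrom A B x (u + 2) := by
  have hstep : ∀ j, ((A.trans B.symm : Equiv.Perm _) ^ (j + 1)) x =
      B.symm (A (((A.trans B.symm : Equiv.Perm _) ^ j) x)) := by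
    intro j
    rw [pow_succ', Equiv.Perm.mul_apply]
    rfl
  obtain ⟨j, rfl | rfl⟩ := Nat.even_or_odd' u
  · rw [walkFrom_two_mul_add_one, walkFrom_two_mul, show 2 * j + 2 = 2 * (j + 1) by ring,
      walkFrom_two_mul, graph_adj_inr, hstep, A.symm_apply_apply]
  · rw [walkFrom_two_mul_add_one, show 2 * j + 1 + 1 = 2 * (j + 1) by ring,
      show 2 * j + 1 + 2 = 2 * (j + 1) + 1 by ring, walkFrom_two_mul_add_one, walkFrom_two_mul,
      graph_adj_inl, or_comm]
    conv_lhs => rw [hstep, B.apply_symm_apply, ← hstep]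

lemma walkFrom_periodic {x : Fin (n / 2)} {l : ℕ}
    (hl : ((A.trans B.symm : Equiv.Perm _) ^ l) x = x) :
    Function.Periodic (walkFrom A B x) (2 * l) := by
  have hstep : ∀ j, ((A.trans B.symm : Equiv.Perm _) ^ (j + l)) x =
      ((A.trans B.symm : Equiv.Perm _) ^ j) x := by
    intro j
    rw [pow_add, Equiv.Perm.mul_apply, hl]
  intro u
  obtain ⟨j, rfl | rfl⟩ := Nat.even_or_odd' u
  · rw [← mul_add, walkFrom_two_mul, walkFrom_two_mul, hstep]
  · rw [show 2 * j + 1 + 2 * l = 2 * (j + l) + 1 by ring, walkFrom_two_mul_add_one,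
      walkFrom_two_mul_add_one, hstep]

lemma walkFrom_injective {x : Fin (n / 2)} {l : ℕ}
    (hmin : ∀ d, 0 < d → d < l → ((A.trans B.symm : Equiv.Perm _) ^ d) x ≠ x) :
    Function.Injective fun i : Fin (2 * l) => walkFrom A B x i := by
  have hpow : ∀ i j, i < l → j < l → i ≤ j → ((A.trans B.symm : Equiv.Perm _) ^ i) x =
      ((A.trans B.symm : Equiv.Perm _) ^ j) x → i = j := by
    intro i j hi hj hij h
    by_contra hne
    refine hmin (j - i) (by omega) (by omega) ?_
    rw [← Nat.add_sub_cancel' hij, pow_add, Equiv.Perm.mul_apply] at h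
    exact (((A.trans B.symm : Equiv.Perm _) ^ i).injective h).symm
  have hpow' : ∀ i j, i < l → j < l → ((A.trans B.symm : Equiv.Perm _) ^ i) x =
      ((A.trans B.symm : Equiv.Perm _) ^ j) x → i = j := by
    intro i j hi hj h
    rcases le_total i j with hij | hij
    · exact hpow i j hi hj hij h
    · exact (hpow j i hj hi hij h.symm).symm
  rintro ⟨i, hi⟩ ⟨j, hj⟩ h
  rw [Fin.mk.injEq]
  simp only at h
  obtain ⟨i, rfl | rfl⟩ := Nat.even_or_odd' i <;> obtain ⟨j, rfl | rfl⟩ := Nat.even_or_odd' j <;>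
    simp only [walkFrom_two_mul, walkFrom_two_mul_add_one, Sum.inl.injEq, Sum.inr.injEq,
      reduceCtorEq, EmbeddingLike.apply_eq_iff_eq] at h
  · rw [hpow' i j (by omega) (by omega) h]
  · rw [hpow' i j (by omega) (by omega) h]

/-- Following an edge of A and then an edge of B back permutes the left vertices. An orbit of length
l is a cycle of length 2l in the graph. -/
lemma isNo_of_orbits {l : ℕ} (hl : 2 ≤ l)
    (h : ∀ x, ((A.trans B.symm : Equiv.Perm _) ^ l) x = x)
    (hmin : ∀ x d, 0 < d → d < l → ((A.trans B.symm : Equiv.Perm _) ^ d) x ≠ x) :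
    IsNo (2 * l) A B := by
  refine ⟨fun i hi => hmin i 1 one_pos (by omega) ?_, fun c => ?_⟩
  · simp [hi]
  have hrep : ∃ x, c = (graph A B).connectedComponentMk (Sum.inl x) := by
    induction c using SimpleGraph.ConnectedComponent.ind with
    | _ v =>
      cases v with
      | inl x => exact ⟨x, rfl⟩
      | inr y =>
        refine ⟨A.symm y, ?_⟩
        rw [SimpleGraph.ConnectedComponent.eq]
        exact (graph_adj_inr.2 (Or.inl rfl)).reachable
  obtain ⟨x, rfl⟩ := hrep
  have := nonempty_component_iso_cycleGraph (H := graph A B) (P := 2 * l) (by omega)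
    (walkFrom_periodic (h x)) (walkFrom_injective (hmin x)) (adj_walkFrom x)
  have h0 : walkFrom A B x 0 = Sum.inl x := by rw [← mul_zero 2, walkFrom_two_mul]; simp
  rwa [h0] at this

lemma isYes_of_orbit {l : ℕ} (hl : 2 ≤ l) (hn : n = 2 * l) {x : Fin (n / 2)}
    (h : ((A.trans B.symm : Equiv.Perm _) ^ l) x = x)
    (hmin : ∀ d, 0 < d → d < l → ((A.trans B.symm : Equiv.Perm _) ^ d) x ≠ x) :
    IsYes A B := by
  have hinj := walkFrom_injective hmin
  have hsurj : Function.Surjective fun i : Fin (2 * l) => walkFrom A B x i := by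
    refine ((Fintype.bijective_iff_injective_and_card _).2 ⟨hinj, ?_⟩).2
    simp only [Fintype.card_fin, Fintype.card_sum]
    omega
  refine ⟨fun i hi => ?_, ?_⟩
  · obtain ⟨u, hu⟩ := hsurj (Sum.inl i)
    obtain ⟨j, hj | hj⟩ := Nat.even_or_odd' (u : ℕ)
    · simp only [hj, walkFrom_two_mul, Sum.inl.injEq] at hu
      refine hmin 1 one_pos (by omega) ?_
      have h1 : (A.trans B.symm : Equiv.Perm _) i = i := by simp [hi]
      rw [← hu, ← Equiv.Perm.mul_apply, ← pow_succ', pow_succ, Equiv.Perm.mul_apply] at h1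
      rw [pow_one]
      exact ((A.trans B.symm : Equiv.Perm _) ^ j).injective h1
    · simp [hj, walkFrom_two_mul_add_one] at hu
  · have := nonempty_iso_cycleGraph (H := graph A B) (P := 2 * l) (by omega)
      (walkFrom_periodic h) hinj (adj_walkFrom x) hsurj
    rw [← hn] at this
    exact this

end OMC

/-! ### Layered permutations and the encoding of products -/

section Layers

variable {m p : ℕ}

/-- The permutation that moves layer `i` to layer `i + 1` by the inverse of `h i`. -/
def layerPerm (h : Fin (p + 1) → Equiv.Perm (Fin m)) : Equiv.Perm (Fin (p + 1) × Fin m) :=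
  Equiv.prodShear (finRotate (p + 1)) fun i => (h i)⁻¹

lemma layerPerm_apply (h : Fin (p + 1) → Equiv.Perm (Fin m)) (x : Fin (p + 1) × Fin m) :
    layerPerm h x = (x.1 + 1, (h x.1)⁻¹ x.2) := by
  simp [layerPerm, Equiv.prodShear]

lemma layerPerm_pow_fst (h : Fin (p + 1) → Equiv.Perm (Fin m)) (x : Fin (p + 1) × Fin m) (j : ℕ) :
    (((layerPerm h ^ j) x).1 : ℕ) = (x.1 + j) % (p + 1) := by
  induction j with
  | zero => simp [Nat.mod_eq_of_lt x.1.2]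
  | succ j ih =>
    rw [pow_succ', Equiv.Perm.mul_apply, layerPerm_apply, Fin.val_add, ih, ← Nat.add_mod_mod,
      Fin.val_one', ← add_assoc, Nat.mod_add_mod]
    simp

/-- The maps of successive layers compose from right to left. Taking inverses makes them assemble
the inverse of the product in its natural order. -/
lemma layerPerm_pow_zero (h : Fin (p + 1) → Equiv.Perm (Fin m)) (v : Fin m) (j : ℕ)
    (hj : j ≤ p + 1) :
    ((layerPerm h ^ j) (0, v)).2 = (((List.ofFn h).take j).prod)⁻¹ v := by
  induction j with
  | zero => simp
  | succ j ih =>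
    have h1 : ((layerPerm h ^ j) (0, v)).1 = ⟨j, hj⟩ := by
      ext
      rw [layerPerm_pow_fst]
      simpa using hj
    rw [pow_succ', Equiv.Perm.mul_apply, layerPerm_apply, ih (by omega), h1,
      List.prod_take_succ _ _ (by simpa using hj), mul_inv_rev, Equiv.Perm.mul_apply,
      List.getElem_ofFn]

lemma layerPerm_pow_card_zero (h : Fin (p + 1) → Equiv.Perm (Fin m)) (v : Fin m) :
    (layerPerm h ^ (p + 1)) (0, v) = (0, ((List.ofFn h).prod)⁻¹ v) := by
  refine Prod.ext ?_ ?_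
  · ext
    rw [layerPerm_pow_fst]
    simp
  · rw [layerPerm_pow_zero h v _ le_rfl, List.take_of_length_le (by simp)]

lemma layerPerm_pow_mul_zero (h : Fin (p + 1) → Equiv.Perm (Fin m)) (v : Fin m) (w : ℕ) :
    (layerPerm h ^ ((p + 1) * w)) (0, v) = (0, (((List.ofFn h).prod)⁻¹ ^ w) v) := by
  induction w with
  | zero => simp
  | succ w ih =>
    rw [mul_add, mul_one, add_comm _ (p + 1), pow_add, Equiv.Perm.mul_apply, ih,
      layerPerm_pow_card_zero,
      pow_succ', Equiv.Perm.mul_apply]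

lemma exists_layerPerm_pow_eq (h : Fin (p + 1) → Equiv.Perm (Fin m)) (x : Fin (p + 1) × Fin m) :
    ∃ v, (layerPerm h ^ (x.1 : ℕ)) (0, v) = x := by
  refine ⟨((List.ofFn h).take x.1).prod x.2, Prod.ext ?_ ?_⟩
  · ext
    rw [layerPerm_pow_fst]
    simpa using Nat.mod_eq_of_lt x.1.2
  · rw [layerPerm_pow_zero h _ _ x.1.2.le, ← Equiv.Perm.mul_apply, inv_mul_cancel,
      Equiv.Perm.one_apply]

lemma layerPerm_pow_card (h : Fin (p + 1) → Equiv.Perm (Fin m)) (h1 : (List.ofFn h).prod = 1)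
    (x : Fin (p + 1) × Fin m) : (layerPerm h ^ (p + 1)) x = x := by
  obtain ⟨v, hv⟩ := exists_layerPerm_pow_eq h x
  rw [← hv, ← Equiv.Perm.mul_apply, ← pow_add, add_comm (p + 1), pow_add, Equiv.Perm.mul_apply,
    layerPerm_pow_card_zero, h1, inv_one, Equiv.Perm.one_apply]

lemma dvd_of_layerPerm_pow_eq (h : Fin (p + 1) → Equiv.Perm (Fin m)) {x : Fin (p + 1) × Fin m}
    {d : ℕ} (hd : (layerPerm h ^ d) x = x) : p + 1 ∣ d := by
  have h1 := layerPerm_pow_fst h x d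
  rw [hd] at h1
  have h2 : (x.1 : ℕ) + 0 ≡ x.1 + d [MOD p + 1] := by
    rw [Nat.ModEq, ← h1]
    simpa using Nat.mod_eq_of_lt x.1.2
  exact (Nat.modEq_zero_iff_dvd).1 (Nat.ModEq.add_left_cancel' _ h2).symm

lemma finRotate_pow_zero (m w : ℕ) : (((finRotate (m + 1)) ^ w) 0 : ℕ) = w % (m + 1) := by
  induction w with
  | zero => simp
  | succ w ih =>
    rw [pow_succ', Equiv.Perm.mul_apply, finRotate_apply, Fin.val_add, ih]
    simp

/-- Interleaved products are encoded by pairs of matchings: a trivial product becomes a union of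
short cycles, and a cyclic rotation a Hamiltonian cycle. -/
lemma exists_matchings_of_altProd {n m p N : ℕ} (hp : 2 ≤ p) (hm : 0 < m) (hn : n = m * (2 * p))
    (hN : N ≤ p) :
    ∃ Φ Ψ : (Fin N → Equiv.Perm (Fin m)) → OMC.Matching n, ∀ a b,
      (altProd a b = 1 → OMC.IsNo (2 * p) (Φ a) (Ψ b)) ∧
      (altProd a b = (finRotate m)⁻¹ → OMC.IsYes (Φ a) (Ψ b)) := by
  obtain ⟨d, rfl⟩ : ∃ d, p = N + d := ⟨p - N, by omega⟩
  obtain ⟨p, hp'⟩ : ∃ p, N + d = p + 1 := ⟨N + d - 1, by omega⟩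
  obtain ⟨m, rfl⟩ : ∃ m', m = m' + 1 := ⟨m - 1, by omega⟩
  have hn2 : n = 2 * ((p + 1) * (m + 1)) := by rw [hn, hp']; ring
  have E : Fin (p + 1) × Fin (m + 1) ≃ Fin (n / 2) :=
    finProdFinEquiv.trans (finCongr (by omega))
  -- Layers beyond the N given factors carry the identity, so they lengthen the cycles to 2p without
  -- changing the product.
  set pad : (Fin N → Equiv.Perm (Fin (m + 1))) → Fin (p + 1) → Equiv.Perm (Fin (m + 1)) :=
    fun a i => Fin.append a (fun _ : Fin d => 1) (Fin.cast hp'.symm i) with hpad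
  have hprod : ∀ a b, (List.ofFn fun i => pad a i * pad b i).prod = altProd a b := by
    intro a b
    have h1 : (List.ofFn fun i => pad a i * pad b i) = List.ofFn fun i : Fin (N + d) =>
        Fin.append a (fun _ : Fin d => 1) i * Fin.append b (fun _ : Fin d => 1) i := by
      rw [List.ofFn_congr hp']
    rw [h1, List.ofFn_add, List.prod_append, altProd]
    have h2 : ∀ i : Fin d, Fin.append a (fun _ : Fin d => (1 : Equiv.Perm (Fin (m + 1))))
        (Fin.natAdd N i) = 1 := fun i => Fin.append_right _ _ i
    have h3 : ∀ i : Fin d, Fin.append b (fun _ : Fin d => (1 : Equiv.Perm (Fin (m + 1))))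
        (Fin.natAdd N i) = 1 := fun i => Fin.append_right _ _ i
    simp only [h2, h3]
    simp
  set Φ : (Fin N → Equiv.Perm (Fin (m + 1))) → OMC.Matching n := fun a =>
    E.symm.trans ((Equiv.prodShear (Equiv.refl _) fun i => (pad a i)⁻¹).trans E) with hΦ
  set Ψ : (Fin N → Equiv.Perm (Fin (m + 1))) → OMC.Matching n := fun b =>
    (E.symm.trans ((layerPerm (pad b)).trans E)).symm with hΨ
  -- Alice moves inside layer i by aᵢ⁻¹, and Bob then moves to layer i + 1 by bᵢ⁻¹. Together this is
  -- the inverse of aᵢbᵢ, as `layerPerm` requires.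
  have hc : ∀ a b, ((Φ a).trans (Ψ b).symm : Equiv.Perm _) =
      E.permCongrHom (layerPerm fun i => pad a i * pad b i) := by
    intro a b
    ext x
    simp [hΦ, hΨ, layerPerm_apply, Equiv.prodShear]
  have hcp : ∀ a b j x, (((Φ a).trans (Ψ b).symm : Equiv.Perm _) ^ j) (E x) =
      E (((layerPerm fun i => pad a i * pad b i) ^ j) x) := by
    intro a b j x
    rw [hc, ← map_pow]
    simp
  refine ⟨Φ, Ψ, fun a b => ⟨fun h => ?_, fun h => ?_⟩⟩
  · rw [hp']
    refine OMC.isNo_of_orbits (by omega) (fun x => ?_) (fun x e he hel hx => ?_)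
    · obtain ⟨x, rfl⟩ := E.surjective x
      rw [hcp, layerPerm_pow_card _ ((hprod a b).trans h)]
    · obtain ⟨x, rfl⟩ := E.surjective x
      rw [hcp] at hx
      have := Nat.le_of_dvd he (dvd_of_layerPerm_pow_eq _ (E.injective hx))
      omega
  · have hmul : ∀ w, (layerPerm (fun i => pad a i * pad b i) ^ ((p + 1) * w)) (0, 0) =
        (0, ((finRotate (m + 1)) ^ w) 0) := by
      intro w
      rw [layerPerm_pow_mul_zero, hprod, h, inv_inv]
    refine OMC.isYes_of_orbit (l := (p + 1) * (m + 1)) (x := E (0, 0)) (by nlinarith) hn2 ?_ ?_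
    · rw [hcp, hmul]
      congr 2
      ext
      rw [finRotate_pow_zero]
      simp
    · intro e he hel hx
      rw [hcp] at hx
      have hx := E.injective hx
      obtain ⟨w, rfl⟩ := dvd_of_layerPerm_pow_eq _ hx
      rw [hmul] at hx
      have h2 := congrArg (fun y => (y.2 : ℕ)) hx
      simp only [finRotate_pow_zero, Fin.val_zero] at h2
      have hw : w < m + 1 := lt_of_mul_lt_mul_left hel (Nat.zero_le _)
      rw [Nat.mod_eq_of_lt hw] at h2
      simp [h2] at he

end Layers

/-! ### From protocols to messages in a fixed alphabet -/

/-- The bit strings of length at most `c`, with redundancy. -/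
abbrev ShortMsg (c : ℕ) : Type := Fin (c + 1) × (Fin c → Bool)

namespace ShortMsg

variable {c : ℕ}

/-- The bit string that is represented. -/
def decode (μ : ShortMsg c) : List Bool := (List.ofFn μ.2).take μ.1

/-- A representation of a bit string, truncated to length `c`. -/
def encode (c : ℕ) (L : List Bool) : ShortMsg c :=
  (Fin.ofNat (c + 1) L.length, fun i => L.getD i false)

lemma decode_encode {L : List Bool} (h : L.length ≤ c) : decode (encode c L) = L := by
  have h1 : ((Fin.ofNat (c + 1) L.length : Fin (c + 1)) : ℕ) = L.length := by
    simpa [Fin.ofNat] using Nat.mod_eq_of_lt (Nat.lt_succ_of_le h)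
  apply List.ext_getElem
  · simp [decode, encode, Nat.mod_eq_of_lt (Nat.lt_succ_of_le h), h]
  · intro i hi hi'
    simp [decode, encode, hi']

lemma card_eq (c : ℕ) : Fintype.card (ShortMsg c) = (c + 1) * 2 ^ c := by
  simp [ShortMsg]

end ShortMsg

namespace DetProtocol

variable {X Y : Type} {r : ℕ} (p : DetProtocol X Y r)

/-- The output after `s` more rounds, starting in round `i` with the history `t`, if all further
messages are truncated. -/
def truncOutput (c : ℕ) (x : X) (y : Y) : ℕ → ℕ → List (List Bool) → Bool
  | 0, i, t => if Even i then p.aliceOut x t else p.bobOut y t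
  | s + 1, i, t => truncOutput c x y s (i + 1)
      (t ++ [(ShortMsg.encode c (if Even i then p.aliceMsg x t else p.bobMsg y t)).decode])

/-- The cost bounds messages only on inputs satisfying the promise, whereas `IsProt` needs one
finite alphabet on all inputs; hence the truncation. The parity of i says who speaks next, so both
orders are treated together. -/
lemma isProt_truncOutput (c s i : ℕ) (t : List (List Bool)) :
    (Even i → IsProt (ShortMsg c) s
      fun x y => if p.truncOutput c x y s i t = true then (1 : ℝ) else 0) ∧
    (¬Even i → IsProt (ShortMsg c) s
      fun y x => if p.truncOutput c x y s i t = true then (1 : ℝ) else 0) := by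
  induction s generalizing i t with
  | zero =>
    refine ⟨fun hi => ⟨fun x => if p.aliceOut x t = true then 1 else 0, fun x => ?_, fun x y => ?_⟩,
      fun hi => ⟨fun y => if p.bobOut y t = true then 1 else 0, fun x => ?_, fun x y => ?_⟩⟩
    · dsimp only; split_ifs <;> simp
    · simp [truncOutput, hi]
    · dsimp only; split_ifs <;> simp
    · simp [truncOutput, hi]
  | succ s ih =>
    refine ⟨fun hi => ⟨fun x => ShortMsg.encode c (p.aliceMsg x t), fun τ y x =>
        if p.truncOutput c x y s (i + 1) (t ++ [τ.decode]) = true then 1 else 0,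
        fun τ => (ih (i + 1) _).2 (by simpa [Nat.even_add_one] using hi), fun x y => ?_⟩,
      fun hi => ⟨fun y => ShortMsg.encode c (p.bobMsg y t), fun τ x y =>
        if p.truncOutput c x y s (i + 1) (t ++ [τ.decode]) = true then 1 else 0,
        fun τ => (ih (i + 1) _).1 (by simpa [Nat.even_add_one] using hi), fun x y => ?_⟩⟩
    · simp only [truncOutput, hi, if_true]
    · simp only [truncOutput, hi, if_false]

lemma length_message_le_bits {x : X} {y : Y} {i : ℕ} (hi : i < r) :
    (if Even i then p.aliceMsg x (p.transcript x y i)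
      else p.bobMsg y (p.transcript x y i)).length ≤ p.bits x y := by
  have hmono : Monotone fun i => ((p.transcript x y i).map List.length).sum :=
    monotone_nat_of_le_succ fun i => by simp [transcript]
  refine le_trans ?_ (hmono (Nat.succ_le_of_lt hi))
  simp [transcript]

lemma truncOutput_eq_output {c : ℕ} {x : X} {y : Y} (hc : p.bits x y ≤ c) :
    p.truncOutput c x y r 0 [] = p.output x y := by
  have key : ∀ s i, i + s = r →
      p.truncOutput c x y s i (p.transcript x y i) = p.output x y := by
    intro s
    induction s with
    | zero =>
      rintro i rfl
      simp [truncOutput, output]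
    | succ s ih =>
      intro i hi
      rw [truncOutput, ShortMsg.decode_encode
        ((p.length_message_le_bits (by omega)).trans hc)]
      exact ih (i + 1) (by omega)
  exact key r 0 (by omega)

lemma transcript_of_bits_eq_zero {x : X} {y : Y} (h : p.bits x y = 0) {i : ℕ} (hi : i ≤ r) :
    p.transcript x y i = List.replicate i [] := by
  induction i with
  | zero => rfl
  | succ i ih =>
    have h1 := p.length_message_le_bits (x := x) (y := y) (i := i) hi
    rw [h, Nat.le_zero, List.length_eq_zero_iff] at h1
    rw [transcript, h1, ih (by omega), List.replicate_succ']

end DetProtocol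

/-! ### Averaging over the random string -/

namespace RandProtocol

variable {X Y : Type} {r : ℕ} (π : RandProtocol.{u} X Y r)

lemma prob_false (x : X) (y : Y) : π.prob x y false = 1 - π.prob x y true := by
  have := π.isProb
  let _ := π.mΩ
  have h1 : {ω | (π.det ω).output x y = false} = {ω | (π.det ω).output x y = true}ᶜ := by
    ext ω; simp
  rw [prob, prob, h1]
  exact MeasureTheory.probReal_compl_eq_one_sub (π.measurable_output x y)

lemma bits_le_of_cost_eq {P : X → Y → Prop} {c : ℕ} (h : π.cost P = c) {x : X} {y : Y}
    (hxy : P x y) (ω : π.Ω) : (π.det ω).bits x y ≤ c := by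
  have h1 : (((π.det ω).bits x y : ℕ) : ℕ∞) ≤ π.cost P := by
    rw [cost]
    exact le_iSup_of_le x (le_iSup_of_le y (le_iSup_of_le hxy (le_iSup_of_le ω le_rfl)))
  rw [h] at h1
  exact_mod_cast h1

/-- A linear bound that holds for every random string holds for the probabilities. -/
lemma sum_mul_prob_le {ι : Type*} [Fintype ι] (x : ι → X) (y : ι → Y) (w : ι → ℝ) {C : ℝ}
    (h : ∀ ω, ∑ i, w i * (if (π.det ω).output (x i) (y i) = true then 1 else 0) ≤ C) :
    ∑ i, w i * π.prob (x i) (y i) true ≤ C := by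
  have := π.isProb
  let _ := π.mΩ
  have hind : ∀ i, (fun ω => if (π.det ω).output (x i) (y i) = true then (1 : ℝ) else 0) =
      Set.indicator {ω | (π.det ω).output (x i) (y i) = true} 1 := by
    intro i
    funext ω
    by_cases hω : (π.det ω).output (x i) (y i) = true <;> simp [hω]
  have hintg : ∀ i, MeasureTheory.Integrable
      (fun ω => if (π.det ω).output (x i) (y i) = true then (1 : ℝ) else 0) π.μ := by
    intro i
    rw [hind]
    exact (MeasureTheory.integrable_const (1 : ℝ)).indicator (π.measurable_output _ _)
  have hval : ∀ i, ∫ ω, (if (π.det ω).output (x i) (y i) = true then (1 : ℝ) else 0) ∂π.μ =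
      π.prob (x i) (y i) true := by
    intro i
    rw [hind, MeasureTheory.integral_indicator_one (π.measurable_output _ _)]
    rfl
  have hle := MeasureTheory.integral_mono (μ := π.μ)
    (MeasureTheory.integrable_finsetSum univ fun i _ => (hintg i).const_mul (w i))
    (MeasureTheory.integrable_const C) h
  rw [MeasureTheory.integral_finsetSum _ fun i _ => (hintg i).const_mul (w i)] at hle
  simp only [MeasureTheory.integral_const_mul, hval] at hle
  simpa using hle

end RandProtocol

/-! ### Bounding the advantage of a protocol -/

section Advantage

lemma card_mul_condSum_const {G : Type} [Group G] [Fintype G] [DecidableEq G] {N : ℕ} (hN : 0 < N)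
    (g : G) (δ : ℝ) :
    Fintype.card G * condSum g (fun _ _ : Fin N → G => δ) =
      δ * (Fintype.card (Fin N → G) : ℝ) ^ 2 := by
  have h1 := fun b : Fin N → G => card_mul_sum_altProd_eq hN b g
  have h2 : condSum g (fun _ _ : Fin N → G => δ) =
      ∑ b : Fin N → G, δ * ∑ a : Fin N → G, if altProd a b = g then (1 : ℝ) else 0 := by
    rw [condSum, sum_comm]
    simp only [mul_sum, mul_ite, mul_one, mul_zero]
  rw [h2, mul_sum, sum_congr rfl fun b _ => (by rw [mul_left_comm, h1] :
    (Fintype.card G : ℝ) * (δ * ∑ a : Fin N → G, if altProd a b = g then (1 : ℝ) else 0) =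
      δ * (Fintype.card G : ℝ) ^ N), sum_const, nsmul_eq_mul]
  simp
  ring

lemma coe_altProd {G : Type} [Group G] (S : Subgroup G) {N : ℕ} (a b : Fin N → S) :
    ((altProd a b : S) : G) = altProd (fun i => (a i : G)) fun i => (b i : G) := by
  have := map_list_prod S.subtype (List.ofFn fun i => a i * b i)
  rw [List.map_ofFn] at this
  exact this

/-- The advantage of a protocol of cost `c` in telling two values of an encoded interleaved product
apart. -/
lemma two_mul_advantage_le {X Y G : Type} [Group G] [Fintype G] [DecidableEq G]
    {m q r c l t N : ℕ} {η δ : ℝ}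
    (hG : ∀ g : G, ∃ L : List G, L.length ≤ m ∧ (∀ x ∈ L, IsCubeShift t x) ∧ L.prod = g)
    (hq : 0 < q) (hN : N = (q + q) ^ r) (hl : 0 < l) (hη : 0 ≤ η)
    (hX : (t : ℝ) * (12 * l / t : ℝ) ^ q ≤ 1)
    (hηX : (t : ℝ) * (t * (12 * l / t : ℝ) ^ q) ≤ η ^ 2) (π : RandProtocol.{u} X Y r)
    {P : X → Y → Prop} (hc : π.cost P = c) (A : (Fin N → G) → X) (B : (Fin N → G) → Y) (g g' : G)
    (hg : ∀ a b, altProd a b = g → P (A a) (B b) ∧ 1 / 2 + δ ≤ π.prob (A a) (B b) true)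
    (hg' : ∀ a b, altProd a b = g' → P (A a) (B b) ∧ π.prob (A a) (B b) true ≤ 1 / 2 - δ) :
    2 * δ ≤ (q + q : ℝ) ^ r * (m * (2 * ((c + 1) * 2 ^ c) / 2 ^ (q * l) + 2 * η)) := by
  have hN0 : 0 < N := by rw [hN]; positivity
  set C : ℝ := ((q + q : ℝ) ^ r * (m * (2 * ((c + 1) * 2 ^ c) / 2 ^ (q * l) + 2 * η))) *
    (Fintype.card (Fin N → G) : ℝ) ^ 2 with hC
  -- For each random string the deterministic bound applies. On the fibres of g and g' the promise
  -- holds, so nothing is truncated there.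
  have hω : ∀ ω, ∑ i : (Fin N → G) × (Fin N → G), (Fintype.card G *
      ((if altProd i.1 i.2 = g then 1 else 0) - (if altProd i.1 i.2 = g' then 1 else 0)) : ℝ) *
        (if (π.det ω).output (A i.1) (B i.2) = true then 1 else 0) ≤ C := by
    intro ω
    have h1 := condSum_sub_le hq hG hl hη hX hηX r hN
      (fun a b => if (π.det ω).truncOutput c (A a) (B b) r 0 [] = true then (1 : ℝ) else 0)
      ((((π.det ω).isProt_truncOutput c r 0 []).1 Even.zero).comp A B) g g'
    have h2 : ∀ g, (∀ a b, altProd a b = g → P (A a) (B b)) →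
        condSum g (fun a b => if (π.det ω).truncOutput c (A a) (B b) r 0 [] = true then (1 : ℝ)
          else 0) = ∑ i : (Fin N → G) × (Fin N → G), (if altProd i.1 i.2 = g then 1 else 0) *
            (if (π.det ω).output (A i.1) (B i.2) = true then 1 else 0) := by
      intro g hg
      rw [condSum, Fintype.sum_prod_type]
      refine sum_congr rfl fun a _ => sum_congr rfl fun b _ => ?_
      by_cases h : altProd a b = g
      · rw [if_pos h, if_pos h, one_mul, (π.det ω).truncOutput_eq_output
          (π.bits_le_of_cost_eq hc (hg a b h) ω)]
      · rw [if_neg h, if_neg h, zero_mul]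
    rw [h2 g fun a b h => (hg a b h).1, h2 g' fun a b h => (hg' a b h).1,
      ← sum_sub_distrib, mul_sum, ShortMsg.card_eq] at h1
    push_cast at h1
    refine le_trans (le_of_eq (sum_congr rfl fun i _ => ?_)) h1
    ring
  have hprob := π.sum_mul_prob_le (fun i : (Fin N → G) × (Fin N → G) => A i.1) (fun i => B i.2)
    _ hω
  have hlow : Fintype.card G * condSum g (fun _ _ : Fin N → G => 1 / 2 + δ) -
      Fintype.card G * condSum g' (fun _ _ : Fin N → G => 1 / 2 - δ) ≤ C := by
    refine le_trans ?_ hprob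
    rw [← mul_sub, condSum, condSum, ← Fintype.sum_prod_type', ← Fintype.sum_prod_type',
      ← sum_sub_distrib, mul_sum]
    refine sum_le_sum fun i _ => ?_
    rw [mul_assoc]
    refine mul_le_mul_of_nonneg_left ?_ (Nat.cast_nonneg _)
    rw [sub_mul]
    refine sub_le_sub ?_ ?_
    · split_ifs with h
      · rw [one_mul]
        exact (hg _ _ h).2
      · simp
    · split_ifs with h
      · rw [one_mul]
        exact (hg' _ _ h).2
      · simp
  rw [card_mul_condSum_const hN0, card_mul_condSum_const hN0, ← sub_mul, hC] at hlow
  have hpos : (0 : ℝ) < (Fintype.card (Fin N → G) : ℝ) ^ 2 := by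
    have : 0 < Fintype.card (Fin N → G) := Fintype.card_pos
    positivity
  have := le_of_mul_le_mul_right hlow hpos
  linarith

open OMC in
/-- The advantage of a protocol of cost `c` for the cycle problem. -/
lemma two_mul_advantage_le_of_solves {m p q r c l t : ℕ} {η δ : ℝ} (hp : 2 ≤ p) (hm : Odd m)
    (hm' : 10 ≤ m) (ht : 2 ≤ t) (htm : t * 4 ≤ m) {n : ℕ} (hn : n = m * (2 * p)) (hq : 0 < q)
    (hqp : (q + q) ^ r ≤ p) (hl : 0 < l) (hη : 0 ≤ η) (hX : (t : ℝ) * (12 * l / t : ℝ) ^ q ≤ 1)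
    (hηX : (t : ℝ) * (t * (12 * l / t : ℝ) ^ q) ≤ η ^ 2)
    (π : RandProtocol.{u} (Matching n) (Matching n) r) (hπ : Solves (2 * p) π (1 / 2 + δ))
    (hc : π.cost (Promise n (2 * p)) = c) :
    2 * δ ≤ (q + q : ℝ) ^ r * (m * (2 * ((c + 1) * 2 ^ c) / 2 ^ (q * l) + 2 * η)) := by
  obtain ⟨Φ, Ψ, hΦΨ⟩ := exists_matchings_of_altProd hp (by omega) hn hqp
  -- Odd m makes the m-cycle even, so that the sign does not separate the two cases.
  have hrot : (finRotate m)⁻¹ ∈ alternatingGroup (Fin m) := by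
    rw [inv_mem_iff, Equiv.Perm.mem_alternatingGroup, sign_finRotate]
    exact (hm.tsub_odd odd_one).neg_one_pow
  refine two_mul_advantage_le (G := alternatingGroup (Fin m)) (fun g => ?_) hq rfl hl hη hX hηX π hc
    (fun a => Φ fun i => (a i : Equiv.Perm (Fin m)))
    (fun b => Ψ fun i => (b i : Equiv.Perm (Fin m)))
    ⟨_, hrot⟩ 1 (fun a b h => ?_) (fun a b h => ?_)
  · have := exists_list_cubeShift ht (by simpa using htm) (by simpa using hm') g
    rwa [Fintype.card_fin] at this
  · have hy := (hΦΨ _ _).2 ((coe_altProd _ a b).symm.trans (congrArg Subtype.val h))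
    exact ⟨Or.inl hy, (hπ _ _).1 hy⟩
  · have hn := (hΦΨ _ _).1 ((coe_altProd _ a b).symm.trans (congrArg Subtype.val h))
    refine ⟨Or.inr hn, ?_⟩
    have h3 := (hπ _ _).2 hn
    rw [π.prob_false] at h3
    linarith

open OMC in
/-- A protocol without communication has no advantage. -/
lemma cost_ne_zero {m p r : ℕ} {δ : ℝ} (hp : 2 ≤ p) (hm : 0 < m) {n : ℕ} (hn : n = m * (2 * p))
    (hδ : 0 < δ) (π : RandProtocol.{u} (Matching n) (Matching n) r)
    (hπ : Solves (2 * p) π (1 / 2 + δ)) : π.cost (Promise n (2 * p)) ≠ 0 := by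
  intro hc
  obtain ⟨Φ, Ψ, hΦΨ⟩ := exists_matchings_of_altProd (N := 1) hp hm hn (by omega)
  set γ : Fin 1 → Equiv.Perm (Fin m) := fun _ => (finRotate m)⁻¹ with hγ
  have hno : IsNo (2 * p) (Φ 1) (Ψ 1) := (hΦΨ 1 1).1 (by simp [altProd])
  have hyesA : IsYes (Φ γ) (Ψ 1) := (hΦΨ γ 1).2 (by simp [altProd, hγ])
  have hyesB : IsYes (Φ 1) (Ψ γ) := (hΦΨ 1 γ).2 (by simp [altProd, hγ])
  have htr : ∀ x y, Promise n (2 * p) x y → ∀ ω, (π.det ω).transcript x y r =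
      List.replicate r [] := fun x y hxy ω =>
    (π.det ω).transcript_of_bits_eq_zero
      (Nat.le_zero.1 (π.bits_le_of_cost_eq (c := 0) hc hxy ω)) le_rfl
  have key : ∀ x y, IsYes x y → (∀ ω, (π.det ω).output x y = (π.det ω).output (Φ 1) (Ψ 1)) →
      False := by
    intro x y hxy h
    have h1 := (hπ x y).1 hxy
    have h2 := (hπ _ _).2 hno
    rw [π.prob_false] at h2
    have h3 : π.prob x y true = π.prob (Φ 1) (Ψ 1) true := by
      simp only [RandProtocol.prob, h]
    linarith
  -- Without communication the output depends only on the input of the player who announces it.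
  -- Changing the other player's input alone turns the No instance into a Yes instance.
  by_cases hr : Even r
  · refine key _ _ hyesB fun ω => ?_
    simp only [DetProtocol.output, hr, if_true]
    rw [htr _ _ (Or.inl hyesB), htr _ _ (Or.inr hno)]
  · refine key _ _ hyesA fun ω => ?_
    simp only [DetProtocol.output, hr, if_false]
    rw [htr _ _ (Or.inl hyesA), htr _ _ (Or.inr hno)]

end Advantage

/-! ### Choice of parameters -/

section Parameters

lemma add_one_mul_two_pow_le_exp (c : ℕ) : ((c : ℝ) + 1) * 2 ^ c ≤ Real.exp (2 * c) := by
  have h1 : (c : ℝ) + 1 ≤ Real.exp c := Real.add_one_le_exp _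
  have h2 : (2 : ℝ) ^ c ≤ Real.exp c := by
    rw [← Real.exp_one_pow]
    have := Real.add_one_le_exp 1
    gcongr
    linarith
  calc ((c : ℝ) + 1) * 2 ^ c ≤ Real.exp c * Real.exp c := by gcongr
    _ = _ := by rw [← Real.exp_add]; ring_nf

/-- The contribution of the number of messages to the advantage is small. -/
lemma message_term_lt {m c r q l : ℕ} {s x : ℝ} (hm : 0 < m) (hr : 1 ≤ r) (hc : 1 ≤ c)
    (hs : 10 ^ 4 < s) (hx : s * x = Real.log m) (hx0 : 0 ≤ x) (hq : s / 6 ≤ q)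
    (hqs : (q + q : ℝ) ≤ s) (hl : (c : ℝ) * 64 ^ r * Real.exp x ≤ l) :
    (q + q : ℝ) ^ r * (m * (2 * ((c + 1) * 2 ^ c) / 2 ^ (q * l))) < 1 / m ^ 2 := by
  have hm' : (0 : ℝ) < m := by exact_mod_cast hm
  have hr' : (1 : ℝ) ≤ r := by exact_mod_cast hr
  have hc' : (1 : ℝ) ≤ c := by exact_mod_cast hc
  have hme : (m : ℝ) = Real.exp (s * x) := by rw [hx, Real.exp_log hm']
  have hs0 : 0 < s := by linarith
  have h64 : 63 * (r : ℝ) ≤ 64 ^ r := by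
    have h1 := one_add_mul_le_pow (a := (63 : ℝ)) (by norm_num) r
    norm_num at h1
    linarith
  -- Here 0.69 · 63 / 6 > 7. The exponent 7rc(s + sx) beats (2q)^r ≤ e^(rs), m³ = e^(3sx) and
  -- 2(c+1)2^c ≤ e^(1+2c) together.
  have hql : 7 * (r * c * (s + s * x)) ≤ Real.log 2 * (q * l : ℕ) := by
    have h1 : 1 + x ≤ Real.exp x := by linarith [Real.add_one_le_exp x]
    have h2 : (c : ℝ) * (63 * r) * (1 + x) ≤ l := by
      refine le_trans ?_ hl
      gcongr
    have h3 : s / 6 * ((c : ℝ) * (63 * r) * (1 + x)) ≤ (q : ℝ) * l := by gcongr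
    have h4 : 0.69 ≤ Real.log 2 := by linarith [Real.log_two_gt_d9]
    have h5 : 0.69 * (s / 6 * ((c : ℝ) * (63 * r) * (1 + x))) ≤ Real.log 2 * ((q : ℝ) * l) := by
      gcongr
    push_cast
    refine le_trans ?_ h5
    have h6 : 0 ≤ (r : ℝ) * c * (s + s * x) := by positivity
    nlinarith
  have h2ql : Real.exp (7 * (r * c * (s + s * x))) ≤ 2 ^ (q * l) := by
    have : (2 : ℝ) ^ (q * l) = Real.exp (Real.log 2 * (q * l : ℕ)) := by
      rw [mul_comm (Real.log 2), Real.exp_nat_mul, Real.exp_log (by norm_num)]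
    rw [this]
    exact Real.exp_le_exp.2 hql
  have hqr : (q + q : ℝ) ^ r ≤ Real.exp (r * s) := by
    rw [Real.exp_nat_mul]
    gcongr
    linarith [Real.add_one_le_exp s]
  have hcc := add_one_mul_two_pow_le_exp c
  have h2e : (2 : ℝ) ≤ Real.exp 1 := by linarith [Real.add_one_le_exp 1]
  rw [lt_div_iff₀ (by positivity)]
  calc (q + q : ℝ) ^ r * (m * (2 * ((c + 1) * 2 ^ c) / 2 ^ (q * l))) * m ^ 2
      ≤ Real.exp (r * s) * (m * (Real.exp 1 * Real.exp (2 * c) /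
          Real.exp (7 * (r * c * (s + s * x))))) * m ^ 2 := by gcongr
    _ = Real.exp (r * s + (s * x + (1 + 2 * c - 7 * (r * c * (s + s * x)))) + 2 * (s * x)) := by
        rw [hme, ← Real.exp_add, ← Real.exp_sub, ← Real.exp_add, ← Real.exp_add,
          ← Real.exp_nat_mul, ← Real.exp_add]
        norm_num
    _ < 1 := by
        rw [Real.exp_lt_one_iff]
        have h1 : (r : ℝ) * s ≤ r * c * s := by nlinarith [mul_pos (show (0:ℝ) < r by linarith) hs0]
        have h2 : (c : ℝ) * 1 ≤ r * c * s := by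
          have : (c : ℝ) * 1 ≤ c * (r * s) := by gcongr; nlinarith
          linarith
        have h3 : 1 * (s * x) ≤ (r * c) * (s * x) := by gcongr; nlinarith
        nlinarith

/-- The contribution of the low Fourier levels to the advantage is small. -/
lemma mixing_term_lt {m r q : ℕ} {s x Y : ℝ} (hm : 0 < m) (hr : 1 ≤ r) (hs : 10 ^ 4 < s)
    (hx : s * x = Real.log m) (hx0 : 0 ≤ x) (hq : s / 6 ≤ q) (hqs : (q + q : ℝ) ≤ s)
    (hY0 : 0 ≤ Y) (hY : Y ≤ Real.exp (-(24 * r + 100 * x))) :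
    ((q + q : ℝ) ^ r) ^ 2 * (4 * ((m : ℝ) ^ 8 * Y ^ q)) < 1 := by
  have hm' : (0 : ℝ) < m := by exact_mod_cast hm
  have hr' : (1 : ℝ) ≤ r := by exact_mod_cast hr
  have hme : (m : ℝ) = Real.exp (s * x) := by rw [hx, Real.exp_log hm']
  have hs0 : 0 < s := by linarith
  -- As q ≥ s/6, the exponents 24r and 100x become at least 4rs and 16sx, enough against (2q)^(2r) ≤
  -- e^(2rs), m⁸ = e^(8sx) and 4 ≤ e³.
  have hYq : Y ^ q ≤ Real.exp (-(4 * (r * s) + 16 * (s * x))) := by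
    calc Y ^ q ≤ Real.exp (-(24 * r + 100 * x)) ^ q := by gcongr
      _ = Real.exp (-(q * (24 * r + 100 * x))) := by rw [← Real.exp_nat_mul]; ring_nf
      _ ≤ _ := by
        rw [Real.exp_le_exp, neg_le_neg_iff]
        have h1 : s / 6 * (24 * r + 100 * x) ≤ q * (24 * r + 100 * x) := by gcongr
        nlinarith [mul_nonneg hs0.le hx0]
  have hqr : (q + q : ℝ) ^ r ≤ Real.exp (r * s) := by
    rw [Real.exp_nat_mul]
    gcongr
    linarith [Real.add_one_le_exp s]
  have h4 : (4 : ℝ) ≤ Real.exp 3 := by linarith [Real.add_one_le_exp 3]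
  calc ((q + q : ℝ) ^ r) ^ 2 * (4 * ((m : ℝ) ^ 8 * Y ^ q))
      ≤ Real.exp (r * s) ^ 2 * (Real.exp 3 * ((m : ℝ) ^ 8 *
          Real.exp (-(4 * (r * s) + 16 * (s * x))))) := by gcongr
    _ = Real.exp (2 * (r * s) + (3 + (8 * (s * x) + -(4 * (r * s) + 16 * (s * x))))) := by
        rw [hme, ← Real.exp_nat_mul, ← Real.exp_nat_mul, ← Real.exp_add, ← Real.exp_add,
          ← Real.exp_add]
        norm_num
    _ < 1 := by
        rw [Real.exp_lt_one_iff]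
        have h1 : 10 ^ 4 ≤ (r : ℝ) * s := by nlinarith
        nlinarith [mul_nonneg hs0.le hx0]

/-- Parameters for which the bound on the advantage is too small. -/
lemma exists_parameters {m k r c : ℕ} (hr : 1 ≤ r) (hc : 1 ≤ c) (hk : 4 ≤ k)
    (h : (c : ℝ) < (2 : ℝ) ^ (-(50 * r : ℝ)) *
      (m : ℝ) ^ (1 - 10 ^ 4 * (k : ℝ) ^ (-(1 / (r : ℝ))))) :
    20 ≤ m ∧ ∃ (q l : ℕ) (η : ℝ), 0 < q ∧ 0 < l ∧ 0 ≤ η ∧ 2 * (q + q) ^ r ≤ k ∧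
      ((m / 4 : ℕ) : ℝ) * (12 * l / (m / 4 : ℕ) : ℝ) ^ q ≤ 1 ∧
      ((m / 4 : ℕ) : ℝ) * ((m / 4 : ℕ) * (12 * l / (m / 4 : ℕ) : ℝ) ^ q) ≤ η ^ 2 ∧
      (q + q : ℝ) ^ r * (m * (2 * ((c + 1) * 2 ^ c) / 2 ^ (q * l) + 2 * η)) < 2 / m ^ 2 := by
  have hr' : (1 : ℝ) ≤ r := by exact_mod_cast hr
  have hc' : (1 : ℝ) ≤ c := by exact_mod_cast hc
  have hk' : (4 : ℝ) ≤ k := by exact_mod_cast hk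
  have hk0 : (0 : ℝ) < k := by linarith
  obtain ⟨s, hs⟩ : ∃ s : ℝ, s = (k : ℝ) ^ (1 / (r : ℝ)) := ⟨_, rfl⟩
  have hs0 : 0 < s := by rw [hs]; positivity
  have hsr : s ^ r = k := by
    rw [hs, one_div, Real.rpow_inv_natCast_pow hk0.le (by omega)]
  have hexp : (k : ℝ) ^ (-(1 / (r : ℝ))) = 1 / s := by
    rw [Real.rpow_neg hk0.le, hs, ← one_div]
  rw [hexp] at h
  have h2r : (2 : ℝ) ^ (-(50 * r : ℝ)) ≤ Real.exp (-(34 * r)) := by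
    rw [Real.rpow_def_of_pos (by norm_num), Real.exp_le_exp]
    have := Real.log_two_gt_d9
    nlinarith
  have hm0 : 0 < m := by
    rcases Nat.eq_zero_or_pos m with rfl | hm
    · exfalso
      have h1 : ((0 : ℕ) : ℝ) ^ (1 - 10 ^ 4 * (1 / s)) ≤ 1 := by
        rw [Nat.cast_zero]; exact Real.zero_rpow_le_one _
      have h2 : Real.exp (-(34 * (r : ℝ))) ≤ 1 := Real.exp_le_one_iff.2 (by linarith)
      have : (2 : ℝ) ^ (-(50 * r : ℝ)) * ((0 : ℕ) : ℝ) ^ (1 - 10 ^ 4 * (1 / s)) ≤ 1 * 1 := by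
        refine mul_le_mul (h2r.trans h2) h1 (Real.rpow_nonneg (by simp) _) zero_le_one
      linarith
    · exact hm
  have hm' : (1 : ℝ) ≤ m := by exact_mod_cast hm0
  -- This makes e^x = m^(1/s), so the assumed bound on c becomes m·e^(-10⁴x) up to the factor
  -- exponential in r.
  obtain ⟨x, hx⟩ : ∃ x : ℝ, x = Real.log m / s := ⟨_, rfl⟩
  have hlog0 : 0 ≤ Real.log m := Real.log_nonneg hm'
  have hx0 : 0 ≤ x := by rw [hx]; positivity
  have hsx : s * x = Real.log m := by rw [hx]; field_simp
  have hme : (m : ℝ) = Real.exp (s * x) := by rw [hsx, Real.exp_log (by linarith)]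
  have hcm : (c : ℝ) < Real.exp (-(34 * r)) * (m * Real.exp (-(10 ^ 4 * x))) := by
    refine lt_of_lt_of_le h ?_
    have : (m : ℝ) ^ (1 - 10 ^ 4 * (1 / s)) = m * Real.exp (-(10 ^ 4 * x)) := by
      rw [Real.rpow_def_of_pos (by linarith), ← hsx]
      conv_rhs => rw [hme, ← Real.exp_add]
      congr 1
      field_simp
      ring
    rw [this]
    gcongr
  have hcm' : (c : ℝ) < Real.exp (-(34 * r) + (s * x - 10 ^ 4 * x)) := by
    rw [Real.exp_add, Real.exp_sub, ← hme, div_eq_mul_inv, ← Real.exp_neg]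
    exact hcm
  -- As c ≥ 1, the bound on c exceeds 1. This alone forces s > 10⁴ and log m > 34r, so all
  -- parameters are large.
  have hpos : 0 < -(34 * (r : ℝ)) + (s * x - 10 ^ 4 * x) := by
    rw [← Real.exp_lt_exp, Real.exp_zero]
    linarith
  have hs4 : 10 ^ 4 < s := by
    by_contra hcon
    push Not at hcon
    have := mul_le_mul_of_nonneg_right hcon hx0
    linarith
  have hm20' : (20 : ℝ) ≤ m := by
    rw [hme]
    have := Real.add_one_le_exp (s * x)
    have : 0 ≤ 10 ^ 4 * x := by positivity
    linarith
  have hm20 : 20 ≤ m := by exact_mod_cast hm20'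
  refine ⟨hm20, ?_⟩
  obtain ⟨t, ht⟩ : ∃ t : ℝ, t = ((m / 4 : ℕ) : ℝ) := ⟨_, rfl⟩
  rw [← ht]
  have htm : t ≤ m := by rw [ht]; exact_mod_cast Nat.div_le_self _ _
  have hmt : (m : ℝ) / 5 ≤ t := by
    have h1 : m ≤ 5 * (m / 4) := by omega
    have h2 : (m : ℝ) ≤ 5 * ((m / 4 : ℕ) : ℝ) := by exact_mod_cast h1
    rw [ht]; linarith
  have ht1 : 1 ≤ t := by linarith
  -- With 2q ≤ s/2 one gets 2(2q)^r ≤ 2^r (s/2)^r = k, and rounding down keeps q ≥ s/6 since s is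
  -- large.
  set q := ⌊s / 4⌋₊ with hqdef
  have hq1 : (q : ℝ) ≤ s / 4 := Nat.floor_le (by positivity)
  have hq2 : s / 6 ≤ q := by
    have := Nat.lt_floor_add_one (s / 4)
    rw [← hqdef] at this
    linarith
  have hq0 : 0 < q := by
    have : (0 : ℝ) < q := by linarith
    exact_mod_cast this
  -- Chosen so that 2^(ql) outweighs the number of messages and all polynomial factors: 64^r
  -- supplies the factor r, and e^x ≥ 1 + x supplies both s and log m after multiplication by q.
  set l := ⌈(c : ℝ) * 64 ^ r * Real.exp x⌉₊ with hldef
  have hl1 : (c : ℝ) * 64 ^ r * Real.exp x ≤ l := Nat.le_ceil _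
  have hbig : 1 ≤ (c : ℝ) * 64 ^ r * Real.exp x := by
    have h1 : (1 : ℝ) ≤ 64 ^ r := one_le_pow₀ (by norm_num)
    have h2 : 1 ≤ Real.exp x := Real.one_le_exp hx0
    calc (1 : ℝ) = 1 * 1 * 1 := by norm_num
      _ ≤ _ := by gcongr
  have hl2 : (l : ℝ) ≤ 2 * (c * 64 ^ r * Real.exp x) := by
    have := Nat.ceil_lt_add_one (show 0 ≤ (c : ℝ) * 64 ^ r * Real.exp x by linarith)
    linarith
  have hl0 : 0 < l := by
    have : (0 : ℝ) < l := by linarith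
    exact_mod_cast this
  obtain ⟨Y, hY⟩ : ∃ Y : ℝ, Y = 12 * l / t := ⟨_, rfl⟩
  have hY0 : 0 ≤ Y := by rw [hY]; positivity
  have h64 : (120 : ℝ) * 64 ^ r ≤ Real.exp (10 * r) := by
    have h1 : (120 : ℝ) ≤ 120 ^ r := le_self_pow₀ (by norm_num) (by omega)
    have h2 : (120 * 64 : ℝ) ≤ Real.exp 10 := by
      have h3 : Real.exp 10 = Real.exp 1 ^ 10 := by rw [← Real.exp_nat_mul]; norm_num
      rw [h3]
      calc (120 * 64 : ℝ) ≤ 2.7 ^ 10 := by norm_num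
        _ ≤ _ := by
          have := Real.exp_one_gt_d9
          gcongr
          linarith
    calc (120 : ℝ) * 64 ^ r ≤ 120 ^ r * 64 ^ r := by gcongr
      _ = (120 * 64) ^ r := (mul_pow _ _ _).symm
      _ ≤ Real.exp 10 ^ r := by gcongr
      _ = _ := by rw [← Real.exp_nat_mul, mul_comm]
  have hYle : Y ≤ Real.exp (-(24 * r + 100 * x)) := by
    calc Y ≤ 12 * (2 * (c * 64 ^ r * Real.exp x)) / (m / 5) := by
          rw [hY]
          gcongr
      _ = (120 * 64 ^ r) * Real.exp x * c / m := by field_simp; ring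
      _ ≤ Real.exp (10 * r) * Real.exp x *
          (Real.exp (-(34 * r)) * (m * Real.exp (-(10 ^ 4 * x)))) / m := by
          gcongr
      _ = Real.exp (10 * r) * Real.exp x * (Real.exp (-(34 * r)) * Real.exp (-(10 ^ 4 * x))) := by
          field_simp
      _ = Real.exp (10 * r + x + (-(34 * r) + -(10 ^ 4 * x))) := by simp only [Real.exp_add]
      _ ≤ _ := by
          rw [Real.exp_le_exp]
          linarith
  have hqs : (q + q : ℝ) ≤ s := by linarith
  have hmsg := message_term_lt hm0 hr hc hs4 hsx hx0 hq2 hqs hl1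
  have hmix := mixing_term_lt hm0 hr hs4 hsx hx0 hq2 hqs hY0 hYle
  have hq1' : (1 : ℝ) ≤ q := by exact_mod_cast hq0
  have hQ1 : (1 : ℝ) ≤ (q + q : ℝ) ^ r := one_le_pow₀ (by linarith)
  have hYq0 : 0 ≤ Y ^ q := by positivity
  refine ⟨q, l, Real.sqrt (t * (t * Y ^ q)), hq0, hl0, Real.sqrt_nonneg _, ?_⟩
  rw [← hY]
  refine ⟨?_, ?_, ?_, ?_⟩
  · have h1 : (2 : ℝ) * (q + q) ^ r ≤ k := by
      have h2 : (2 : ℝ) ≤ 2 ^ r := le_self_pow₀ (by norm_num) (by omega)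
      calc (2 : ℝ) * (q + q) ^ r ≤ 2 ^ r * (s / 2) ^ r := by gcongr; linarith
        _ = k := by rw [← mul_pow, mul_div_cancel₀ _ (by norm_num), hsr]
    exact_mod_cast h1
  · calc t * Y ^ q ≤ (m : ℝ) ^ 8 * Y ^ q := by
          gcongr
          exact htm.trans (le_self_pow₀ hm' (by norm_num))
      _ ≤ 1 ^ 2 * (4 * ((m : ℝ) ^ 8 * Y ^ q)) := by
          have : 0 ≤ (m : ℝ) ^ 8 * Y ^ q := by positivity
          linarith
      _ ≤ ((q + q : ℝ) ^ r) ^ 2 * (4 * ((m : ℝ) ^ 8 * Y ^ q)) := by gcongr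
      _ ≤ 1 := hmix.le
  · rw [Real.sq_sqrt (by positivity)]
  · have h2 : (q + q : ℝ) ^ r * (m * (2 * Real.sqrt (t * (t * Y ^ q)))) < 1 / m ^ 2 := by
      rw [lt_div_iff₀ (by positivity)]
      refine lt_of_pow_lt_pow_left₀ 2 zero_le_one ?_
      calc ((q + q : ℝ) ^ r * (m * (2 * Real.sqrt (t * (t * Y ^ q)))) * m ^ 2) ^ 2
          = ((q + q : ℝ) ^ r) ^ 2 * (4 * ((m : ℝ) ^ 6 * (Real.sqrt (t * (t * Y ^ q))) ^ 2)) := by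
            ring
        _ = ((q + q : ℝ) ^ r) ^ 2 * (4 * ((m : ℝ) ^ 6 * t ^ 2 * Y ^ q)) := by
            rw [Real.sq_sqrt (by positivity)]; ring
        _ ≤ ((q + q : ℝ) ^ r) ^ 2 * (4 * ((m : ℝ) ^ 6 * m ^ 2 * Y ^ q)) := by gcongr
        _ = ((q + q : ℝ) ^ r) ^ 2 * (4 * ((m : ℝ) ^ 8 * Y ^ q)) := by ring
        _ < 1 := hmix
        _ = 1 ^ 2 := by norm_num
    rw [mul_add, mul_add]
    calc _ < 1 / (m : ℝ) ^ 2 + 1 / (m : ℝ) ^ 2 := add_lt_add hmsg h2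
      _ = _ := by ring

end Parameters

theorem theorem3p1 :
    ∃ K : ℝ, 0 < K ∧
      ∀ n k r : ℕ, Even k → 4 ≤ k → 0 < r → (∃ m : ℕ, Odd m ∧ n = m * k) →
        ∀ π : RandProtocol.{u} (OMC.Matching n) (OMC.Matching n) r,
          OMC.Solves k π (1 / 2 + ((k : ℝ) / n) ^ 2) →
            ENNReal.ofReal
                ((2 : ℝ) ^ (-(K * r)) *
                  ((n : ℝ) / k) ^ (1 - 10 ^ 4 * (k : ℝ) ^ (-(1 / (r : ℝ))))) ≤
              ((π.cost (OMC.Promise n k) : ℕ∞) : ENNReal) := by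
  -- 50 log 2 > 34 = 24 + 10: the part 10r absorbs 120·64^r in the bound on Y = 12l/t, and 24r is
  -- what the mixing term consumes.
  refine ⟨50, by norm_num, ?_⟩
  rintro n k r hk hk4 hr ⟨m, hm, hn⟩ π hπ
  obtain ⟨p, rfl⟩ := hk.two_dvd
  have hm0 : 0 < m := hm.pos
  have hm' : (0 : ℝ) < m := by exact_mod_cast hm0
  have hk' : (0 : ℝ) < (2 * p : ℕ) := by exact_mod_cast (show 0 < 2 * p by omega)
  have hnk : (n : ℝ) / (2 * p : ℕ) = m := by
    rw [hn, Nat.cast_mul, mul_div_assoc, div_self hk'.ne', mul_one]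
  have hkn : ((2 * p : ℕ) : ℝ) / n = 1 / m := by rw [← hnk, one_div_div]
  rw [hkn] at hπ
  rw [hnk]
  by_contra hlt
  rw [not_le] at hlt
  have hfin : π.cost (OMC.Promise n (2 * p)) ≠ ⊤ := by
    intro htop
    rw [htop] at hlt
    exact absurd hlt (by simp)
  obtain ⟨c, hc⟩ := ENat.ne_top_iff_exists.1 hfin
  rw [← hc] at hlt
  rw [ENat.toENNReal_coe, ENNReal.natCast_lt_ofReal] at hlt
  -- For c = 0 the assumed upper bound on c carries no information about the sizes of the
  -- parameters, so this case is excluded directly.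
  have hc1 : 1 ≤ c := by
    by_contra h0
    obtain rfl : c = 0 := by omega
    exact cost_ne_zero (by omega) hm0 hn (by positivity) π hπ hc.symm
  obtain ⟨hm20, q, l, η, hq, hl, hη, hqk, hX, hηX, hsmall⟩ := exists_parameters hr hc1 hk4 hlt
  have := two_mul_advantage_le_of_solves (t := m / 4) (by omega) hm (by omega) (by omega) (by omega)
    hn hq (by omega) hl hη hX hηX π hπ hc.symm
  rw [one_div_pow] at this
  exact absurd hsmall (not_lt.2 (le_trans (le_of_eq (by ring)) this))
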